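/- Let $(M,ds_M^2)$ be a non-empty closed (compact, boundaryless) smooth Riemannian manifold of dimension $m$, and let $\xi$ be a smooth Riemannian vector bundle of rank $n\ge 1$ over $M$ with fibre metric $\langle\cdot,\cdot\rangle$, total space $E$ and projection $\pi:E\to M$. Let $D$ be a smooth connection on $\xi$ compatible with $\langle\cdot,\cdot\rangle$, let $K_{(p,v)}:T_{(p,v)}E\to\xi_p$ be its connector (in a local frame $(e_\alpha)$ of $\xi$ with fibre coordinates $v_\alpha$ and $De_\alpha=\sum_\beta\omega_{\alpha\beta}e_\beta$, $K=\sum_\alpha\bigl(dv_\alpha+\sum_\beta v_\beta\,\pi^*\omega_{\beta\alpha}\bigr)\otimes e_\alpha$), and let $$ds_\xi^2(u,w)=ds_M^2(d\pi\,u,d\pi\,w)+\langle Ku,Kw\rangle$$ be the connection metric on $E$. For $r>0$ put $S_r(\xi)=\{(p,v)\in E:\langle v,v\rangle=r^2\}$. Then: (0) $ds_\xi^2$ is a smooth complete Riemannian metric on $E$, and $E$ is connected if $M$ is. (1) For every $r>0$, $S_r(\xi)$ is a smooth embedded hypersurface of $E$ (of dimension $m+n-1$), and it is an isoparametric hypersurface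 of $(E,ds_\xi^2)$: it is a non-empty regular level set of an isoparametric function, that is, of a non-constant smooth function $f:E\to\mathbb R$ such that $|\nabla f|^2=b(f)$ and $\Delta f=a(f)$ for some smooth $b:\mathbb R\to\mathbb R$ and continuous $a:\mathbb R\to\mathbb R$. With respect to the outward unit normal field $\eta$ (shape operator $u\mapsto-\nabla_u\eta$), its principal curvatures at every point are $0$ with multiplicity $m$ and $-1/r$ with multiplicity $n-1$. (2) If in addition $(M,ds_M^2)$ has positive Ricci curvature and $n\ge 3$, then there is $r_0>0$ such that for all $0<r<r_0$ the metric induced by $ds_\xi^2$ on $S_r(\xi)$ has positive Ricci curvature. -/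

import Mathlib

noncomputable section

/-! ### Local Riemannian geometry: metrics on (open subsets of) a vector space -/

section LocalGeometry

variable {W : Type*} [NormedAddCommGroup W] [NormedSpace ℝ W]

/-- The functional `w ↦ (∂_u g)(v, w) + (∂_v g)(u, w) - (∂_w g)(u, v)` at `y`, for a field `g` of
bilinear forms on `W`. -/
def koszulForm (g : W → W →L[ℝ] W →L[ℝ] ℝ) (y u v : W) : W →L[ℝ] ℝ :=
  fderiv ℝ g y u v + fderiv ℝ g y v u - ((fderiv ℝ g y).flip u).flip v

theorem koszulForm_apply (g : W → W →L[ℝ] W →L[ℝ] ℝ) (y u v w : W) :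
    koszulForm g y u v w =
      fderiv ℝ g y u v w + fderiv ℝ g y v u w - fderiv ℝ g y w u v := rfl

/-- The Christoffel symbols of the metric `g`, as a bilinear map `Γ_y : W × W → W`, determined by
`2 g(Γ(u, v), w) = (∂_u g)(v, w) + (∂_v g)(u, w) - (∂_w g)(u, v)` (see `christoffel_apply`). -/
def christoffel (g : W → W →L[ℝ] W →L[ℝ] ℝ) (y : W) : W →L[ℝ] W →L[ℝ] W :=
  letI sharp : (W →L[ℝ] W →L[ℝ] ℝ) →L[ℝ] (W →L[ℝ] W) :=
    ContinuousLinearMap.compL ℝ W (W →L[ℝ] ℝ) W (g y).inverse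
  letI flipMap : (W →L[ℝ] W →L[ℝ] ℝ) →L[ℝ] (W →L[ℝ] W →L[ℝ] ℝ) :=
    (ContinuousLinearMap.flipₗᵢ ℝ W W ℝ).toContinuousLinearEquiv.toContinuousLinearMap
  (2⁻¹ : ℝ) • (sharp ∘L fderiv ℝ g y + sharp ∘L (fderiv ℝ g y).flip
    - sharp ∘L (flipMap ∘L (fderiv ℝ g y).flip))

theorem christoffel_apply (g : W → W →L[ℝ] W →L[ℝ] ℝ) (y u v : W) :
    christoffel g y u v = (2⁻¹ : ℝ) • (g y).inverse (koszulForm g y u v) := by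
  rw [koszulForm, map_sub, map_add]
  rfl

/-- The map `u ↦ R(u, v) w` at `y`, where `R` is the Riemann curvature tensor of `g`:
`R(u, v) w = (∂_u Γ)(v, w) - (∂_v Γ)(u, w) + Γ(u, Γ(v, w)) - Γ(v, Γ(u, w))`. -/
def curvatureEndo (g : W → W →L[ℝ] W →L[ℝ] ℝ) (y v w : W) : W →L[ℝ] W :=
  ((fderiv ℝ (christoffel g) y).flip v).flip w
    - (fderiv ℝ (christoffel g) y v).flip w
    + (christoffel g y).flip (christoffel g y v w)
    - (christoffel g y v) ∘L ((christoffel g y).flip w)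

theorem curvatureEndo_apply (g : W → W →L[ℝ] W →L[ℝ] ℝ) (y u v w : W) :
    curvatureEndo g y v w u =
      fderiv ℝ (christoffel g) y u v w - fderiv ℝ (christoffel g) y v u w
        + christoffel g y u (christoffel g y v w)
        - christoffel g y v (christoffel g y u w) := rfl

/-- The Ricci tensor `Ric(v, w) = tr (u ↦ R(u, v) w)` of the metric `g` at `y`. -/
def ricci (g : W → W →L[ℝ] W →L[ℝ] ℝ) (y v w : W) : ℝ :=
  LinearMap.trace ℝ W (curvatureEndo g y v w : W →ₗ[ℝ] W)

end LocalGeometry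

end

open Bundle Set Filter Topology Manifold
open scoped ContDiff ENNReal

noncomputable section

/-! ### Riemannian geometry on a manifold (without boundary) -/

section ManifoldGeometry

variable {E : Type*} [NormedAddCommGroup E] [NormedSpace ℝ E]
  {H : Type*} [TopologicalSpace H] {I : ModelWithCorners ℝ E H}
  {N : Type*} [TopologicalSpace N] [ChartedSpace H N]

variable (I N) in
/-- A field of (continuous) bilinear forms on the tangent spaces of `N`. -/
abbrev BilinearField := ∀ x : N, TangentSpace I x →L[ℝ] TangentSpace I x →L[ℝ] ℝ

/-- `G` is a smooth Riemannian metric on `N`. -/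
def IsRiemannianMetric [IsManifold I 1 N] (G : BilinearField I N) : Prop :=
  ∃ g : ContMDiffRiemannianMetric I ∞ E (fun x : N ↦ TangentSpace I x), ∀ x, g.inner x = G x

/-- The Riemannian distance of `G`: the infimum of the `G`-lengths of `C¹` paths. -/
def metricEDist (G : BilinearField I N) (x y : N) : ℝ≥0∞ :=
  letI : ∀ z : N, ENorm (TangentSpace I z) :=
    fun z ↦ ⟨fun v ↦ ENNReal.ofReal (Real.sqrt (G z v v))⟩
  riemannianEDist I x y

/-- Completeness of `N` with respect to the Riemannian distance of `G`. -/
def IsCompleteMetric (G : BilinearField I N) : Prop :=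
  ∀ x : ℕ → N,
    (∀ ε : ℝ≥0∞, 0 < ε → ∃ k₀, ∀ k ≥ k₀, ∀ l ≥ k₀, metricEDist G (x k) (x l) < ε) →
    ∃ z : N, Tendsto (fun k ↦ metricEDist G (x k) z) atTop (𝓝 0)

variable {W : Type*} [NormedAddCommGroup W] [NormedSpace ℝ W]

variable (I) in
/-- The differential at `y` of a map `φ` from a vector space to `N`. -/
def paramDeriv (φ : W → N) (y : W) : W →L[ℝ] TangentSpace I (φ y) :=
  mfderiv 𝓘(ℝ, W) I φ y

/-- The pull-back `φ^* G` under a map `φ` from a vector space to `N`. -/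
def pullbackMetric (G : BilinearField I N) (φ : W → N) (y : W) : W →L[ℝ] W →L[ℝ] ℝ :=
  (paramDeriv I φ y).precomp ℝ ∘L (G (φ y) ∘L paramDeriv I φ y)

theorem pullbackMetric_apply (G : BilinearField I N) (φ : W → N) (y u v : W) :
    pullbackMetric G φ y u v = G (φ y) (paramDeriv I φ y u) (paramDeriv I φ y v) := rfl

/-- The gradient of `f`: `G(grad f, ·) = df`. -/
def riemGradient (G : BilinearField I N) (f : N → ℝ) (x : N) : TangentSpace I x :=
  (G x).inverse (mvfderiv I f x)

/-- A vector field `X` on `N` read in the coordinates given by `φ`. -/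
def readVectorField (φ : W → N) (X : ∀ x : N, TangentSpace I x) (y : W) : W :=
  (paramDeriv I φ y).inverse (X (φ y))

/-- The Levi-Civita covariant derivative `u ↦ ∇_u X` of a vector field `X` at `x`, computed in the
chart at `x`: if `Y` is `X` in coordinates, `∇_u X` is `∂_u Y + Γ(u, Y)` in coordinates. -/
def covDeriv (G : BilinearField I N) (X : ∀ x : N, TangentSpace I x) (x : N) :
    TangentSpace I x →L[ℝ] TangentSpace I x :=
  letI φ : E → N := (extChartAt I x).symm
  letI y : E := extChartAt I x x
  letI Y : E → E := readVectorField φ X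
  letI A : E →L[ℝ] TangentSpace I x := (mfderiv I 𝓘(ℝ, E) (extChartAt I x) x).inverse
  letI B : TangentSpace I x →L[ℝ] E := mfderiv I 𝓘(ℝ, E) (extChartAt I x) x
  A ∘L (fderiv ℝ Y y + (christoffel (pullbackMetric G φ) y).flip (Y y)) ∘L B

/-- The Laplace-Beltrami operator `Δ f = tr (u ↦ ∇_u grad f)`. -/
def laplaceBeltrami (G : BilinearField I N) (f : N → ℝ) (x : N) : ℝ :=
  LinearMap.trace ℝ (TangentSpace I x)
    (covDeriv G (riemGradient G f) x : TangentSpace I x →ₗ[ℝ] TangentSpace I x)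

/-- `f` is an isoparametric function: smooth, non-constant, `|grad f|² = b(f)` with `b` smooth,
and `Δ f = a(f)` with `a` continuous. -/
structure IsIsoparametricFunction (G : BilinearField I N) (f : N → ℝ) : Prop where
  smooth : ContMDiff I 𝓘(ℝ, ℝ) ∞ f
  nonconstant : ∃ x y, f x ≠ f y
  transnormal : ∃ b : ℝ → ℝ, ContDiff ℝ ∞ b ∧
    ∀ x, G x (riemGradient G f x) (riemGradient G f x) = b (f x)
  laplacian : ∃ a : ℝ → ℝ, Continuous a ∧ ∀ x, laplaceBeltrami G f x = a (f x)

/-- `S` is an isoparametric hypersurface: a (non-empty) regular level set of an isoparametric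
function. -/
def IsIsoparametricHypersurface (G : BilinearField I N) (S : Set N) : Prop :=
  ∃ (f : N → ℝ) (c : ℝ), IsIsoparametricFunction G f ∧ S = f ⁻¹' {c} ∧ S.Nonempty ∧
    ∀ x ∈ S, mvfderiv I f x ≠ 0

/-- The unit normal field `grad f / |grad f|` of the regular level hypersurfaces of `f`. -/
def levelUnitNormal (G : BilinearField I N) (f : N → ℝ) (x : N) : TangentSpace I x :=
  (Real.sqrt (G x (riemGradient G f x) (riemGradient G f x)))⁻¹ • riemGradient G f x

/-- The space of principal vectors at `x`, for the principal curvature `κ`, of the level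
hypersurface of `f` through the regular point `x`, with respect to `η = grad f / |grad f|`:
the vectors `u` tangent to the hypersurface (`df(u) = 0`) such that `-∇_u η = κ u`. -/
def principalSpace (G : BilinearField I N) (f : N → ℝ) (x : N) (κ : ℝ) :
    Submodule ℝ (TangentSpace I x) :=
  LinearMap.ker (mvfderiv I f x : TangentSpace I x →ₗ[ℝ] ℝ) ⊓
    Module.End.eigenspace
      (-(covDeriv G (levelUnitNormal G f) x : TangentSpace I x →ₗ[ℝ] TangentSpace I x)) κ

variable (I) in
/-- `φ : U → N` is a local parametrization of the `d`-dimensional embedded submanifold `S`: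
a smooth immersion of the open set `U ⊆ ℝ^d` which is a homeomorphism onto a relatively open
subset of `S`. -/
structure IsLocalParametrization (d : ℕ) (S : Set N) (U : Set (EuclideanSpace ℝ (Fin d)))
    (φ : EuclideanSpace ℝ (Fin d) → N) : Prop where
  isOpen : IsOpen U
  smooth : ContMDiffOn 𝓘(ℝ, EuclideanSpace ℝ (Fin d)) I ∞ φ U
  immersion : ∀ y ∈ U, Function.Injective (paramDeriv I φ y)
  embedding : IsEmbedding (U.domRestrict φ)
  image_open : ∃ O : Set N, IsOpen O ∧ φ '' U = O ∩ S

variable (I) in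
/-- `S` is a smooth embedded submanifold of dimension `d` of `N`. -/
def IsEmbeddedSubmanifold (d : ℕ) (S : Set N) : Prop :=
  ∀ x ∈ S, ∃ U φ, IsLocalParametrization I d S U φ ∧ x ∈ φ '' U

/-- The metric induced by `G` on the `d`-dimensional embedded submanifold `S` has positive Ricci
curvature: its Ricci tensor, in any local coordinates, is positive definite.
For `S = univ` this is positivity of the Ricci curvature of `N` itself. -/
def HasPositiveRicci (G : BilinearField I N) (d : ℕ) (S : Set N) : Prop :=
  ∀ U φ, IsLocalParametrization I d S U φ → ∀ y ∈ U, ∀ u : EuclideanSpace ℝ (Fin d), u ≠ 0 →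
    0 < ricci (pullbackMetric G φ) y u u

end ManifoldGeometry

/-! ### The connection metric on the total space of a Riemannian vector bundle -/

section ConnectionMetric

variable {EM : Type*} [NormedAddCommGroup EM] [NormedSpace ℝ EM]
  {H : Type*} [TopologicalSpace H] {I : ModelWithCorners ℝ EM H}
  {M : Type*} [TopologicalSpace M] [ChartedSpace H M]
  {F : Type*} [NormedAddCommGroup F] [NormedSpace ℝ F]
  {ξ : M → Type*} [TopologicalSpace (TotalSpace F ξ)]
  [∀ p, NormedAddCommGroup (ξ p)] [∀ p, InnerProductSpace ℝ (ξ p)]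
  [FiberBundle F ξ] [VectorBundle ℝ F ξ]

/-- The differential of the bundle projection `π` at `x`. -/
def projDeriv (x : TotalSpace F ξ) :
    TangentSpace (I.prod 𝓘(ℝ, F)) x →L[ℝ] TangentSpace I x.proj :=
  mfderiv (I.prod 𝓘(ℝ, F)) I (TotalSpace.proj : TotalSpace F ξ → M) x

/-- The connector `K` of the connection `D`, at the point `x = (p, v)` of the total space.
In the preferred local trivialization, with local frame `(e_α)` and fibre coordinates `v_α`, it is
`∑_α dv_α ⊗ e_α + ∑_α v_α D e_α = ∑_α (dv_α + ∑_β v_β ω_{βα}) ⊗ e_α`;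
`FiberBundle.extend F v` is the local section with constant coordinates through `v`. -/
def connector (D : CovariantDerivative I F ξ) (x : TotalSpace F ξ) :
    TangentSpace (I.prod 𝓘(ℝ, F)) x →L[ℝ] ξ x.proj :=
  (trivializationAt F ξ x.proj).symmL ℝ x.proj ∘L
      mvfderiv (I.prod 𝓘(ℝ, F)) (fun z : TotalSpace F ξ ↦ (trivializationAt F ξ x.proj z).2) x
    + D (FiberBundle.extend F x.snd) x.proj ∘L projDeriv x

/-- The connection metric on the total space:
`ds²(u, w) = g(dπ u, dπ w) + ⟨K u, K w⟩`. -/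
def connectionMetric (g : BilinearField I M) (D : CovariantDerivative I F ξ) :
    BilinearField (I.prod 𝓘(ℝ, F)) (TotalSpace F ξ) := fun x ↦
  (projDeriv x).precomp ℝ ∘L (g x.proj ∘L projDeriv x)
    + (connector D x).precomp ℝ ∘L (innerSL ℝ ∘L connector D x)

theorem connectionMetric_apply (g : BilinearField I M) (D : CovariantDerivative I F ξ)
    (x : TotalSpace F ξ) (u w : TangentSpace (I.prod 𝓘(ℝ, F)) x) :
    connectionMetric g D x u w =
      g x.proj (projDeriv x u) (projDeriv x w)
        + inner ℝ (connector D x u) (connector D x w) := rfl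

variable (F ξ) in
/-- The function `(p, v) ↦ ⟨v, v⟩` on the total space. -/
def fiberNormSq (x : TotalSpace F ξ) : ℝ := inner ℝ x.snd x.snd

variable (F ξ) in
/-- The sphere bundle `S_r(ξ)`. -/
def sphereBundle (r : ℝ) : Set (TotalSpace F ξ) := {x | inner ℝ x.snd x.snd = r ^ 2}

end ConnectionMetric

end

/-!
In the chart of the total space given by a chart of `M` and a trivialization of `ξ`, the connection
metric is `g y (u, u') + k y (K u, K u')` on `X × F`, where `g` and `k` are the coordinate
expressions of the metrics of `M` and of `ξ` and `K (a, b) = b + A y a v` at `(y, v)` for the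
connection form `A`. Everything rests on one formula: for the Euler field `P`, the vertical lift of
`v`, `∇_u P` is the vertical lift of `K u`, because `D` is metric.

* Since `⟨v, v⟩` has gradient `2 P`, the formula gives its Hessian, hence the isoparametric
  equations, and the shape operator of `S_r`, whose unit normal is `P / r`.
* A set of bounded fibre norm is relatively compact, as `M` is compact, and the fibre norm is
  bounded on Cauchy sequences because `√⟨v, v⟩` has gradient of norm at most `1`.
* Differentiating the formula shows that `R(u, P) P = 0`, so by the Gauss equation the Ricci tensor
  of `S_r` is `Ric_E(w, w) + (n - 2) / r² ⟨K w, K w⟩`. As `r → 0` this tends to infinity unless `w`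
  is horizontal, in which case it tends to the Ricci tensor of the base, since the zero section is
  totally geodesic and the mixed curvature terms cancel there. Compactness of `M` and of the unit
  sphere of tangent vectors makes `r₀` uniform.
-/

noncomputable section

set_option maxSynthPendingDepth 3

/-! ### Metric connections, curvature and the Gauss–Codazzi equations in coordinates -/

section Calculus

variable {𝕜 W E₁ E₂ E₃ : Type*} [NontriviallyNormedField 𝕜]
  [NormedAddCommGroup W] [NormedSpace 𝕜 W] [NormedAddCommGroup E₁] [NormedSpace 𝕜 E₁]
  [NormedAddCommGroup E₂] [NormedSpace 𝕜 E₂] [NormedAddCommGroup E₃] [NormedSpace 𝕜 E₃]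

theorem fderiv_clm_apply₂ {B : W → E₁ →L[𝕜] E₂ →L[𝕜] E₃} {a : W → E₁} {b : W → E₂} {y : W}
    (hB : DifferentiableAt 𝕜 B y) (ha : DifferentiableAt 𝕜 a y) (hb : DifferentiableAt 𝕜 b y)
    (w : W) :
    fderiv 𝕜 (fun z ↦ B z (a z) (b z)) y w =
      fderiv 𝕜 B y w (a y) (b y) + B y (fderiv 𝕜 a y w) (b y) + B y (a y) (fderiv 𝕜 b y w) := by
  rw [((hB.hasFDerivAt.clm_apply ha.hasFDerivAt).clm_apply hb.hasFDerivAt).fderiv]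
  simp
  abel

theorem fderiv_clm_apply_const {L : W → E₁ →L[𝕜] E₂} {y : W} (hL : DifferentiableAt 𝕜 L y)
    (a : E₁) (w : W) : fderiv 𝕜 (fun z ↦ L z a) y w = fderiv 𝕜 L y w a := by
  rw [(hL.hasFDerivAt.clm_apply (hasFDerivAt_const a y)).fderiv]
  simp

theorem fderiv_clm_apply₂_const {B : W → E₁ →L[𝕜] E₂ →L[𝕜] E₃} {y : W}
    (hB : DifferentiableAt 𝕜 B y) (a : E₁) (b : E₂) (w : W) :
    fderiv 𝕜 (fun z ↦ B z a b) y w = fderiv 𝕜 B y w a b := by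
  rw [fderiv_clm_apply₂ hB (differentiableAt_const a) (differentiableAt_const b)]
  simp

theorem fderiv_comp_fst {f : W → E₂} {x : W × E₁} (hf : DifferentiableAt 𝕜 f x.1) :
    fderiv 𝕜 (fun z : W × E₁ ↦ f z.1) x = fderiv 𝕜 f x.1 ∘L .fst 𝕜 W E₁ :=
  (hf.hasFDerivAt.comp x hasFDerivAt_fst).fderiv

theorem contDiffAt_infty_fderiv {f : W → E₁} {y : W} (hf : ContDiffAt 𝕜 ∞ f y) :
    ContDiffAt 𝕜 ∞ (fderiv 𝕜 f) y :=
  hf.fderiv_right (by simp)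

end Calculus

section Connection

variable {W E : Type*} [NormedAddCommGroup W] [NormedSpace ℝ W]
  [NormedAddCommGroup E] [NormedSpace ℝ E]

theorem fderiv_fderiv_comm {f : W → E} {y : W} (hf : ContDiffAt ℝ 2 f y) (u v : W) :
    fderiv ℝ (fderiv ℝ f) y u v = fderiv ℝ (fderiv ℝ f) y v u :=
  hf.isSymmSndFDerivAt (by simp) u v

/-- The curvature `R(a, b) v` at `x` of the linear connection `d + A` on the trivial bundle with
fibre `E` over `W`. -/
def connectionCurvature (A : W → W →L[ℝ] E →L[ℝ] E) (x a b : W) (v : E) : E :=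
  fderiv ℝ A x a b v - fderiv ℝ A x b a v + A x a (A x b v) - A x b (A x a v)

/-- Compatibility at `x` of the linear connection `d + A` with the family `k` of bilinear forms on
the fibres: `d(k(s, t)) = k(∇s, t) + k(s, ∇t)`, tested on constant sections. -/
def IsMetricConnectionAt (k : W → E →L[ℝ] E →L[ℝ] ℝ) (A : W → W →L[ℝ] E →L[ℝ] E) (x : W) : Prop :=
  ∀ a s t, fderiv ℝ k x a s t = k x (A x a s) t + k x s (A x a t)

variable {k : W → E →L[ℝ] E →L[ℝ] ℝ} {A : W → W →L[ℝ] E →L[ℝ] E} {x : W}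

theorem fderiv_fderiv_of_isMetricConnectionAt (hk : ContDiffAt ℝ 2 k x)
    (hA : DifferentiableAt ℝ A x) (hkA : ∀ᶠ z in 𝓝 x, IsMetricConnectionAt k A z)
    (a b : W) (v : E) :
    fderiv ℝ (fderiv ℝ k) x a b v v =
      fderiv ℝ k x a (A x b v) v + k x (fderiv ℝ A x a b v) v
        + (fderiv ℝ k x a v (A x b v) + k x v (fderiv ℝ A x a b v)) := by
  have hk₁ : DifferentiableAt ℝ k x := hk.differentiableAt (by simp)
  have hk₂ : DifferentiableAt ℝ (fderiv ℝ k) x :=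
    (hk.fderiv_right (m := 1) (by norm_num)).differentiableAt (by simp)
  have hkb : DifferentiableAt ℝ (fun z ↦ fderiv ℝ k z b) x := by fun_prop
  have hAv : DifferentiableAt ℝ (fun z ↦ A z b v) x := by fun_prop
  have hv : DifferentiableAt ℝ (fun _ : W ↦ v) x := differentiableAt_const v
  calc fderiv ℝ (fderiv ℝ k) x a b v v = fderiv ℝ (fun z ↦ fderiv ℝ k z b v v) x a := by
        rw [fderiv_clm_apply₂_const hkb, fderiv_clm_apply_const hk₂]
    _ = fderiv ℝ (fun z ↦ k z (A z b v) v + k z v (A z b v)) x a := by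
        rw [EventuallyEq.fderiv_eq (hkA.mono fun z hz ↦ hz b v v)]
    _ = _ := by
        rw [fderiv_fun_add (by fun_prop) (by fun_prop), add_apply, fderiv_clm_apply₂ hk₁ hAv hv,
          fderiv_clm_apply₂ hk₁ hv hAv, fderiv_clm_apply₂_const hA]
        simp

theorem apply_connectionCurvature_self (hk : ContDiffAt ℝ 2 k x) (hA : DifferentiableAt ℝ A x)
    (hsymm : ∀ s t, k x s t = k x t s) (hkA : ∀ᶠ z in 𝓝 x, IsMetricConnectionAt k A z)
    (a b : W) (v : E) :
    k x (connectionCurvature A x a b v) v = 0 := by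
  have hab := fderiv_fderiv_of_isMetricConnectionAt hk hA hkA a b v
  have hba := fderiv_fderiv_of_isMetricConnectionAt hk hA hkA b a v
  have hx := hkA.self_of_nhds
  rw [fderiv_fderiv_comm hk a b] at hab
  rw [hx, hx] at hab hba
  simp only [connectionCurvature, map_sub, map_add, sub_apply, add_apply]
  linarith [hsymm v (fderiv ℝ A x a b v), hsymm v (fderiv ℝ A x b a v),
    hsymm v (A x a (A x b v)), hsymm v (A x b (A x a v))]

end Connection

section PositiveForm

variable {V : Type*} [NormedAddCommGroup V] [NormedSpace ℝ V] {b : V →L[ℝ] V →L[ℝ] ℝ}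

theorem eq_of_forall_apply_eq_of_pos (hb : ∀ u, u ≠ 0 → 0 < b u u) {u v : V}
    (h : ∀ w, b u w = b v w) : u = v := by
  by_contra hne
  have := hb _ (sub_ne_zero.2 hne)
  simp [h] at this

theorem isInvertible_of_pos [FiniteDimensional ℝ V] (hb : ∀ u, u ≠ 0 → 0 < b u u) :
    b.IsInvertible := by
  have hinj : Function.Injective b := fun u v h ↦
    eq_of_forall_apply_eq_of_pos hb (DFunLike.congr_fun h)
  have hfr : Module.finrank ℝ V = Module.finrank ℝ (V →L[ℝ] ℝ) := by
    have e : (V →L[ℝ] ℝ) ≃ₗ[ℝ] Module.Dual ℝ V := LinearMap.toContinuousLinearMap.symm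
    rw [e.finrank_eq, Subspace.dual_finrank_eq]
  exact ⟨(LinearEquiv.ofInjectiveOfFinrankEq (b : V →ₗ[ℝ] (V →L[ℝ] ℝ))
    hinj hfr).toContinuousLinearEquiv, rfl⟩

end PositiveForm

/-- `k` is a smooth metric on the trivial bundle with fibre `E` over the open subset `O` of `W`; for
`E = W` this is a smooth Riemannian metric on `O`. -/
structure IsMetricOn {W E : Type*} [NormedAddCommGroup W] [NormedSpace ℝ W] [NormedAddCommGroup E]
    [NormedSpace ℝ E] (k : W → E →L[ℝ] E →L[ℝ] ℝ) (O : Set W) : Prop where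
  isOpen : IsOpen O
  contDiffOn : ContDiffOn ℝ ∞ k O
  symm : ∀ y ∈ O, ∀ u v, k y u v = k y v u
  pos : ∀ y ∈ O, ∀ u, u ≠ 0 → 0 < k y u u

namespace IsMetricOn

section Fibre

variable {W E : Type*} [NormedAddCommGroup W] [NormedSpace ℝ W] [NormedAddCommGroup E]
  [NormedSpace ℝ E] {k : W → E →L[ℝ] E →L[ℝ] ℝ} {O : Set W} {y : W}

theorem contDiffAt (hk : IsMetricOn k O) (hy : y ∈ O) : ContDiffAt ℝ ∞ k y :=
  hk.contDiffOn.contDiffAt (hk.isOpen.mem_nhds hy)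

theorem nonneg (hk : IsMetricOn k O) (hy : y ∈ O) (u : E) : 0 ≤ k y u u := by
  rcases eq_or_ne u 0 with rfl | hu
  · simp
  · exact (hk.pos y hy u hu).le

theorem mono {O' : Set W} (hk : IsMetricOn k O) (hO' : IsOpen O') (h : O' ⊆ O) :
    IsMetricOn k O' :=
  ⟨hO', hk.contDiffOn.mono h, fun y hy ↦ hk.symm y (h hy), fun y hy ↦ hk.pos y (h hy)⟩

theorem congr {k' : W → E →L[ℝ] E →L[ℝ] ℝ} (hk : IsMetricOn k O) (h : EqOn k' k O) :
    IsMetricOn k' O where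
  isOpen := hk.isOpen
  contDiffOn := hk.contDiffOn.congr h
  symm y hy := by rw [h hy]; exact hk.symm y hy
  pos y hy := by rw [h hy]; exact hk.pos y hy

theorem isInvertible [FiniteDimensional ℝ E] (hk : IsMetricOn k O) (hy : y ∈ O) :
    (k y).IsInvertible :=
  isInvertible_of_pos (hk.pos y hy)

theorem fderiv_symm (hk : IsMetricOn k O) (hy : y ∈ O) (w : W) (u v : E) :
    fderiv ℝ k y w u v = fderiv ℝ k y w v u := by
  have hd : DifferentiableAt ℝ k y := (hk.contDiffAt hy).differentiableAt (by simp)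
  have hsymm : (fun z ↦ k z u v) =ᶠ[𝓝 y] fun z ↦ k z v u := by
    filter_upwards [hk.isOpen.mem_nhds hy] with z hz using hk.symm z hz u v
  rw [← fderiv_clm_apply₂_const hd, ← fderiv_clm_apply₂_const hd, hsymm.fderiv_eq]

end Fibre

variable {W : Type*} [NormedAddCommGroup W] [NormedSpace ℝ W] [FiniteDimensional ℝ W]
  {G : W → W →L[ℝ] W →L[ℝ] ℝ} {O : Set W} {y : W}

theorem two_mul_apply_christoffel (hG : IsMetricOn G O) (hy : y ∈ O) (u v w : W) :
    2 * G y (christoffel G y u v) w =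
      fderiv ℝ G y u v w + fderiv ℝ G y v u w - fderiv ℝ G y w u v := by
  rw [christoffel_apply, map_smul, (hG.isInvertible hy).self_apply_inverse, smul_apply,
    koszulForm_apply]
  simp

theorem christoffel_eq (hG : IsMetricOn G O) (hy : y ∈ O) {u v z : W}
    (h : ∀ w, 2 * G y z w = fderiv ℝ G y u v w + fderiv ℝ G y v u w - fderiv ℝ G y w u v) :
    christoffel G y u v = z := by
  refine eq_of_forall_apply_eq_of_pos (hG.pos y hy) fun w ↦ ?_
  linarith [h w, hG.two_mul_apply_christoffel hy u v w]

theorem christoffel_symm (hG : IsMetricOn G O) (hy : y ∈ O) (u v : W) :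
    christoffel G y u v = christoffel G y v u := by
  refine hG.christoffel_eq hy fun w ↦ ?_
  rw [hG.two_mul_apply_christoffel hy, hG.fderiv_symm hy w u v]
  ring

theorem isMetricConnectionAt_christoffel (hG : IsMetricOn G O) (hy : y ∈ O) :
    IsMetricConnectionAt G (christoffel G) y := by
  intro a s t
  rw [hG.symm y hy s]
  linarith [hG.two_mul_apply_christoffel hy a s t, hG.two_mul_apply_christoffel hy a t s,
    hG.fderiv_symm hy a t s, hG.fderiv_symm hy t a s, hG.fderiv_symm hy s a t]

theorem contDiffAt_christoffel (hG : IsMetricOn G O) (hy : y ∈ O) :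
    ContDiffAt ℝ ∞ (christoffel G) y := by
  have hG₀ := hG.contDiffAt hy
  have hG₁ := contDiffAt_infty_fderiv hG₀
  have hinv : ContDiffAt ℝ ∞ (fun z ↦ (G z).inverse) y :=
    (hG.isInvertible hy).contDiffAt_map_inverse.comp y hG₀
  have hsharp : ContDiffAt ℝ ∞
      (fun z ↦ ContinuousLinearMap.compL ℝ W (W →L[ℝ] ℝ) W (G z).inverse) y :=
    (ContinuousLinearMap.compL ℝ W (W →L[ℝ] ℝ) W).contDiff.contDiffAt.comp y hinv
  have hflip : ContDiffAt ℝ ∞ (fun z ↦ (fderiv ℝ G z).flip) y :=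
    (ContinuousLinearMap.flipₗᵢ ℝ W W (W →L[ℝ] ℝ)).contDiff.contDiffAt.comp y hG₁
  unfold christoffel
  exact ContDiffAt.const_smul (2⁻¹ : ℝ) (((hsharp.clm_comp hG₁).add (hsharp.clm_comp hflip)).sub
    (hsharp.clm_comp (contDiffAt_const.clm_comp hflip)))

theorem differentiableAt_christoffel (hG : IsMetricOn G O) (hy : y ∈ O) :
    DifferentiableAt ℝ (christoffel G) y :=
  (hG.contDiffAt_christoffel hy).differentiableAt (by simp)

theorem apply_curvatureEndo_self (hG : IsMetricOn G O) (hy : y ∈ O) (u v w : W) :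
    G y (curvatureEndo G y v w u) w = 0 :=
  apply_connectionCurvature_self ((hG.contDiffAt hy).of_le (WithTop.coe_le_coe.2 le_top))
    (hG.differentiableAt_christoffel hy) (hG.symm y hy)
    (eventually_of_mem (hG.isOpen.mem_nhds hy) fun _ hz ↦ hG.isMetricConnectionAt_christoffel hz)
    u v w

theorem apply_curvatureEndo_skew (hG : IsMetricOn G O) (hy : y ∈ O) (u v w z : W) :
    G y (curvatureEndo G y v w u) z = -G y (curvatureEndo G y v z u) w := by
  have hwz := hG.apply_curvatureEndo_self hy u v (w + z)
  have hw := hG.apply_curvatureEndo_self hy u v w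
  have hz := hG.apply_curvatureEndo_self hy u v z
  simp only [curvatureEndo_apply, map_add, map_sub, add_apply, sub_apply] at *
  linarith

theorem continuousAt_curvatureEndo {T : Type*} [TopologicalSpace T] {γ v w : T → W} {t : T}
    (hG : IsMetricOn G O) (ht : γ t ∈ O) (hγ : ContinuousAt γ t) (hv : ContinuousAt v t)
    (hw : ContinuousAt w t) : ContinuousAt (fun s ↦ curvatureEndo G (γ s) (v s) (w s)) t := by
  have hΓ : ContinuousAt (fun s ↦ christoffel G (γ s)) t :=
    ContinuousAt.comp (g := christoffel G) (hG.contDiffAt_christoffel ht).continuousAt hγ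
  have hdΓ : ContinuousAt (fun s ↦ fderiv ℝ (christoffel G) (γ s)) t :=
    ContinuousAt.comp (g := fderiv ℝ (christoffel G))
      (contDiffAt_infty_fderiv (hG.contDiffAt_christoffel ht)).continuousAt hγ
  have hflip : Continuous (ContinuousLinearMap.flip : (W →L[ℝ] W →L[ℝ] W) → _) :=
    (ContinuousLinearMap.flipₗᵢ ℝ W W W).continuous
  have hflip' : Continuous (ContinuousLinearMap.flip : (W →L[ℝ] W →L[ℝ] W →L[ℝ] W) → _) :=
    (ContinuousLinearMap.flipₗᵢ ℝ W W (W →L[ℝ] W)).continuous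
  have hΓflip := hflip.continuousAt.comp hΓ
  exact ((((hflip.continuousAt.comp ((hflip'.continuousAt.comp hdΓ).clm_apply hv)).clm_apply
    hw).sub ((hflip.continuousAt.comp (hdΓ.clm_apply hv)).clm_apply hw)).add
    (hΓflip.clm_apply ((hΓ.clm_apply hv).clm_apply hw))).sub
    ((hΓ.clm_apply hv).clm_comp (hΓflip.clm_apply hw))

theorem continuousAt_ricci {T : Type*} [TopologicalSpace T] {γ v w : T → W} {t : T}
    (hG : IsMetricOn G O) (ht : γ t ∈ O) (hγ : ContinuousAt γ t) (hv : ContinuousAt v t)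
    (hw : ContinuousAt w t) : ContinuousAt (fun s ↦ ricci G (γ s) (v s) (w s)) t := by
  have htr : Continuous fun T : W →L[ℝ] W ↦ LinearMap.trace ℝ W (T : W →ₗ[ℝ] W) :=
    (LinearMap.trace ℝ W ∘ₗ ContinuousLinearMap.coeLM ℝ).continuous_of_finiteDimensional
  exact htr.continuousAt.comp (hG.continuousAt_curvatureEndo ht hγ hv hw)

end IsMetricOn

section Tensor

variable {W : Type*} [NormedAddCommGroup W] [NormedSpace ℝ W]
  {G G' : W → W →L[ℝ] W →L[ℝ] ℝ} {y : W}

theorem christoffel_congr (h : G =ᶠ[𝓝 y] G') : christoffel G =ᶠ[𝓝 y] christoffel G' := by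
  filter_upwards [h.eventuallyEq_nhds] with z hz
  unfold christoffel
  rw [hz.fderiv_eq, hz.self_of_nhds]

theorem ricci_congr (h : G =ᶠ[𝓝 y] G') (v w : W) : ricci G y v w = ricci G' y v w := by
  unfold ricci curvatureEndo
  rw [(christoffel_congr h).fderiv_eq, (christoffel_congr h).self_of_nhds]

theorem ricci_smul (G : W → W →L[ℝ] W →L[ℝ] ℝ) (y : W) (c : ℝ) (v : W) :
    ricci G y (c • v) (c • v) = c ^ 2 * ricci G y v v := by
  have hR : (curvatureEndo G y (c • v) (c • v) : W →ₗ[ℝ] W) =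
      c ^ 2 • (curvatureEndo G y v v : W →ₗ[ℝ] W) := by
    refine LinearMap.ext fun u ↦ ?_
    simp only [ContinuousLinearMap.coe_coe, LinearMap.smul_apply, curvatureEndo_apply, map_smul,
      smul_apply]
    module
  rw [ricci, hR, map_smul, smul_eq_mul, ricci]

end Tensor

section Gauss

variable {W V : Type*} [NormedAddCommGroup W] [NormedSpace ℝ W]
  [NormedAddCommGroup V] [NormedSpace ℝ V]

/-- The Gauss formula `∇_{dφ u} (dφ w) = dφ (∇_u w) + II(u, w)` at `y`, tested on constant fields:
`II` is the second fundamental form of the map `φ` from the metric `h` to the metric `G`. -/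
def IsSecondFundamentalFormAt (G : V → V →L[ℝ] V →L[ℝ] ℝ) (h : W → W →L[ℝ] W →L[ℝ] ℝ) (φ : W → V)
    (II : W → W → W → V) (y : W) : Prop :=
  ∀ u w, fderiv ℝ (fderiv ℝ φ) y u w + christoffel G (φ y) (fderiv ℝ φ y u) (fderiv ℝ φ y w) =
    fderiv ℝ φ y (christoffel h y u w) + II y u w

variable {G : V → V →L[ℝ] V →L[ℝ] ℝ} {h : W → W →L[ℝ] W →L[ℝ] ℝ} {φ : W → V} {y : W}

theorem fderiv_gauss_formula {II : W → W → W → V} (hφ : ContDiffAt ℝ 3 φ y)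
    (hG : DifferentiableAt ℝ (christoffel G) (φ y)) (hh : DifferentiableAt ℝ (christoffel h) y)
    (hII : ∀ v w, DifferentiableAt ℝ (fun z ↦ II z v w) y)
    (hgauss : ∀ᶠ z in 𝓝 y, IsSecondFundamentalFormAt G h φ II z) (u v w : W) :
    fderiv ℝ (fderiv ℝ (fderiv ℝ φ)) y u v w
        + (fderiv ℝ (christoffel G) (φ y) (fderiv ℝ φ y u) (fderiv ℝ φ y v) (fderiv ℝ φ y w)
          + christoffel G (φ y) (fderiv ℝ (fderiv ℝ φ) y u v) (fderiv ℝ φ y w)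
          + christoffel G (φ y) (fderiv ℝ φ y v) (fderiv ℝ (fderiv ℝ φ) y u w))
      = fderiv ℝ (fderiv ℝ φ) y u (christoffel h y v w)
        + fderiv ℝ φ y (fderiv ℝ (christoffel h) y u v w) + fderiv ℝ (fun z ↦ II z v w) y u := by
  have hφ₀ : DifferentiableAt ℝ φ y := hφ.differentiableAt (by simp)
  have hφ₁ : ContDiffAt ℝ 2 (fderiv ℝ φ) y := hφ.fderiv_right (by norm_num)
  have hφ₁' : DifferentiableAt ℝ (fderiv ℝ φ) y := hφ₁.differentiableAt (by simp)
  have hφ₂ : DifferentiableAt ℝ (fderiv ℝ (fderiv ℝ φ)) y :=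
    (hφ₁.fderiv_right (m := 1) (by norm_num)).differentiableAt (by simp)
  have hGφ : DifferentiableAt ℝ (fun z ↦ christoffel G (φ z)) y :=
    DifferentiableAt.comp (g := christoffel G) y hG hφ₀
  have hGφ' : fderiv ℝ (fun z ↦ christoffel G (φ z)) y =
      fderiv ℝ (christoffel G) (φ y) ∘L fderiv ℝ φ y :=
    fderiv_comp (g := christoffel G) y hG hφ₀
  have hvw := hII v w
  have heq := DFunLike.congr_fun
    (EventuallyEq.fderiv_eq (𝕜 := ℝ) (hgauss.mono fun z hz ↦ hz v w)) u
  rw [fderiv_fun_add (by fun_prop) (by fun_prop), fderiv_fun_add (by fun_prop) hvw, add_apply,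
    add_apply, fderiv_clm_apply₂ hGφ (by fun_prop) (by fun_prop), fderiv_clm_apply₂_const hφ₂,
    fderiv_clm_apply_const hφ₁', fderiv_clm_apply_const hφ₁', hGφ',
    fderiv_clm_apply hφ₁' (by fun_prop)] at heq
  simp only [add_apply, ContinuousLinearMap.comp_apply, ContinuousLinearMap.flip_apply,
    fderiv_clm_apply₂_const hh] at heq
  rw [heq]
  abel

theorem gauss_codazzi_equation {II : W → W → W → V} (hφ : ContDiffAt ℝ 3 φ y)
    (hG : DifferentiableAt ℝ (christoffel G) (φ y)) (hh : DifferentiableAt ℝ (christoffel h) y)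
    (hII : ∀ v w, DifferentiableAt ℝ (fun z ↦ II z v w) y)
    (hgauss : ∀ᶠ z in 𝓝 y, IsSecondFundamentalFormAt G h φ II z) (u v w : W) :
    curvatureEndo G (φ y) (fderiv ℝ φ y v) (fderiv ℝ φ y w) (fderiv ℝ φ y u) =
      fderiv ℝ φ y (curvatureEndo h y v w u)
      + (fderiv ℝ (fun z ↦ II z v w) y u + II y u (christoffel h y v w)
        + christoffel G (φ y) (fderiv ℝ φ y u) (II y v w))
      - (fderiv ℝ (fun z ↦ II z u w) y v + II y v (christoffel h y u w)
        + christoffel G (φ y) (fderiv ℝ φ y v) (II y u w)) := by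
  have huv := fderiv_gauss_formula hφ hG hh hII hgauss u v w
  have hvu := fderiv_gauss_formula hφ hG hh hII hgauss v u w
  rw [fderiv_fderiv_comm (hφ.fderiv_right (by norm_num)) v u,
    fderiv_fderiv_comm (hφ.of_le (by norm_num)) v u] at hvu
  have hy := hgauss.self_of_nhds
  have hu := hy u (christoffel h y v w)
  have hv := hy v (christoffel h y u w)
  have hu' := congrArg (christoffel G (φ y) (fderiv ℝ φ y u)) (hy v w)
  have hv' := congrArg (christoffel G (φ y) (fderiv ℝ φ y v)) (hy u w)
  simp only [curvatureEndo_apply, map_add, map_sub] at *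
  linear_combination (norm := module) huv - hvu + hu - hv + hu' - hv'

theorem gauss_equation_hypersurface {q : W → W → W → ℝ} {N : W → V} (hφ : ContDiffAt ℝ 3 φ y)
    (hG : DifferentiableAt ℝ (christoffel G) (φ y)) (hh : DifferentiableAt ℝ (christoffel h) y)
    (hq : ∀ v w, DifferentiableAt ℝ (fun z ↦ q z v w) y) (hN : DifferentiableAt ℝ N y)
    (hgauss : ∀ᶠ z in 𝓝 y, IsSecondFundamentalFormAt G h φ (fun z u w ↦ q z u w • N z) z)
    (u v w : W) :
    ∃ c : ℝ, curvatureEndo G (φ y) (fderiv ℝ φ y v) (fderiv ℝ φ y w) (fderiv ℝ φ y u) =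
      fderiv ℝ φ y (curvatureEndo h y v w u)
      + q y v w • (fderiv ℝ N y u + christoffel G (φ y) (fderiv ℝ φ y u) (N y))
      - q y u w • (fderiv ℝ N y v + christoffel G (φ y) (fderiv ℝ φ y v) (N y)) + c • N y := by
  refine ⟨fderiv ℝ (fun z ↦ q z v w) y u - fderiv ℝ (fun z ↦ q z u w) y v
    + q y u (christoffel h y v w) - q y v (christoffel h y u w), ?_⟩
  rw [gauss_codazzi_equation (II := fun z u w ↦ q z u w • N z) hφ hG hh
      (fun v w ↦ (hq v w).smul hN) hgauss,
    fderiv_fun_smul (hq v w) hN, fderiv_fun_smul (hq u w) hN]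
  simp only [add_apply, smul_apply, ContinuousLinearMap.smulRight_apply, map_smul]
  module

end Gauss

/-! ### The connection metric on a trivial bundle -/

section LinearAlgebra

theorem trace_eq_zero_of_skew {F : Type*} [NormedAddCommGroup F] [NormedSpace ℝ F]
    [FiniteDimensional ℝ F] {k : F →L[ℝ] F →L[ℝ] ℝ} (hk : ∀ b, b ≠ 0 → 0 < k b b)
    (hsymm : ∀ b b', k b b' = k b' b) {B : F →ₗ[ℝ] F} (hB : ∀ b b', k (B b) b' = -k (B b') b) :
    LinearMap.trace ℝ F B = 0 := by
  have hinj : Function.Injective (k.toLinearMap₁₂ : F →ₗ[ℝ] Module.Dual ℝ F) := fun u v huv ↦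
    eq_of_forall_apply_eq_of_pos hk fun w ↦ DFunLike.congr_fun huv w
  let e : F ≃ₗ[ℝ] Module.Dual ℝ F :=
    LinearEquiv.ofInjectiveOfFinrankEq k.toLinearMap₁₂ hinj Subspace.dual_finrank_eq.symm
  have he : ∀ u v, e u v = k u v := fun u v ↦ rfl
  -- Under the identification `e` of `F` with its dual, `B` becomes minus its own transpose.
  have hconj : e.conj B = -Module.Dual.transpose (R := ℝ) B := by
    ext f v
    obtain ⟨u, rfl⟩ := e.surjective f
    simp only [LinearEquiv.conj_apply, LinearMap.comp_apply, LinearEquiv.coe_coe,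
      LinearEquiv.symm_apply_apply, LinearMap.neg_apply, Module.Dual.transpose_apply, he]
    rw [hB, hsymm]
  have htr := LinearMap.trace_conj' B e
  rw [hconj, map_neg, LinearMap.trace_transpose'] at htr
  linarith

theorem trace_prod_eq {R X F : Type*} [CommRing R] [AddCommGroup X] [AddCommGroup F] [Module R X]
    [Module R F] [Module.Free R X] [Module.Finite R X] [Module.Free R F] [Module.Finite R F]
    (T : X × F →ₗ[R] X × F) :
    LinearMap.trace R (X × F) T =
      LinearMap.trace R X (LinearMap.fst R X F ∘ₗ T ∘ₗ LinearMap.inl R X F)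
      + LinearMap.trace R F (LinearMap.snd R X F ∘ₗ T ∘ₗ LinearMap.inr R X F) := by
  have hT : T = (T ∘ₗ LinearMap.inl R X F) ∘ₗ LinearMap.fst R X F
      + (T ∘ₗ LinearMap.inr R X F) ∘ₗ LinearMap.snd R X F :=
    LinearMap.ext fun z ↦ by simp [← map_add]
  conv_lhs => rw [hT]
  rw [map_add, LinearMap.trace_comp_comm' (LinearMap.fst R X F),
    LinearMap.trace_comp_comm' (LinearMap.snd R X F)]

end LinearAlgebra

section LocalMetric

variable {X F : Type*} [NormedAddCommGroup X] [NormedSpace ℝ X]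
  [NormedAddCommGroup F] [NormedSpace ℝ F]

/-- The connector `(a, b) ↦ b + A(a) v` at `(x, v)` of the connection `d + A` on `X × F`. -/
def localConnector (A : X → X →L[ℝ] F →L[ℝ] F) (y : X × F) : X × F →L[ℝ] F :=
  .snd ℝ X F + (A y.1).flip y.2 ∘L .fst ℝ X F

@[simp]
theorem localConnector_apply (A : X → X →L[ℝ] F →L[ℝ] F) (y u : X × F) :
    localConnector A y u = u.2 + A y.1 u.1 y.2 := rfl

/-- The connection metric on the trivial bundle `X × F`, for the metric `g` of the base, the fibre
metric `k` and the connection `d + A`. -/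
def localMetric (g : X → X →L[ℝ] X →L[ℝ] ℝ) (k : X → F →L[ℝ] F →L[ℝ] ℝ)
    (A : X → X →L[ℝ] F →L[ℝ] F) (y : X × F) : X × F →L[ℝ] X × F →L[ℝ] ℝ :=
  (ContinuousLinearMap.fst ℝ X F).precomp ℝ ∘L (g y.1 ∘L .fst ℝ X F)
    + (localConnector A y).precomp ℝ ∘L (k y.1 ∘L localConnector A y)

theorem localMetric_apply (g : X → X →L[ℝ] X →L[ℝ] ℝ) (k : X → F →L[ℝ] F →L[ℝ] ℝ)
    (A : X → X →L[ℝ] F →L[ℝ] F) (y u w : X × F) :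
    localMetric g k A y u w =
      g y.1 u.1 w.1 + k y.1 (localConnector A y u) (localConnector A y w) := rfl

/-- A Riemannian vector bundle with compatible connection over a Riemannian manifold, read in a
chart and a local frame over it: a base metric `g`, a fibre metric `k`, and a connection form `A`
compatible with `k`, all smooth on the open set `Ω`. -/
structure IsConnectionData (g : X → X →L[ℝ] X →L[ℝ] ℝ) (k : X → F →L[ℝ] F →L[ℝ] ℝ)
    (A : X → X →L[ℝ] F →L[ℝ] F) (Ω : Set X) : Prop where
  base : IsMetricOn g Ω
  fiber : IsMetricOn k Ω
  contDiffOn_form : ContDiffOn ℝ ∞ A Ω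
  compatible : ∀ x ∈ Ω, IsMetricConnectionAt k A x

namespace IsConnectionData

variable {g : X → X →L[ℝ] X →L[ℝ] ℝ} {k : X → F →L[ℝ] F →L[ℝ] ℝ}
  {A : X → X →L[ℝ] F →L[ℝ] F} {Ω : Set X} {y : X × F} {x : X}

theorem isOpen (h : IsConnectionData g k A Ω) : IsOpen Ω := h.base.isOpen

theorem contDiffAt_form (h : IsConnectionData g k A Ω) (hx : x ∈ Ω) : ContDiffAt ℝ ∞ A x :=
  h.contDiffOn_form.contDiffAt (h.isOpen.mem_nhds hx)

theorem differentiableAt_form (h : IsConnectionData g k A Ω) (hx : x ∈ Ω) :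
    DifferentiableAt ℝ A x :=
  (h.contDiffAt_form hx).differentiableAt (by simp)

theorem contDiffAt_localConnector (h : IsConnectionData g k A Ω) (hy : y.1 ∈ Ω) :
    ContDiffAt ℝ ∞ (localConnector A) y := by
  have hA : ContDiffAt ℝ ∞ (fun z : X × F ↦ A z.1) y :=
    (h.contDiffAt_form hy).comp y contDiffAt_fst
  have hflip : ContDiffAt ℝ ∞ (fun z : X × F ↦ (A z.1).flip) y :=
    (ContinuousLinearMap.flipₗᵢ ℝ X F F).contDiff.contDiffAt.comp y hA
  exact contDiffAt_const.add ((hflip.clm_apply contDiffAt_snd).clm_comp contDiffAt_const)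

theorem differentiableAt_localConnector (h : IsConnectionData g k A Ω) (hy : y.1 ∈ Ω) :
    DifferentiableAt ℝ (localConnector A) y :=
  (h.contDiffAt_localConnector hy).differentiableAt (by simp)

theorem contDiffAt_localMetric (h : IsConnectionData g k A Ω) (hy : y.1 ∈ Ω) :
    ContDiffAt ℝ ∞ (localMetric g k A) y := by
  have hg : ContDiffAt ℝ ∞ (fun z : X × F ↦ g z.1) y :=
    (h.base.contDiffAt hy).comp y contDiffAt_fst
  have hk : ContDiffAt ℝ ∞ (fun z : X × F ↦ k z.1) y :=
    (h.fiber.contDiffAt hy).comp y contDiffAt_fst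
  have hK := h.contDiffAt_localConnector hy
  have hpre : ContDiffAt ℝ ∞ (fun z ↦ (localConnector A z).precomp ℝ) y :=
    (ContinuousLinearMap.compL ℝ (X × F) F ℝ).flip.contDiff.contDiffAt.comp y hK
  exact (contDiffAt_const.clm_comp (hg.clm_comp contDiffAt_const)).add
    (hpre.clm_comp (hk.clm_comp hK))

theorem isMetricOn (h : IsConnectionData g k A Ω) :
    IsMetricOn (localMetric g k A) (Ω ×ˢ univ) where
  isOpen := h.isOpen.prod isOpen_univ
  contDiffOn := fun _ hy ↦ (h.contDiffAt_localMetric hy.1).contDiffWithinAt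
  symm := fun y hy u w ↦ by
    rw [localMetric_apply, localMetric_apply, h.base.symm _ hy.1, h.fiber.symm _ hy.1]
  pos := fun y hy u hu ↦ by
    rw [localMetric_apply]
    by_cases hu₁ : u.1 = 0
    · have hu₂ : u.2 ≠ 0 := fun hu₂ ↦ hu (Prod.ext hu₁ hu₂)
      simpa [hu₁] using h.fiber.pos _ hy.1 _ hu₂
    · exact add_pos_of_pos_of_nonneg (h.base.pos _ hy.1 _ hu₁) (h.fiber.nonneg hy.1 _)

theorem fderiv_localConnector_apply (h : IsConnectionData g k A Ω) (hy : y.1 ∈ Ω) (u w : X × F) :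
    fderiv ℝ (fun z ↦ localConnector A z u) y w =
      fderiv ℝ A y.1 w.1 u.1 y.2 + A y.1 u.1 w.2 := by
  have hA := h.differentiableAt_form hy
  have hA' : DifferentiableAt ℝ (fun z : X × F ↦ A z.1) y := hA.comp y differentiableAt_fst
  simp only [localConnector_apply]
  rw [fderiv_fun_add (by fun_prop) (by fun_prop), add_apply,
    fderiv_clm_apply₂ hA' (differentiableAt_const _) differentiableAt_snd, fderiv_comp_fst hA,
    fderiv_snd]
  simp

theorem fderiv_localMetric_apply (h : IsConnectionData g k A Ω) (hy : y.1 ∈ Ω) (w u u' : X × F) :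
    fderiv ℝ (localMetric g k A) y w u u' = fderiv ℝ g y.1 w.1 u.1 u'.1
      + (k y.1 (A y.1 w.1 (localConnector A y u)) (localConnector A y u')
        + k y.1 (localConnector A y u) (A y.1 w.1 (localConnector A y u')))
      + k y.1 (fderiv ℝ A y.1 w.1 u.1 y.2 + A y.1 u.1 w.2) (localConnector A y u')
      + k y.1 (localConnector A y u) (fderiv ℝ A y.1 w.1 u'.1 y.2 + A y.1 u'.1 w.2) := by
  have hg : DifferentiableAt ℝ g y.1 := (h.base.contDiffAt hy).differentiableAt (by simp)
  have hk : DifferentiableAt ℝ k y.1 := (h.fiber.contDiffAt hy).differentiableAt (by simp)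
  have hK := h.differentiableAt_localConnector hy
  have hg' : DifferentiableAt ℝ (fun z : X × F ↦ g z.1) y := hg.comp y differentiableAt_fst
  have hk' : DifferentiableAt ℝ (fun z : X × F ↦ k z.1) y := hk.comp y differentiableAt_fst
  have hKu : DifferentiableAt ℝ (fun z ↦ localConnector A z u) y := by fun_prop
  have hKu' : DifferentiableAt ℝ (fun z ↦ localConnector A z u') y := by fun_prop
  rw [← fderiv_clm_apply₂_const ((h.contDiffAt_localMetric hy).differentiableAt (by simp))]
  simp only [localMetric_apply]
  rw [fderiv_fun_add (by fun_prop) (by fun_prop), add_apply, fderiv_clm_apply₂_const hg',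
    fderiv_comp_fst hg, fderiv_clm_apply₂ hk' hKu hKu', fderiv_comp_fst hk,
    h.fderiv_localConnector_apply hy, h.fderiv_localConnector_apply hy]
  simp only [ContinuousLinearMap.comp_apply, ContinuousLinearMap.coe_fst']
  rw [h.compatible _ hy]
  ring

variable [FiniteDimensional ℝ X] [FiniteDimensional ℝ F]

/- The position field `P(x, v) = (0, v)` satisfies `∇_u P = (0, K u)`, where `K` is the connector:
`∂_u P = (0, u.2)`, and this lemma gives the remaining term `Γ(u, P)`. -/
theorem christoffel_position (h : IsConnectionData g k A Ω) (hy : y.1 ∈ Ω) (u : X × F) :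
    christoffel (localMetric g k A) y u (0, y.2) = (0, A y.1 u.1 y.2) := by
  refine h.isMetricOn.christoffel_eq (y := y) ⟨hy, mem_univ _⟩ fun w ↦ ?_
  have hskew : k y.1 (connectionCurvature A y.1 u.1 w.1 y.2) y.2 = 0 :=
    apply_connectionCurvature_self
      ((h.fiber.contDiffAt hy).of_le (WithTop.coe_le_coe.2 le_top))
      (h.differentiableAt_form hy) (h.fiber.symm _ hy)
      (eventually_of_mem (h.isOpen.mem_nhds hy) h.compatible) u.1 w.1 y.2
  simp only [connectionCurvature, h.fderiv_localMetric_apply hy, localMetric_apply,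
    localConnector_apply, map_add, map_sub, map_zero, add_apply, sub_apply, zero_apply, zero_add,
    add_zero] at hskew ⊢
  have s := h.fiber.symm _ hy
  linarith [s y.2 (fderiv ℝ A y.1 u.1 w.1 y.2), s y.2 (fderiv ℝ A y.1 w.1 u.1 y.2),
    s y.2 (A y.1 u.1 (A y.1 w.1 y.2)), s y.2 (A y.1 w.1 (A y.1 u.1 y.2)),
    s y.2 (A y.1 u.1 w.2), s y.2 (A y.1 w.1 u.2), s (A y.1 w.1 y.2) (A y.1 u.1 y.2)]

theorem covDeriv_smul_position (h : IsConnectionData g k A Ω) (hy : y.1 ∈ Ω)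
    {c : X × F → ℝ} (hc : DifferentiableAt ℝ c y) (w : X × F) :
    fderiv ℝ (fun z ↦ c z • ((0, z.2) : X × F)) y w
        + christoffel (localMetric g k A) y w (c y • (0, y.2)) =
      fderiv ℝ c y w • (0, y.2) + c y • (0, localConnector A y w) := by
  have hposition : HasFDerivAt (fun z : X × F ↦ ((0, z.2) : X × F))
      (ContinuousLinearMap.inr ℝ X F ∘L ContinuousLinearMap.snd ℝ X F) y :=
    (ContinuousLinearMap.inr ℝ X F ∘L ContinuousLinearMap.snd ℝ X F).hasFDerivAt
  rw [(hc.hasFDerivAt.fun_smul hposition).fderiv, map_smul, h.christoffel_position hy,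
    localConnector_apply]
  ext <;> simp
  module

theorem fderiv_christoffel_position (h : IsConnectionData g k A Ω) (hy : y.1 ∈ Ω) (u w : X × F) :
    fderiv ℝ (christoffel (localMetric g k A)) y w u (0, y.2)
      + christoffel (localMetric g k A) y u (0, w.2) =
    (0, fderiv ℝ A y.1 w.1 u.1 y.2 + A y.1 u.1 w.2) := by
  have hyO : y ∈ Ω ×ˢ (univ : Set F) := ⟨hy, mem_univ _⟩
  have hΓ := h.isMetricOn.differentiableAt_christoffel hyO
  let inr := ContinuousLinearMap.inr ℝ X F
  have hP' : fderiv ℝ (fun z : X × F ↦ ((0 : X), z.2)) y = inr ∘L .snd ℝ X F :=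
    (inr ∘L .snd ℝ X F).fderiv
  have hK : DifferentiableAt ℝ (fun z ↦ localConnector A z u) y :=
    (h.differentiableAt_localConnector hy).clm_apply (differentiableAt_const _)
  have hΓP : (fun z : X × F ↦ christoffel (localMetric g k A) z u ((0 : X), z.2)) =ᶠ[𝓝 y]
      fun z ↦ inr (localConnector A z u - u.2) := by
    filter_upwards [h.isMetricOn.isOpen.mem_nhds hyO] with z hz
    rw [h.christoffel_position hz.1]
    simp [inr]
  calc _ = fderiv ℝ (fun z : X × F ↦ christoffel (localMetric g k A) z u ((0 : X), z.2)) y w := by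
        rw [fderiv_clm_apply₂ hΓ (differentiableAt_const u) (by fun_prop), hP']
        simp [inr]
    _ = inr (fderiv ℝ (fun z ↦ localConnector A z u) y w) := by
        have hd : HasFDerivAt (fun z ↦ inr (localConnector A z u - u.2))
            (inr ∘L fderiv ℝ (fun z ↦ localConnector A z u) y) y :=
          inr.hasFDerivAt.comp y (hK.hasFDerivAt.sub_const u.2)
        rw [hΓP.fderiv_eq, hd.fderiv]
        rfl
    _ = _ := by rw [h.fderiv_localConnector_apply hy]; rfl

theorem curvatureEndo_position (h : IsConnectionData g k A Ω) (hy : y.1 ∈ Ω) (u : X × F) :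
    curvatureEndo (localMetric g k A) y (0, y.2) (0, y.2) u = 0 := by
  have hΓ := h.isMetricOn.christoffel_symm (y := y) ⟨hy, mem_univ _⟩
  have hP := h.christoffel_position hy
  have hPu := h.fderiv_christoffel_position hy (0, y.2) u
  have huP := h.fderiv_christoffel_position hy u (0, y.2)
  rw [hΓ, hP] at hPu
  rw [hP] at huP
  rw [curvatureEndo_apply, hP, hP, hΓ (0, y.2), hP]
  simp only [map_zero, zero_apply, add_zero, zero_add, Prod.mk_zero_zero] at hPu huP ⊢
  simp [hPu, add_eq_right.1 huP]

theorem curvatureEndo_zero_vertical_self (h : IsConnectionData g k A Ω) (hx : x ∈ Ω) (b : F)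
    (u : X × F) : curvatureEndo (localMetric g k A) (x, 0) (0, b) (0, b) u = 0 := by
  have hray : Tendsto (fun t : ℝ ↦ (x, t • b)) (𝓝[≠] 0) (𝓝 (x, 0)) := by
    have hcont : Continuous fun t : ℝ ↦ (x, t • b) := by fun_prop
    exact (hcont.tendsto' 0 _ (by simp)).mono_left nhdsWithin_le_nhds
  have hlim : Tendsto
      (fun t : ℝ ↦ curvatureEndo (localMetric g k A) (x, t • b) (0, b) (0, b) u) (𝓝[≠] 0)
      (𝓝 (curvatureEndo (localMetric g k A) (x, 0) (0, b) (0, b) u)) :=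
    ((h.isMetricOn.continuousAt_curvatureEndo (γ := id) (t := (x, 0)) ⟨hx, mem_univ _⟩
      continuousAt_id continuousAt_const continuousAt_const).clm_apply
      continuousAt_const).tendsto.comp hray
  refine tendsto_nhds_unique (hlim.congr' ?_) tendsto_const_nhds
  filter_upwards [self_mem_nhdsWithin] with t (ht : t ≠ 0)
  have hpos := h.curvatureEndo_position (y := (x, t • b)) hx u
  have htb : ((0 : X), t • b) = t • ((0 : X), b) := by simp
  simp only [htb, curvatureEndo_apply, map_smul, smul_apply, ← smul_add, ← smul_sub,
    smul_smul] at hpos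
  simpa [curvatureEndo_apply] using (smul_eq_zero.1 hpos).resolve_left (mul_ne_zero ht ht)

theorem curvatureEndo_zero_vertical (h : IsConnectionData g k A Ω) (hx : x ∈ Ω) (b b' : F)
    (u : X × F) : curvatureEndo (localMetric g k A) (x, 0) (0, b) (0, b') u =
      -curvatureEndo (localMetric g k A) (x, 0) (0, b') (0, b) u := by
  have hsum := h.curvatureEndo_zero_vertical_self hx (b + b') u
  have hb := h.curvatureEndo_zero_vertical_self hx b u
  have hb' := h.curvatureEndo_zero_vertical_self hx b' u
  have hadd : ((0 : X), b + b') = (0, b) + (0, b') := by simp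
  simp only [hadd, curvatureEndo_apply, map_add, add_apply] at hsum hb hb' ⊢
  linear_combination (norm := module) hsum - hb - hb'

theorem christoffel_zero_horizontal (h : IsConnectionData g k A Ω) (hx : x ∈ Ω) (a a' : X) :
    christoffel (localMetric g k A) (x, 0) (a, 0) (a', 0) = (christoffel g x a a', 0) := by
  refine h.isMetricOn.christoffel_eq (y := (x, 0)) ⟨hx, mem_univ _⟩ fun w ↦ ?_
  have := h.base.two_mul_apply_christoffel hx a a' w.1
  simp only [h.fderiv_localMetric_apply (y := (x, 0)) hx, localMetric_apply, localConnector_apply,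
    map_zero, zero_apply, zero_add, add_zero]
  linarith

/- The zero section is totally geodesic, so that the Gauss equation has no correction term. -/
theorem curvatureEndo_zero_horizontal (h : IsConnectionData g k A Ω) (hx : x ∈ Ω) (a a' α : X) :
    curvatureEndo (localMetric g k A) (x, 0) (a, 0) (a', 0) (α, 0) =
      (curvatureEndo g x a a' α, 0) := by
  have hd : fderiv ℝ (ContinuousLinearMap.inl ℝ X F) = fun _ ↦ .inl ℝ X F := by
    ext1 z
    exact ContinuousLinearMap.fderiv _
  have hgauss : ∀ᶠ z in 𝓝 x, IsSecondFundamentalFormAt (localMetric g k A) g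
      (ContinuousLinearMap.inl ℝ X F) (fun _ _ _ ↦ 0) z := by
    filter_upwards [h.isOpen.mem_nhds hx] with z hz u w
    simp [hd, h.christoffel_zero_horizontal hz u w]
  simpa [hd] using gauss_codazzi_equation (ContinuousLinearMap.contDiff _).contDiffAt
    (h.isMetricOn.differentiableAt_christoffel (y := (x, 0)) ⟨hx, mem_univ _⟩)
    (h.base.differentiableAt_christoffel hx) (fun _ _ ↦ differentiableAt_const _) hgauss α a a'

theorem ricci_zero_horizontal (h : IsConnectionData g k A Ω) (hx : x ∈ Ω) (a : X) :
    ricci (localMetric g k A) (x, 0) (a, 0) (a, 0) = ricci g x a a := by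
  let R := curvatureEndo (localMetric g k A) (x, 0)
  have hbase : LinearMap.fst ℝ X F ∘ₗ (R (a, 0) (a, 0) : X × F →ₗ[ℝ] X × F) ∘ₗ
      LinearMap.inl ℝ X F = (curvatureEndo g x a a : X →ₗ[ℝ] X) := by
    ext α
    simp [R, h.curvatureEndo_zero_horizontal hx]
  have hfibre : ∀ b b' : F, k x (R (a, 0) (a, 0) (0, b)).2 b' =
      localMetric g k A (x, 0) (R (0, b) (0, b') (a, 0)) (a, 0) := by
    intro b b'
    have hskew := h.isMetricOn.apply_curvatureEndo_skew (y := (x, 0)) ⟨hx, mem_univ _⟩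
      (0, b) (a, 0) (a, 0) (0, b')
    have hanti : R (a, 0) (0, b') (0, b) = -R (0, b) (0, b') (a, 0) := by
      simp only [R, curvatureEndo_apply]
      abel
    rw [hanti, map_neg, neg_apply, neg_neg] at hskew
    rw [← hskew]
    simp [R, localMetric_apply]
  rw [ricci, trace_prod_eq, hbase, ricci, add_eq_left]
  refine trace_eq_zero_of_skew (h.fiber.pos x hx) (h.fiber.symm x hx) fun b b' ↦ ?_
  change k x (R (a, 0) (a, 0) (0, b)).2 b' = -k x (R (a, 0) (a, 0) (0, b')).2 b
  simp only [hfibre, R, h.curvatureEndo_zero_vertical hx b b', map_neg, neg_apply]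

end IsConnectionData

end LocalMetric

/-! ### Induced metrics and the Gauss equation of the sphere bundles -/

section Immersion

variable {W V : Type*} [NormedAddCommGroup W] [NormedSpace ℝ W]
  [NormedAddCommGroup V] [NormedSpace ℝ V]

/-- `φ` is a smooth immersion of the open set `U` into `O`. -/
structure IsImmersionOn (φ : W → V) (U : Set W) (O : Set V) : Prop where
  isOpen : IsOpen U
  contDiffOn : ContDiffOn ℝ ∞ φ U
  mapsTo : MapsTo φ U O
  injective : ∀ z ∈ U, Function.Injective (fderiv ℝ φ z)

/-- The metric `φ^* G` induced on `W` by the map `φ : W → V` and the metric `G` on `V`. -/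
def inducedMetric (G : V → V →L[ℝ] V →L[ℝ] ℝ) (φ : W → V) (z : W) : W →L[ℝ] W →L[ℝ] ℝ :=
  (fderiv ℝ φ z).precomp ℝ ∘L (G (φ z) ∘L fderiv ℝ φ z)

theorem inducedMetric_apply (G : V → V →L[ℝ] V →L[ℝ] ℝ) (φ : W → V) (z u w : W) :
    inducedMetric G φ z u w = G (φ z) (fderiv ℝ φ z u) (fderiv ℝ φ z w) := rfl

/-- The covariant derivative `∇_u N` at `z`, for the metric `G`, of a vector field `N` along `φ`. -/
def covDerivAlong (G : V → V →L[ℝ] V →L[ℝ] ℝ) (φ N : W → V) (z u : W) : V :=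
  fderiv ℝ N z u + christoffel G (φ z) (fderiv ℝ φ z u) (N z)

/-- The second fundamental form `G(II(u, w), ν) = -G(∇_u ν, dφ w)` of `φ` with respect to the
unit normal field `ν`. -/
def secondFundamentalForm (G : V → V →L[ℝ] V →L[ℝ] ℝ) (φ ν : W → V) (z u w : W) : ℝ :=
  -G (φ z) (covDerivAlong G φ ν z u) (fderiv ℝ φ z w)

/-- `ν` is a smooth unit normal field along `φ` for the metric `G`. -/
structure IsUnitNormalOn (G : V → V →L[ℝ] V →L[ℝ] ℝ) (φ ν : W → V) (U : Set W) : Prop where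
  contDiffOn : ContDiffOn ℝ ∞ ν U
  orthogonal : ∀ z ∈ U, ∀ u, G (φ z) (ν z) (fderiv ℝ φ z u) = 0
  unit : ∀ z ∈ U, G (φ z) (ν z) (ν z) = 1

variable {G : V → V →L[ℝ] V →L[ℝ] ℝ} {O : Set V} {φ N ν : W → V} {U : Set W} {z : W}

theorem IsImmersionOn.contDiffAt (hφ : IsImmersionOn φ U O) (hz : z ∈ U) : ContDiffAt ℝ ∞ φ z :=
  hφ.contDiffOn.contDiffAt (hφ.isOpen.mem_nhds hz)

theorem IsUnitNormalOn.contDiffAt (hν : IsUnitNormalOn G φ ν U) (hU : IsOpen U) (hz : z ∈ U) :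
    ContDiffAt ℝ ∞ ν z :=
  hν.contDiffOn.contDiffAt (hU.mem_nhds hz)

namespace IsMetricOn

theorem contDiffAt_inducedMetric (hG : IsMetricOn G O) (hφ : ContDiffAt ℝ ∞ φ z)
    (hz : φ z ∈ O) : ContDiffAt ℝ ∞ (inducedMetric G φ) z := by
  have hdφ := contDiffAt_infty_fderiv hφ
  have hGφ : ContDiffAt ℝ ∞ (fun z ↦ G (φ z)) z := (hG.contDiffAt hz).comp z hφ
  have hpre : ContDiffAt ℝ ∞ (fun z ↦ (fderiv ℝ φ z).precomp ℝ) z :=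
    (ContinuousLinearMap.compL ℝ W V ℝ).flip.contDiff.contDiffAt.comp z hdφ
  exact hpre.clm_comp (hGφ.clm_comp hdφ)

theorem isMetricOn_inducedMetric (hG : IsMetricOn G O) (hφ : IsImmersionOn φ U O) :
    IsMetricOn (inducedMetric G φ) U where
  isOpen := hφ.isOpen
  contDiffOn := fun _ hz ↦
    (hG.contDiffAt_inducedMetric (hφ.contDiffAt hz) (hφ.mapsTo hz)).contDiffWithinAt
  symm := fun z hz u w ↦ by
    rw [inducedMetric_apply, inducedMetric_apply, hG.symm _ (hφ.mapsTo hz)]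
  pos := fun z hz u hu ↦
    hG.pos _ (hφ.mapsTo hz) _ fun h ↦ hu (hφ.injective z hz (by simpa using h))

theorem fderiv_apply_along (hG : IsMetricOn G O) (hφ : DifferentiableAt ℝ φ z) (hz : φ z ∈ O)
    {a b : W → V} (ha : DifferentiableAt ℝ a z) (hb : DifferentiableAt ℝ b z) (u : W) :
    fderiv ℝ (fun z ↦ G (φ z) (a z) (b z)) z u = fderiv ℝ G (φ z) (fderiv ℝ φ z u) (a z) (b z)
      + G (φ z) (fderiv ℝ a z u) (b z) + G (φ z) (a z) (fderiv ℝ b z u) := by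
  have hd : DifferentiableAt ℝ G (φ z) := (hG.contDiffAt hz).differentiableAt (by simp)
  have hGφ : DifferentiableAt ℝ (fun z ↦ G (φ z)) z := hd.comp (g := G) z hφ
  have hGφ' : fderiv ℝ (fun z ↦ G (φ z)) z = fderiv ℝ G (φ z) ∘L fderiv ℝ φ z :=
    fderiv_comp (g := G) z hd hφ
  rw [fderiv_clm_apply₂ hGφ ha hb, hGφ']
  rfl

theorem fderiv_inducedMetric_apply (hG : IsMetricOn G O) (hφ : ContDiffAt ℝ ∞ φ z)
    (hz : φ z ∈ O) (w u v : W) : fderiv ℝ (inducedMetric G φ) z w u v =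
      fderiv ℝ G (φ z) (fderiv ℝ φ z w) (fderiv ℝ φ z u) (fderiv ℝ φ z v)
      + G (φ z) (fderiv ℝ (fderiv ℝ φ) z w u) (fderiv ℝ φ z v)
      + G (φ z) (fderiv ℝ φ z u) (fderiv ℝ (fderiv ℝ φ) z w v) := by
  have hdφ : DifferentiableAt ℝ (fderiv ℝ φ) z :=
    (contDiffAt_infty_fderiv hφ).differentiableAt (by simp)
  rw [← fderiv_clm_apply₂_const ((hG.contDiffAt_inducedMetric hφ hz).differentiableAt (by simp))]
  simp only [inducedMetric_apply]
  rw [hG.fderiv_apply_along (hφ.differentiableAt (by simp)) hz (by fun_prop) (by fun_prop),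
    fderiv_clm_apply_const hdφ, fderiv_clm_apply_const hdφ]

variable [FiniteDimensional ℝ V]

theorem fderiv_apply_eq_covDerivAlong (hG : IsMetricOn G O) (hφ : DifferentiableAt ℝ φ z)
    (hz : φ z ∈ O) {a b : W → V} (ha : DifferentiableAt ℝ a z) (hb : DifferentiableAt ℝ b z)
    (u : W) :
    fderiv ℝ (fun z ↦ G (φ z) (a z) (b z)) z u =
      G (φ z) (covDerivAlong G φ a z u) (b z) + G (φ z) (a z) (covDerivAlong G φ b z u) := by
  rw [hG.fderiv_apply_along hφ hz ha hb, hG.isMetricConnectionAt_christoffel hz]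
  simp only [covDerivAlong, map_add, add_apply]
  ring

theorem differentiableAt_covDerivAlong (hG : IsMetricOn G O) (hφ : ContDiffAt ℝ ∞ φ z)
    (hz : φ z ∈ O) (hN : ContDiffAt ℝ ∞ N z) (u : W) :
    DifferentiableAt ℝ (fun z ↦ covDerivAlong G φ N z u) z := by
  have hΓ : DifferentiableAt ℝ (fun z ↦ christoffel G (φ z)) z :=
    (hG.differentiableAt_christoffel hz).comp (g := christoffel G) z
      (hφ.differentiableAt (by simp))
  have hdφ := (contDiffAt_infty_fderiv hφ).differentiableAt (by simp)
  have hdN := (contDiffAt_infty_fderiv hN).differentiableAt (by simp)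
  have hN₀ := hN.differentiableAt (by simp)
  unfold covDerivAlong
  fun_prop

theorem differentiableAt_secondFundamentalForm (hG : IsMetricOn G O) (hφ : ContDiffAt ℝ ∞ φ z)
    (hz : φ z ∈ O) (hν : ContDiffAt ℝ ∞ ν z) (u w : W) :
    DifferentiableAt ℝ (fun z ↦ secondFundamentalForm G φ ν z u w) z := by
  have hGφ : DifferentiableAt ℝ (fun z ↦ G (φ z)) z :=
    ((hG.contDiffAt hz).differentiableAt (by simp)).comp (g := G) z (hφ.differentiableAt (by simp))
  have hdφ := (contDiffAt_infty_fderiv hφ).differentiableAt (by simp)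
  have hνu := hG.differentiableAt_covDerivAlong hφ hz hν u
  exact ((hGφ.clm_apply hνu).clm_apply (by fun_prop)).neg

theorem apply_covDerivAlong_normal (hG : IsMetricOn G O) (hφ : IsImmersionOn φ U O)
    (hν : IsUnitNormalOn G φ ν U) (hz : z ∈ U) (u w : W) :
    G (φ z) (covDerivAlong G φ (fun z ↦ fderiv ℝ φ z w) z u) (ν z) =
      secondFundamentalForm G φ ν z u w := by
  have hφz := hφ.contDiffAt hz
  have hdφ := (contDiffAt_infty_fderiv hφz).differentiableAt (by simp)
  have hzero : (fun z ↦ G (φ z) (ν z) (fderiv ℝ φ z w)) =ᶠ[𝓝 z] fun _ ↦ 0 := by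
    filter_upwards [hφ.isOpen.mem_nhds hz] with z hz using hν.orthogonal z hz w
  have hleibniz := DFunLike.congr_fun (hzero.fderiv_eq (𝕜 := ℝ)) u
  rw [hG.fderiv_apply_eq_covDerivAlong (hφz.differentiableAt (by simp)) (hφ.mapsTo hz)
    ((hν.contDiffAt hφ.isOpen hz).differentiableAt (by simp)) (by fun_prop),
    hG.symm _ (hφ.mapsTo hz) (ν z)] at hleibniz
  simp only [fderiv_fun_const, Pi.zero_apply, zero_apply] at hleibniz
  rw [secondFundamentalForm]
  linarith

variable [FiniteDimensional ℝ W]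

theorem apply_covDerivAlong_tangent (hG : IsMetricOn G O) (hφ : IsImmersionOn φ U O) (hz : z ∈ U)
    (u v w : W) :
    G (φ z) (covDerivAlong G φ (fun z ↦ fderiv ℝ φ z v) z u) (fderiv ℝ φ z w) =
      inducedMetric G φ z (christoffel (inducedMetric G φ) z u v) w := by
  have hφz := hφ.contDiffAt hz
  have hφ₂ : ContDiffAt ℝ 2 φ z := hφz.of_le (WithTop.coe_le_coe.2 le_top)
  have hGz := hG.symm _ (hφ.mapsTo hz)
  have hind := (hG.isMetricOn_inducedMetric hφ).two_mul_apply_christoffel hz u v w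
  have hamb := hG.two_mul_apply_christoffel (hφ.mapsTo hz) (fderiv ℝ φ z u) (fderiv ℝ φ z v)
    (fderiv ℝ φ z w)
  simp only [hG.fderiv_inducedMetric_apply hφz (hφ.mapsTo hz)] at hind
  rw [fderiv_fderiv_comm hφ₂ v u, fderiv_fderiv_comm hφ₂ w u, fderiv_fderiv_comm hφ₂ w v] at hind
  rw [covDerivAlong,
    fderiv_clm_apply_const ((contDiffAt_infty_fderiv hφz).differentiableAt (by simp)), map_add,
    add_apply]
  linarith [hGz (fderiv ℝ φ z v) (fderiv ℝ (fderiv ℝ φ) z u w),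
    hGz (fderiv ℝ φ z u) (fderiv ℝ (fderiv ℝ φ) z v w)]

end IsMetricOn

end Immersion

section Splitting

variable {K W V : Type*} [Field K] [AddCommGroup W] [Module K W] [AddCommGroup V] [Module K V]
  [FiniteDimensional K V]

theorem exists_splitting {L : W →ₗ[K] V} (hL : Function.Injective L) {α : V →ₗ[K] K} {n : V}
    (hαL : ∀ u, α (L u) = 0) (hαn : α n = 1)
    (hdim : Module.finrank K W + 1 = Module.finrank K V) :
    ∃ ρ : V →ₗ[K] W, (∀ u, ρ (L u) = u) ∧ ∀ Y, L (ρ Y) + α Y • n = Y := by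
  have hrange : LinearMap.range L = LinearMap.ker α := by
    refine Submodule.eq_of_le_of_finrank_eq ?_ ?_
    · rintro _ ⟨u, rfl⟩
      exact hαL u
    · have hker := Module.Dual.finrank_ker_add_one_of_ne_zero (f := α)
        (fun h ↦ by simp [h] at hαn)
      rw [LinearMap.finrank_range_of_inj hL]
      lia
  obtain ⟨ρ₀, hρ₀⟩ := LinearMap.exists_leftInverse_of_injective L (LinearMap.ker_eq_bot.2 hL)
  have hρ₀L : ∀ u, ρ₀ (L u) = u := LinearMap.congr_fun hρ₀
  refine ⟨ρ₀ ∘ₗ (LinearMap.id - α.smulRight n), fun u ↦ by simp [hαL, hρ₀L], fun Y ↦ ?_⟩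
  obtain ⟨u, hu⟩ : Y - α Y • n ∈ LinearMap.range L := by simp [hrange, hαn]
  simp [← hu, hρ₀L, eq_sub_iff_add_eq.1 hu]

theorem trace_eq_of_splitting [FiniteDimensional K W] {L : W →ₗ[K] V} {α : V →ₗ[K] K} {n : V}
    {ρ : V →ₗ[K] W} (h : ∀ Y, L (ρ Y) + α Y • n = Y) (T : V →ₗ[K] V) :
    LinearMap.trace K V T = LinearMap.trace K W (ρ ∘ₗ T ∘ₗ L) + α (T n) := by
  have hT : T = (T ∘ₗ L) ∘ₗ ρ + α.smulRight (T n) := by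
    refine LinearMap.ext fun Y ↦ ?_
    conv_lhs => rw [← h Y]
    simp
  conv_lhs => rw [hT]
  rw [map_add, LinearMap.trace_comp_comm' ρ, LinearMap.trace_smulRight]

end Splitting

section Hypersurface

variable {W V : Type*} [NormedAddCommGroup W] [NormedSpace ℝ W] [FiniteDimensional ℝ W]
  [NormedAddCommGroup V] [NormedSpace ℝ V] [FiniteDimensional ℝ V]
  {G : V → V →L[ℝ] V →L[ℝ] ℝ} {O : Set V} {φ ν : W → V} {U : Set W} {z : W}

namespace IsUnitNormalOn

omit [FiniteDimensional ℝ W] in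
theorem exists_splitting (hν : IsUnitNormalOn G φ ν U) (hφ : IsImmersionOn φ U O)
    (hdim : Module.finrank ℝ W + 1 = Module.finrank ℝ V) (hz : z ∈ U) :
    ∃ ρ : V →ₗ[ℝ] W, (∀ u, ρ (fderiv ℝ φ z u) = u) ∧
      ∀ Y, fderiv ℝ φ z (ρ Y) + G (φ z) (ν z) Y • ν z = Y :=
  _root_.exists_splitting (L := (fderiv ℝ φ z : W →ₗ[ℝ] V))
    (α := (G (φ z) (ν z) : V →ₗ[ℝ] ℝ)) (n := ν z) (hφ.injective z hz) (hν.orthogonal z hz)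
    (hν.unit z hz) hdim

theorem isSecondFundamentalFormAt (hν : IsUnitNormalOn G φ ν U) (hG : IsMetricOn G O)
    (hφ : IsImmersionOn φ U O) (hdim : Module.finrank ℝ W + 1 = Module.finrank ℝ V)
    (hz : z ∈ U) :
    IsSecondFundamentalFormAt G (inducedMetric G φ) φ
      (fun z u w ↦ secondFundamentalForm G φ ν z u w • ν z) z := by
  intro u w
  have hdφ : DifferentiableAt ℝ (fderiv ℝ φ) z :=
    (contDiffAt_infty_fderiv (hφ.contDiffAt hz)).differentiableAt (by simp)
  obtain ⟨ρ, -, hρ⟩ := hν.exists_splitting hφ hdim hz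
  refine eq_of_forall_apply_eq_of_pos (hG.pos _ (hφ.mapsTo hz)) fun Y ↦ ?_
  have htangent := hG.apply_covDerivAlong_tangent hφ hz u w (ρ Y)
  have hnormal := hG.apply_covDerivAlong_normal hφ hν hz u w
  have horth := hν.orthogonal z hz (christoffel (inducedMetric G φ) z u w)
  rw [hG.symm _ (hφ.mapsTo hz)] at horth
  rw [covDerivAlong, fderiv_clm_apply_const hdφ] at htangent hnormal
  rw [inducedMetric_apply] at htangent
  rw [← hρ Y]
  generalize G (φ z) (ν z) Y = c
  simp only [map_add, map_smul, add_apply, smul_apply, smul_eq_mul, hν.orthogonal z hz,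
    hν.unit z hz] at htangent hnormal ⊢
  linear_combination htangent + c * hnormal - c * horth

theorem ricci_eq (hν : IsUnitNormalOn G φ ν U) (hG : IsMetricOn G O) (hφ : IsImmersionOn φ U O)
    (hdim : Module.finrank ℝ W + 1 = Module.finrank ℝ V) (hz : z ∈ U) {S : W →ₗ[ℝ] W}
    (hS : ∀ w, fderiv ℝ φ z (S w) = covDerivAlong G φ ν z w) (u : W) :
    ricci (inducedMetric G φ) z u u =
      ricci G (φ z) (fderiv ℝ φ z u) (fderiv ℝ φ z u)
      - G (φ z) (ν z) (curvatureEndo G (φ z) (fderiv ℝ φ z u) (fderiv ℝ φ z u) (ν z))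
      + LinearMap.trace ℝ W S * inducedMetric G φ z (S u) u
      - inducedMetric G φ z (S (S u)) u := by
  obtain ⟨ρ, hρφ, hρ⟩ := hν.exists_splitting hφ hdim hz
  have hρν : ρ (ν z) = 0 := by
    have h := hρ (ν z)
    rw [hν.unit z hz, one_smul, add_eq_right] at h
    exact hφ.injective z hz (by rw [h, map_zero])
  let Y := fderiv ℝ φ z u
  have hφz := hφ.contDiffAt hz
  have hgauss : ρ ∘ₗ (curvatureEndo G (φ z) Y Y : V →ₗ[ℝ] V) ∘ₗ (fderiv ℝ φ z : W →ₗ[ℝ] V) =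
      (curvatureEndo (inducedMetric G φ) z u u : W →ₗ[ℝ] W) - inducedMetric G φ z (S u) u • S
        + (((inducedMetric G φ z).flip u : W →ₗ[ℝ] ℝ) ∘ₗ S).smulRight (S u) := by
    refine LinearMap.ext fun w ↦ ?_
    obtain ⟨c, hc⟩ := gauss_equation_hypersurface (q := secondFundamentalForm G φ ν)
      (hφz.of_le (WithTop.coe_le_coe.2 le_top))
      (hG.differentiableAt_christoffel (hφ.mapsTo hz))
      ((hG.isMetricOn_inducedMetric hφ).differentiableAt_christoffel hz)
      (hG.differentiableAt_secondFundamentalForm hφz (hφ.mapsTo hz) (hν.contDiffAt hφ.isOpen hz))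
      ((hν.contDiffAt hφ.isOpen hz).differentiableAt (by simp))
      (by filter_upwards [hφ.isOpen.mem_nhds hz] with z hz
          using hν.isSecondFundamentalFormAt hG hφ hdim hz) w u u
    rw [← covDerivAlong, ← covDerivAlong, ← hS, ← hS] at hc
    have hρc := congrArg ρ hc
    simp only [map_add, map_sub, map_smul, hρφ, hρν, smul_zero, add_zero, secondFundamentalForm,
      ← hS, ← inducedMetric_apply] at hρc
    simpa [Y, sub_eq_add_neg, inducedMetric_apply] using hρc
  have htr := trace_eq_of_splitting (L := (fderiv ℝ φ z : W →ₗ[ℝ] V))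
    (α := (G (φ z) (ν z) : V →ₗ[ℝ] ℝ)) hρ (curvatureEndo G (φ z) Y Y : V →ₗ[ℝ] V)
  rw [hgauss, map_add, map_sub, map_smul, LinearMap.trace_smulRight, ← ricci, ← ricci,
    smul_eq_mul] at htr
  simp only [LinearMap.comp_apply, ContinuousLinearMap.coe_coe,
    ContinuousLinearMap.flip_apply, Y] at htr
  linarith

end IsUnitNormalOn

end Hypersurface

section SphereBundle

variable {X F : Type*} [NormedAddCommGroup X] [NormedSpace ℝ X]
  [NormedAddCommGroup F] [NormedSpace ℝ F]
  {g : X → X →L[ℝ] X →L[ℝ] ℝ} {k : X → F →L[ℝ] F →L[ℝ] ℝ}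
  {A : X → X →L[ℝ] F →L[ℝ] F} {Ω : Set X} {y : X × F}

theorem localConnector_vertical (A : X → X →L[ℝ] F →L[ℝ] F) (y : X × F) (b : F) :
    localConnector A y (0, b) = b := by
  simp

theorem localMetric_vertical_apply (y : X × F) (b : F) (u : X × F) :
    localMetric g k A y (0, b) u = k y.1 b (localConnector A y u) := by
  simp [localMetric_apply]

theorem hasFDerivAt_fiberNorm (hk : DifferentiableAt ℝ k y.1)
    (hsymm : ∀ b b', k y.1 b b' = k y.1 b' b) (hA : IsMetricConnectionAt k A y.1) :
    HasFDerivAt (fun z : X × F ↦ k z.1 z.2 z.2)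
      ((2 : ℝ) • (k y.1 y.2 ∘L localConnector A y)) y := by
  have hk' : DifferentiableAt ℝ (fun z : X × F ↦ k z.1) y := hk.comp y differentiableAt_fst
  have hd : DifferentiableAt ℝ (fun z : X × F ↦ k z.1 z.2 z.2) y := by fun_prop
  convert! hd.hasFDerivAt using 1
  refine ContinuousLinearMap.ext fun u ↦ ?_
  rw [fderiv_clm_apply₂ hk' differentiableAt_snd differentiableAt_snd, fderiv_comp_fst hk,
    fderiv_snd]
  have hkA := hA u.1 y.2 y.2
  simp only [ContinuousLinearMap.comp_apply, ContinuousLinearMap.coe_fst',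
    ContinuousLinearMap.coe_snd', smul_apply, localConnector_apply, map_add, hkA, smul_eq_mul]
  linarith [hsymm y.2 u.2, hsymm y.2 (A y.1 u.1 y.2)]

namespace IsConnectionData

variable {W : Type*} [NormedAddCommGroup W] [NormedSpace ℝ W] {φ : W → X × F} {U : Set W} {r : ℝ}
  {z : W}

theorem apply_localConnector_eq_zero (h : IsConnectionData g k A Ω)
    (hφ : IsImmersionOn φ U (Ω ×ˢ univ)) (hsphere : ∀ z ∈ U, k (φ z).1 (φ z).2 (φ z).2 = r ^ 2)
    (hz : z ∈ U) (u : W) :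
    k (φ z).1 (φ z).2 (localConnector A (φ z) (fderiv ℝ φ z u)) = 0 := by
  have hΩ := (hφ.mapsTo hz).1
  have hcomp := (hasFDerivAt_fiberNorm ((h.fiber.contDiffAt hΩ).differentiableAt (by simp))
    (h.fiber.symm _ hΩ) (h.compatible _ hΩ)).comp z
    ((hφ.contDiffAt hz).differentiableAt (by simp)).hasFDerivAt
  have hconst : (fun y : X × F ↦ k y.1 y.2 y.2) ∘ φ =ᶠ[𝓝 z] fun _ ↦ r ^ 2 := by
    filter_upwards [hφ.isOpen.mem_nhds hz] with z hz using hsphere z hz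
  simpa using DFunLike.congr_fun
    (hcomp.unique ((hasFDerivAt_const (r ^ 2) z).congr_of_eventuallyEq hconst)) u

theorem isUnitNormalOn (h : IsConnectionData g k A Ω)
    (hφ : IsImmersionOn φ U (Ω ×ˢ univ)) (hr : r ≠ 0)
    (hsphere : ∀ z ∈ U, k (φ z).1 (φ z).2 (φ z).2 = r ^ 2) :
    IsUnitNormalOn (localMetric g k A) φ (fun z ↦ (0, r⁻¹ • (φ z).2)) U where
  contDiffOn := contDiffOn_const.prodMk (contDiffOn_const.smul hφ.contDiffOn.snd)
  orthogonal := fun z hz u ↦ by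
    rw [localMetric_vertical_apply, map_smul, smul_apply,
      h.apply_localConnector_eq_zero hφ hsphere hz, smul_zero]
  unit := fun z hz ↦ by
    rw [localMetric_vertical_apply]
    simp only [localConnector_vertical, map_smul, smul_apply, hsphere z hz, smul_eq_mul]
    field_simp

variable [FiniteDimensional ℝ X] [FiniteDimensional ℝ F]

theorem covDerivAlong_position (h : IsConnectionData g k A Ω) (hφ : DifferentiableAt ℝ φ z)
    (hz : (φ z).1 ∈ Ω) (c : ℝ) (u : W) :
    covDerivAlong (localMetric g k A) φ (fun z ↦ (0, c • (φ z).2)) z u =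
      c • (0, localConnector A (φ z) (fderiv ℝ φ z u)) := by
  have hderiv : HasFDerivAt (fun z ↦ ((0 : X), c • (φ z).2))
      ((c • .inr ℝ X F ∘L .snd ℝ X F) ∘L fderiv ℝ φ z) z := by
    simpa [Function.comp_def] using
      (c • ContinuousLinearMap.inr ℝ X F ∘L .snd ℝ X F).hasFDerivAt.comp z hφ.hasFDerivAt
  have hsmul : ((0 : X), c • (φ z).2) = c • (0, (φ z).2) := by simp
  rw [covDerivAlong, hderiv.fderiv, hsmul, map_smul, h.christoffel_position hz]
  simp

theorem apply_curvatureEndo_position (h : IsConnectionData g k A Ω) (hy : y.1 ∈ Ω) (c : ℝ)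
    (u : X × F) : localMetric g k A y (0, c • y.2)
      (curvatureEndo (localMetric g k A) y u u (0, c • y.2)) = 0 := by
  have hyO : y ∈ Ω ×ˢ (univ : Set F) := ⟨hy, mem_univ _⟩
  have hanti : curvatureEndo (localMetric g k A) y u (0, y.2) (0, y.2) =
      -curvatureEndo (localMetric g k A) y (0, y.2) (0, y.2) u := by
    simp only [curvatureEndo_apply]
    abel
  have hsmul : ((0 : X), c • y.2) = c • (0, y.2) := by simp
  rw [hsmul, map_smul, map_smul, smul_apply, map_smul, h.isMetricOn.symm _ hyO,
    h.isMetricOn.apply_curvatureEndo_skew hyO, hanti, h.curvatureEndo_position hy]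
  simp

variable [FiniteDimensional ℝ W]

theorem exists_shapeOperator (h : IsConnectionData g k A Ω)
    (hφ : IsImmersionOn φ U (Ω ×ˢ univ)) (hr : r ≠ 0)
    (hsphere : ∀ z ∈ U, k (φ z).1 (φ z).2 (φ z).2 = r ^ 2)
    (hdim : Module.finrank ℝ W + 1 = Module.finrank ℝ (X × F)) (hz : z ∈ U) :
    ∃ S : W →ₗ[ℝ] W,
      (∀ w, fderiv ℝ φ z (S w) = r⁻¹ • (0, localConnector A (φ z) (fderiv ℝ φ z w))) ∧
      LinearMap.trace ℝ W S = r⁻¹ * (Module.finrank ℝ F - 1) := by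
  have hν := h.isUnitNormalOn hφ hr hsphere
  obtain ⟨ρ, -, hρ⟩ := hν.exists_splitting hφ hdim hz
  let α : X × F →ₗ[ℝ] ℝ := localMetric g k A (φ z) (0, r⁻¹ • (φ z).2)
  -- the orthogonal projection of `T_{φ z} (X × F)` onto the vertical space
  let P : X × F →ₗ[ℝ] X × F :=
    LinearMap.inr ℝ X F ∘ₗ (localConnector A (φ z) : X × F →ₗ[ℝ] F)
  have hαP : ∀ w, α (P (fderiv ℝ φ z w)) = 0 := fun w ↦ by
    change localMetric g k A (φ z) (0, r⁻¹ • (φ z).2)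
      (0, localConnector A (φ z) (fderiv ℝ φ z w)) = 0
    rw [localMetric_vertical_apply]
    simpa using Or.inr (h.apply_localConnector_eq_zero hφ hsphere hz w)
  have htraceP : LinearMap.trace ℝ (X × F) P = Module.finrank ℝ F := by
    rw [LinearMap.trace_comp_comm', ← LinearMap.trace_id ℝ F]
    congr 1
    ext b
    simp
  have hPν : α (P (0, r⁻¹ • (φ z).2)) = 1 := by
    have : P (0, r⁻¹ • (φ z).2) = (0, r⁻¹ • (φ z).2) := by simp [P]
    rw [this]
    exact hν.unit z hz
  refine ⟨r⁻¹ • ρ ∘ₗ P ∘ₗ (fderiv ℝ φ z : W →ₗ[ℝ] X × F), fun w ↦ ?_, ?_⟩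
  · have hPw := hρ (P (fderiv ℝ φ z w))
    rw [show localMetric g k A (φ z) (0, r⁻¹ • (φ z).2) (P (fderiv ℝ φ z w)) = 0 from hαP w,
      zero_smul, add_zero] at hPw
    simpa [P] using congrArg (r⁻¹ • ·) hPw
  · have htr := trace_eq_of_splitting (L := (fderiv ℝ φ z : W →ₗ[ℝ] X × F)) (α := α) hρ P
    rw [hPν, htraceP] at htr
    rw [map_smul, smul_eq_mul, ← eq_sub_iff_add_eq.2 htr.symm]

theorem ricci_inducedMetric (h : IsConnectionData g k A Ω)
    (hφ : IsImmersionOn φ U (Ω ×ˢ univ)) (hr : r ≠ 0)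
    (hsphere : ∀ z ∈ U, k (φ z).1 (φ z).2 (φ z).2 = r ^ 2)
    (hdim : Module.finrank ℝ W + 1 = Module.finrank ℝ (X × F)) (hz : z ∈ U) (u : W) :
    ricci (inducedMetric (localMetric g k A) φ) z u u =
      ricci (localMetric g k A) (φ z) (fderiv ℝ φ z u) (fderiv ℝ φ z u)
      + ((Module.finrank ℝ F : ℝ) - 2) / r ^ 2 *
        k (φ z).1 (localConnector A (φ z) (fderiv ℝ φ z u))
          (localConnector A (φ z) (fderiv ℝ φ z u)) := by
  have hφz : DifferentiableAt ℝ φ z := (hφ.contDiffAt hz).differentiableAt (by simp)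
  obtain ⟨S, hS, htr⟩ := h.exists_shapeOperator hφ hr hsphere hdim hz
  rw [(h.isUnitNormalOn hφ hr hsphere).ricci_eq h.isMetricOn hφ hdim hz
    (fun w ↦ (hS w).trans (h.covDerivAlong_position hφz (hφ.mapsTo hz).1 r⁻¹ w).symm), htr,
    h.apply_curvatureEndo_position (hφ.mapsTo hz).1]
  simp only [inducedMetric_apply, hS, localMetric_apply, map_smul, smul_apply, smul_eq_mul,
    localConnector_vertical, map_zero, zero_apply, zero_add]
  field_simp
  ring

end IsConnectionData

end SphereBundle

theorem eventually_forall_ne_zero_pos {Y E : Type*} [NormedAddCommGroup E] [NormedSpace ℝ E]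
    [FiniteDimensional ℝ E] {l : Filter Y} {Q : Y → E → ℝ}
    (hom : ∀ y (c : ℝ) u, Q y (c • u) = c ^ 2 * Q y u)
    (hpos : ∀ u, u ≠ 0 → ∀ᶠ q in l ×ˢ 𝓝 u, 0 < Q q.1 q.2) :
    ∀ᶠ y in l, ∀ u, u ≠ 0 → 0 < Q y u := by
  have hsphere : ∀ᶠ q in l ×ˢ 𝓝ˢ (Metric.sphere (0 : E) 1), 0 < Q q.1 q.2 :=
    (isCompact_sphere (0 : E) 1).mem_prod_nhdsSet_of_forall fun u hu ↦
      hpos u (ne_zero_of_mem_unit_sphere ⟨u, hu⟩)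
  filter_upwards [hsphere.curry] with y hy u hu
  have hunit := hy.self_of_nhdsSet (‖u‖⁻¹ • u) (by simp [norm_smul, hu])
  rw [hom] at hunit
  exact pos_of_mul_pos_right hunit (by positivity)

namespace IsConnectionData

variable {X F : Type*} [NormedAddCommGroup X] [NormedSpace ℝ X]
  [NormedAddCommGroup F] [NormedSpace ℝ F]
  {g : X → X →L[ℝ] X →L[ℝ] ℝ} {k : X → F →L[ℝ] F →L[ℝ] ℝ}
  {A : X → X →L[ℝ] F →L[ℝ] F} {Ω : Set X} {x : X}

theorem continuousAt_verticalNormSq [FiniteDimensional ℝ X] [FiniteDimensional ℝ F]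
    (h : IsConnectionData g k A Ω) (hx : x ∈ Ω) (v : F) (u : X × F) :
    ContinuousAt (fun p : (X × F) × (X × F) ↦
      k p.1.1 (localConnector A p.1 p.2) (localConnector A p.1 p.2)) ((x, v), u) := by
  have hK : ContinuousAt (fun p : (X × F) × (X × F) ↦ localConnector A p.1) ((x, v), u) :=
    ContinuousAt.comp (g := localConnector A) (f := Prod.fst)
      (h.contDiffAt_localConnector (y := (x, v)) hx).continuousAt continuousAt_fst
  have hk : ContinuousAt (fun p : (X × F) × (X × F) ↦ k p.1.1) ((x, v), u) :=
    ContinuousAt.comp (g := k) (f := fun p : (X × F) × (X × F) ↦ p.1.1)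
      (h.fiber.contDiffAt hx).continuousAt (by fun_prop)
  have hKu := hK.clm_apply (continuousAt_snd (p := ((x, v), u)))
  exact (hk.clm_apply hKu).clm_apply hKu

variable [FiniteDimensional ℝ X] [FiniteDimensional ℝ F]

theorem eventually_ricci_add_pos_nhds (h : IsConnectionData g k A Ω) (hx : x ∈ Ω)
    (hpos : ∀ a, a ≠ 0 → 0 < ricci g x a a) {u : X × F} (hu : u ≠ 0) :
    ∀ᶠ q : ((X × F) × ℝ) × (X × F) in (𝓝 (x, 0) ×ˢ atTop) ×ˢ 𝓝 u,
      0 < ricci (localMetric g k A) q.1.1 q.2 q.2 + q.1.2 *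
        k q.1.1.1 (localConnector A q.1.1 q.2) (localConnector A q.1.1 q.2) := by
  have hpoint : Tendsto (fun q : ((X × F) × ℝ) × (X × F) ↦ (q.1.1, q.2))
      ((𝓝 (x, 0) ×ˢ atTop) ×ˢ 𝓝 u) (𝓝 ((x, 0), u)) := by
    rw [nhds_prod_eq (y := u)]
    exact (tendsto_fst.comp tendsto_fst).prodMk tendsto_snd
  have hcoeff : Tendsto (fun q : ((X × F) × ℝ) × (X × F) ↦ q.1.2)
      ((𝓝 (x, 0) ×ˢ atTop) ×ˢ 𝓝 u) atTop := tendsto_snd.comp tendsto_fst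
  have hbase : ∀ᶠ q : ((X × F) × ℝ) × (X × F) in (𝓝 (x, 0) ×ˢ atTop) ×ˢ 𝓝 u, q.1.1.1 ∈ Ω :=
    ((continuousAt_fst (p := (x, (0 : F)))).tendsto.comp
      (tendsto_fst.comp tendsto_fst)).eventually (h.isOpen.mem_nhds hx)
  have hcont : ContinuousAt (fun p : (X × F) × (X × F) ↦ ricci (localMetric g k A) p.1 p.2 p.2)
      ((x, 0), u) :=
    h.isMetricOn.continuousAt_ricci ⟨hx, mem_univ _⟩ continuousAt_fst continuousAt_snd
      continuousAt_snd
  have hric := hcont.tendsto.comp hpoint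
  by_cases hvert : localConnector A (x, 0) u = 0
  · have hu2 : u.2 = 0 := by simpa using hvert
    have hu1 : u.1 ≠ 0 := fun hu1 ↦ hu (Prod.ext hu1 hu2)
    have hlim : 0 < ricci (localMetric g k A) (x, 0) u u := by
      rw [show u = (u.1, 0) from Prod.ext rfl hu2, h.ricci_zero_horizontal hx]
      exact hpos _ hu1
    filter_upwards [hric.eventually_const_lt hlim, hcoeff.eventually_ge_atTop 0, hbase]
      with q hq hc hΩ
    exact add_pos_of_pos_of_nonneg hq (mul_nonneg hc (h.fiber.nonneg hΩ _))
  · exact (hric.add_atTop (hcoeff.atTop_mul_pos (h.fiber.pos x hx _ hvert)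
      ((h.continuousAt_verticalNormSq hx 0 u).tendsto.comp hpoint))).eventually_gt_atTop 0

theorem eventually_ricci_add_pos (h : IsConnectionData g k A Ω) (hx : x ∈ Ω)
    (hpos : ∀ a, a ≠ 0 → 0 < ricci g x a a) :
    ∀ᶠ p : (X × F) × ℝ in 𝓝 (x, 0) ×ˢ atTop, ∀ u : X × F, u ≠ 0 →
      0 < ricci (localMetric g k A) p.1 u u
        + p.2 * k p.1.1 (localConnector A p.1 u) (localConnector A p.1 u) := by
  refine eventually_forall_ne_zero_pos (fun p c u ↦ ?_)
    fun u hu ↦ h.eventually_ricci_add_pos_nhds hx hpos hu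
  simp only [ricci_smul, map_smul, smul_apply, smul_eq_mul]
  ring

end IsConnectionData

section Param

variable {E : Type*} [NormedAddCommGroup E] [NormedSpace ℝ E]
  {H : Type*} [TopologicalSpace H] {I : ModelWithCorners ℝ E H}
  {N : Type*} [TopologicalSpace N] [ChartedSpace H N]
  {W : Type*} [NormedAddCommGroup W] [NormedSpace ℝ W]
  {W' : Type*} [NormedAddCommGroup W'] [NormedSpace ℝ W']

theorem paramDeriv_comp {φ : W' → N} {f : W → W'} {y : W}
    (hφ : MDifferentiableAt 𝓘(ℝ, W') I φ (f y)) (hf : DifferentiableAt ℝ f y) :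
    paramDeriv I (φ ∘ f) y = paramDeriv I φ (f y) ∘L fderiv ℝ f y := by
  unfold paramDeriv
  rw [mfderiv_comp y hφ hf.mdifferentiableAt, mfderiv_eq_fderiv]
  rfl

theorem mvfderiv_paramDeriv {h : N → W'} {φ : W → N} {y : W}
    (hh : MDifferentiableAt I 𝓘(ℝ, W') h (φ y)) (hφ : MDifferentiableAt 𝓘(ℝ, W) I φ y) (u : W) :
    mvfderiv I h (φ y) (paramDeriv I φ y u) = fderiv ℝ (h ∘ φ) y u := by
  rw [← mfderiv_eq_fderiv, mfderiv_comp y hh hφ]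
  rfl

theorem mfderiv_paramDeriv {E' : Type*} [NormedAddCommGroup E'] [NormedSpace ℝ E']
    {H' : Type*} [TopologicalSpace H'] {I' : ModelWithCorners ℝ E' H'}
    {N' : Type*} [TopologicalSpace N'] [ChartedSpace H' N']
    {h : N → N'} {φ : W → N} {y : W}
    (hh : MDifferentiableAt I I' h (φ y)) (hφ : MDifferentiableAt 𝓘(ℝ, W) I φ y) (u : W) :
    mfderiv I I' h (φ y) (paramDeriv I φ y u) = paramDeriv I' (h ∘ φ) y u := by
  unfold paramDeriv
  rw [mfderiv_comp y hh hφ]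
  rfl

theorem paramDeriv_congr {φ φ' : W → N} {y : W} (h : φ =ᶠ[𝓝 y] φ') (u : W) :
    (paramDeriv I φ y u : E) = paramDeriv I φ' y u := by
  unfold paramDeriv
  rw [h.mfderiv_eq]
  rfl

theorem pullbackMetric_comp (G : BilinearField I N) {φ : W' → N} {f : W → W'} {y : W}
    (hφ : MDifferentiableAt 𝓘(ℝ, W') I φ (f y)) (hf : DifferentiableAt ℝ f y) :
    pullbackMetric G (φ ∘ f) y = inducedMetric (pullbackMetric G φ) f y := by
  ext u v
  rw [pullbackMetric_apply, inducedMetric_apply, pullbackMetric_apply, paramDeriv_comp hφ hf]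
  rfl

theorem pullbackMetric_congr (G : BilinearField I N) {φ φ' : W → N} {y : W}
    (h : φ =ᶠ[𝓝 y] φ') : pullbackMetric G φ y = pullbackMetric G φ' y := by
  -- `TangentSpace I p` is `E` for every `p`, so both sides can be compared at different points
  have hG : ∀ {p p' : N} {a b a' b' : E}, p = p' → a = a' → b = b' →
      (G p : E →L[ℝ] E →L[ℝ] ℝ) a b = (G p' : E →L[ℝ] E →L[ℝ] ℝ) a' b' := by
    rintro _ _ _ _ _ _ rfl rfl rfl
    rfl
  ext u v
  exact hG h.self_of_nhds (paramDeriv_congr h u) (paramDeriv_congr h v)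

variable [I.Boundaryless] [IsManifold I 1 N]

theorem mdifferentiableAt_extChartAt_symm {x : N} {z : E} (hz : z ∈ (extChartAt I x).target) :
    MDifferentiableAt 𝓘(ℝ, E) I (extChartAt I x).symm z := by
  have := mdifferentiableWithinAt_extChartAt_symm hz
  rwa [I.range_eq_univ, mdifferentiableWithinAt_univ] at this

theorem isInvertible_paramDeriv_extChartAt_symm {x : N} {z : E}
    (hz : z ∈ (extChartAt I x).target) :
    (paramDeriv I (extChartAt I x).symm z).IsInvertible := by
  have := isInvertible_mfderivWithin_extChartAt_symm hz
  rwa [I.range_eq_univ, mfderivWithin_univ] at this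

theorem pullbackMetric_eventuallyEq_inducedMetric (G : BilinearField I N) {x : N} {φ : W → N}
    {U : Set W} (hU : IsOpen U) (hφ : ContMDiffOn 𝓘(ℝ, W) I 1 φ U)
    {y : W} (hy : y ∈ U) (hyx : φ y ∈ (extChartAt I x).source) :
    pullbackMetric G φ =ᶠ[𝓝 y]
      inducedMetric (pullbackMetric G (extChartAt I x).symm) (extChartAt I x ∘ φ) := by
  have hc : ContinuousAt φ y := (hφ.contMDiffAt (hU.mem_nhds hy)).continuousAt
  have hnear : ∀ᶠ z in 𝓝 y, z ∈ U ∧ φ z ∈ (extChartAt I x).source :=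
    (hU.eventually_mem hy).and (hc.eventually ((isOpen_extChartAt_source x).mem_nhds hyx))
  filter_upwards [hnear.eventually_nhds] with z hz
  obtain ⟨hzU, hzx⟩ := hz.self_of_nhds
  have hd : DifferentiableAt ℝ (extChartAt I x ∘ φ) z := by
    rw [← mdifferentiableAt_iff_differentiableAt]
    exact (mdifferentiableAt_extChartAt (by simpa using hzx)).comp z
      ((hφ.contMDiffAt (hU.mem_nhds hzU)).mdifferentiableAt one_ne_zero)
  rw [← pullbackMetric_comp (f := extChartAt I x ∘ φ) G (mdifferentiableAt_extChartAt_symm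
    ((extChartAt I x).map_source hzx)) hd]
  refine pullbackMetric_congr G ?_
  filter_upwards [hz] with w hw using ((extChartAt I x).left_inv hw.2).symm

end Param

/-! ### The connector in a local trivialization -/

section VectorValued

variable {E : Type*} [NormedAddCommGroup E] [NormedSpace ℝ E]
  {H : Type*} [TopologicalSpace H] {I : ModelWithCorners ℝ E H}
  {N : Type*} [TopologicalSpace N] [ChartedSpace H N]
  {W : Type*} [NormedAddCommGroup W] [NormedSpace ℝ W]
  {W' : Type*} [NormedAddCommGroup W'] [NormedSpace ℝ W']

theorem mvfderiv_congr_of_eventuallyEq {f f' : N → W} {z : N} (h : f =ᶠ[𝓝 z] f') :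
    mvfderiv I f z = mvfderiv I f' z := by
  simp only [mvfderiv]
  rw [h.mfderiv_eq]
  rfl

theorem mvfderiv_comp_mfderiv {E' : Type*} [NormedAddCommGroup E'] [NormedSpace ℝ E']
    {H' : Type*} [TopologicalSpace H'] {I' : ModelWithCorners ℝ E' H'}
    {N' : Type*} [TopologicalSpace N'] [ChartedSpace H' N'] {h : N' → W} {f : N → N'} {z : N}
    (hh : MDifferentiableAt I' 𝓘(ℝ, W) h (f z)) (hf : MDifferentiableAt I I' f z)
    (u : TangentSpace I z) :
    mvfderiv I (h ∘ f) z u = mvfderiv I' h (f z) (mfderiv I I' f z u) := by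
  unfold mvfderiv
  rw [mfderiv_comp z hh hf]
  rfl

theorem mvfderiv_clm_apply {c : N → W →L[ℝ] W'} {v : N → W} {z : N}
    (hc : MDifferentiableAt I 𝓘(ℝ, W →L[ℝ] W') c z) (hv : MDifferentiableAt I 𝓘(ℝ, W) v z)
    (u : TangentSpace I z) :
    mvfderiv I (fun y ↦ c y (v y)) z u = c z (mvfderiv I v z u) + mvfderiv I c z u (v z) := by
  let χ := extChartAt I z
  let c' : E →L[ℝ] W →L[ℝ] W' := mvfderiv I c z
  let v' : E →L[ℝ] W := mvfderiv I v z
  have hc' : HasFDerivWithinAt (c ∘ χ.symm) c' (range I) (χ z) := hc.hasMFDerivAt.2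
  have hv' : HasFDerivWithinAt (v ∘ χ.symm) v' (range I) (χ z) := hv.hasMFDerivAt.2
  have hcv := hc'.clm_apply hv'
  simp only [Function.comp_apply, χ, extChartAt_to_inv] at hcv
  have h : HasMFDerivAt I 𝓘(ℝ, W') (fun y ↦ c y (v y)) z (c z ∘L v' + c'.flip (v z)) :=
    ⟨hc.continuousAt.clm_apply hv.continuousAt, hcv⟩
  rw [mvfderiv, h.mfderiv]
  rfl

end VectorValued

section LocalForm

variable {EM : Type*} [NormedAddCommGroup EM] [NormedSpace ℝ EM]
  {H : Type*} [TopologicalSpace H] {I : ModelWithCorners ℝ EM H}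
  {M : Type*} [TopologicalSpace M] [ChartedSpace H M]
  {F : Type*} [NormedAddCommGroup F] [NormedSpace ℝ F]
  {V : M → Type*} [TopologicalSpace (TotalSpace F V)]
  [∀ p, AddCommGroup (V p)] [∀ p, Module ℝ (V p)] [∀ p, TopologicalSpace (V p)]
  [FiberBundle F V] [VectorBundle ℝ F V]
  (e : Trivialization F (TotalSpace.proj : TotalSpace F V → M)) [MemTrivializationAtlas e]

theorem contMDiffOn_symm_const {n : ℕ∞ω} [ContMDiffVectorBundle n F V I] (v : F) :
    ContMDiffOn I (I.prod 𝓘(ℝ, F)) n (fun q ↦ TotalSpace.mk' F q (e.symm q v)) e.baseSet := by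
  rw [e.contMDiffOn_section_baseSet_iff]
  refine (contMDiffOn_const (c := v)).congr fun q hq ↦ ?_
  rw [e.apply_mk_symm hq]

variable (I) in
/-- The flat connection of a local trivialization `e`: it differentiates the coordinates of a
section. -/
def flatCovDeriv (σ : ∀ q, V q) (q : M) : TangentSpace I q →L[ℝ] V q :=
  e.symmL ℝ q ∘L mvfderiv I (fun q' ↦ (e ⟨q', σ q'⟩).2) q

variable [ContMDiffVectorBundle 1 F V I]

theorem mdifferentiableAt_trivialization_snd {z : TotalSpace F V} (hz : z.proj ∈ e.baseSet) :
    MDifferentiableAt (I.prod 𝓘(ℝ, F)) 𝓘(ℝ, F) (fun z' ↦ (e z').2) z := by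
  have he : MDifferentiableAt (I.prod 𝓘(ℝ, F)) (I.prod 𝓘(ℝ, F)) e z :=
    ((e.contMDiffOn (IB := I) (n := 1)).contMDiffAt
      (e.open_source.mem_nhds (e.mem_source.2 hz))).mdifferentiableAt one_ne_zero
  exact he.snd

variable [∀ p, IsTopologicalAddGroup (V p)] [∀ p, ContinuousSMul ℝ (V p)]

theorem isCovariantDerivativeOn_flatCovDeriv :
    IsCovariantDerivativeOn F (flatCovDeriv I e) e.baseSet where
  add {σ σ' q} hσ hσ' hq := by
    rw [e.mdifferentiableAt_section_iff _ _ hq] at hσ hσ'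
    have hadd : (fun q' ↦ (e ⟨q', (σ + σ') q'⟩).2) =ᶠ[𝓝 q]
        fun q' ↦ (e ⟨q', σ q'⟩).2 + (e ⟨q', σ' q'⟩).2 := by
      filter_upwards [e.open_baseSet.mem_nhds hq] with q' hq'
      exact (e.linear ℝ hq').map_add (σ q') (σ' q')
    simp only [flatCovDeriv]
    rw [mvfderiv_congr_of_eventuallyEq hadd, mvfderiv_fun_add hσ hσ',
      ContinuousLinearMap.comp_add]
  leibniz {σ f q} hσ hf hq := by
    rw [e.mdifferentiableAt_section_iff _ _ hq] at hσ
    have hsmul : (fun q' ↦ (e ⟨q', (f • σ) q'⟩).2) =ᶠ[𝓝 q]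
        f • fun q' ↦ (e ⟨q', σ q'⟩).2 := by
      filter_upwards [e.open_baseSet.mem_nhds hq] with q' hq'
      exact (e.linear ℝ hq').map_smul (f q') (σ q')
    have hinv : e.symmL ℝ q (e ⟨q, σ q⟩).2 = σ q := by
      rw [e.symmL_apply hq, e.symm_apply_apply_mk hq]
    simp only [flatCovDeriv]
    rw [mvfderiv_congr_of_eventuallyEq hsmul, mvfderiv_smul hf hσ]
    ext u
    simp [hinv]

variable [FiniteDimensional ℝ F] (D : CovariantDerivative I F V)

/-- The connection form `ω` of `D` in the local trivialization `e`, as the difference of `D` and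
the flat connection of `e`. -/
def connectionForm (q : M) : V q →L[ℝ] TangentSpace I q →L[ℝ] V q :=
  (D.isCovariantDerivativeOn (s := e.baseSet)).difference
    (isCovariantDerivativeOn_flatCovDeriv e) q

theorem covariantDerivative_eq_add_connectionForm {q : M} (hq : q ∈ e.baseSet) {σ : ∀ q, V q}
    (hσ : MDifferentiableAt I (I.prod 𝓘(ℝ, F)) (fun q ↦ TotalSpace.mk' F q (σ q)) q) :
    D σ q = e.symmL ℝ q ∘L mvfderiv I (fun q' ↦ (e ⟨q', σ q'⟩).2) q
      + connectionForm e D q (σ q) := by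
  rw [connectionForm, IsCovariantDerivativeOn.difference_apply _ _ hq hσ]
  simp [flatCovDeriv]

theorem covariantDerivative_symm_const {q : M} (hq : q ∈ e.baseSet) (v : F) :
    D (fun q ↦ e.symm q v) q = connectionForm e D q (e.symm q v) := by
  have hσ := ((contMDiffOn_symm_const (I := I) (n := 1) e v).contMDiffAt
    (e.open_baseSet.mem_nhds hq)).mdifferentiableAt one_ne_zero
  have hconst : (fun q' ↦ (e ⟨q', e.symm q' v⟩).2) =ᶠ[𝓝 q] fun _ ↦ v := by
    filter_upwards [e.open_baseSet.mem_nhds hq] with q' hq'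
    rw [e.apply_mk_symm hq']
  rw [covariantDerivative_eq_add_connectionForm e D hq hσ,
    mvfderiv_congr_of_eventuallyEq hconst, mvfderiv_const]
  simp

end LocalForm

section Connector

variable {EM : Type*} [NormedAddCommGroup EM] [NormedSpace ℝ EM]
  {H : Type*} [TopologicalSpace H] {I : ModelWithCorners ℝ EM H}
  {M : Type*} [TopologicalSpace M] [ChartedSpace H M]
  {F : Type*} [NormedAddCommGroup F] [NormedSpace ℝ F]
  {ξ : M → Type*} [TopologicalSpace (TotalSpace F ξ)]
  [∀ p, NormedAddCommGroup (ξ p)] [∀ p, InnerProductSpace ℝ (ξ p)]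
  [FiberBundle F ξ] [VectorBundle ℝ F ξ]
  [FiniteDimensional ℝ F] [ContMDiffVectorBundle 1 F ξ I]

-- `connector` is defined with the preferred trivialization `t`; the derivative of the coordinate
-- change from `t` to `e` is absorbed by the covariant derivative of the extended section.
theorem connector_apply (e : Trivialization F (TotalSpace.proj : TotalSpace F ξ → M))
    [MemTrivializationAtlas e] (D : CovariantDerivative I F ξ)
    (z : TotalSpace F ξ) (hz : z.proj ∈ e.baseSet) (u : TangentSpace (I.prod 𝓘(ℝ, F)) z) :
    connector D z u =
      e.symmL ℝ z.proj (mvfderiv (I.prod 𝓘(ℝ, F)) (fun z' ↦ (e z').2) z u)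
        + connectionForm e D z.proj z.snd (projDeriv z u) := by
  let t := trivializationAt F ξ z.proj
  let C : M → F →L[ℝ] F := fun q ↦ t.coordChangeL ℝ e q
  have hzt : z.proj ∈ t.baseSet := mem_baseSet_trivializationAt F ξ z.proj
  have hC_apply : ∀ {q}, q ∈ t.baseSet → q ∈ e.baseSet → ∀ v, C q v = (e ⟨q, t.symm q v⟩).2 :=
    fun ht he v ↦ t.coordChangeL_apply e ⟨ht, he⟩ v
  have hnear : ∀ᶠ q in 𝓝 z.proj, q ∈ t.baseSet ∧ q ∈ e.baseSet :=
    (t.open_baseSet.eventually_mem hzt).and (e.open_baseSet.eventually_mem hz)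
  have hC : MDifferentiableAt I 𝓘(ℝ, F →L[ℝ] F) C z.proj := mdifferentiableAt_coordChangeL hzt hz
  have hproj : MDifferentiableAt (I.prod 𝓘(ℝ, F)) I (TotalSpace.proj : TotalSpace F ξ → M) z :=
    (contMDiffAt_proj ξ).mdifferentiableAt one_ne_zero
  have hcoord : mvfderiv (I.prod 𝓘(ℝ, F)) (fun z' ↦ (e z').2) z u =
      C z.proj (mvfderiv (I.prod 𝓘(ℝ, F)) (fun z' ↦ (t z').2) z u)
        + mvfderiv I C z.proj (projDeriv z u) (t z).2 := by
    have hchange : (fun z' ↦ (e z').2) =ᶠ[𝓝 z] fun z' ↦ (C ∘ TotalSpace.proj) z' (t z').2 := by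
      filter_upwards [hproj.continuousAt.eventually hnear] with z' ⟨ht, he⟩
      rw [Function.comp_apply, hC_apply ht he, t.symm_apply_apply_mk ht]
    rw [mvfderiv_congr_of_eventuallyEq hchange, mvfderiv_clm_apply (hC.comp z hproj)
      (mdifferentiableAt_trivialization_snd t hzt), mvfderiv_comp_mfderiv hC hproj]
    rfl
  have hextend : mvfderiv I (fun q ↦ (e ⟨q, FiberBundle.extend F z.snd q⟩).2) z.proj
      (projDeriv z u) = mvfderiv I C z.proj (projDeriv z u) (t z).2 := by
    have hchange : (fun q ↦ (e ⟨q, FiberBundle.extend F z.snd q⟩).2) =ᶠ[𝓝 z.proj]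
        fun q ↦ C q (t z).2 := by
      filter_upwards [hnear] with q ⟨ht, he⟩
      rw [hC_apply ht he]
      rfl
    rw [mvfderiv_congr_of_eventuallyEq hchange, mvfderiv_clm_apply hC mdifferentiableAt_const,
      mvfderiv_const]
    simp
  have hsymm : ∀ v, e.symmL ℝ z.proj (C z.proj v) = t.symmL ℝ z.proj v := fun v ↦ by
    rw [hC_apply hzt hz, e.symmL_apply hz, e.symm_apply_apply_mk hz, t.symmL_apply hzt]
  rw [hcoord, map_add, hsymm, connector, add_apply, ContinuousLinearMap.comp_apply,
    ContinuousLinearMap.comp_apply, covariantDerivative_eq_add_connectionForm e D hz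
      (FiberBundle.mdifferentiableAt_extend I F z.snd),
    add_apply, ContinuousLinearMap.comp_apply, hextend, FiberBundle.extend_apply_self, ← add_assoc]

end Connector

section TotalSpaceChart

variable {EM : Type*} [NormedAddCommGroup EM] [NormedSpace ℝ EM]
  {H : Type*} [TopologicalSpace H] {I : ModelWithCorners ℝ EM H}
  {M : Type*} [TopologicalSpace M] [ChartedSpace H M]
  {F : Type*} [NormedAddCommGroup F]
  {V : M → Type*} [TopologicalSpace (TotalSpace F V)] [∀ p, TopologicalSpace (V p)]
  [FiberBundle F V]

variable (I F V) in
/-- The domain of the coordinates on the base given by the chart at `p`, restricted to the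
trivialization at `p`. -/
def coordDomain (p : M) : Set EM :=
  (extChartAt I p).target ∩ (extChartAt I p).symm ⁻¹' (trivializationAt F V p).baseSet

theorem extChartAt_mem_coordDomain {p q : M} (hq : q ∈ (extChartAt I p).source)
    (hq' : q ∈ (trivializationAt F V p).baseSet) : extChartAt I p q ∈ coordDomain I F V p :=
  ⟨(extChartAt I p).map_source hq, by rwa [mem_preimage, (extChartAt I p).left_inv hq]⟩

theorem isOpen_coordDomain [I.Boundaryless] (p : M) : IsOpen (coordDomain I F V p) :=
  (continuousOn_extChartAt_symm p).isOpen_inter_preimage (isOpen_extChartAt_target p)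
    (trivializationAt F V p).open_baseSet

variable [NormedSpace ℝ F]

theorem extChartAt_totalSpace_target (x₀ : TotalSpace F V) :
    (extChartAt (I.prod 𝓘(ℝ, F)) x₀).target = coordDomain I F V x₀.proj ×ˢ univ :=
  FiberBundle.extChartAt_target x₀

theorem mem_extChartAt_totalSpace_target {x₀ : TotalSpace F V} {y : EM × F}
    (hy : y.1 ∈ coordDomain I F V x₀.proj) : y ∈ (extChartAt (I.prod 𝓘(ℝ, F)) x₀).target := by
  rw [extChartAt_totalSpace_target]
  exact ⟨hy, mem_univ _⟩

theorem extChartAt_totalSpace (x₀ x : TotalSpace F V)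
    (hx : x.proj ∈ (trivializationAt F V x₀.proj).baseSet) :
    extChartAt (I.prod 𝓘(ℝ, F)) x₀ x =
      (extChartAt I x₀.proj x.proj, (trivializationAt F V x₀.proj x).2) := by
  rw [FiberBundle.extChartAt]
  simp [Trivialization.coe_fst _ ((Trivialization.mem_source _).2 hx)]

theorem extChartAt_totalSpace_symm [∀ p, Zero (V p)] (x₀ : TotalSpace F V) {y : EM × F}
    (hy : y.1 ∈ coordDomain I F V x₀.proj) :
    (extChartAt (I.prod 𝓘(ℝ, F)) x₀).symm y =
      ⟨(extChartAt I x₀.proj).symm y.1,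
        (trivializationAt F V x₀.proj).symm ((extChartAt I x₀.proj).symm y.1) y.2⟩ := by
  rw [Trivialization.mk_symm _ hy.2, FiberBundle.extChartAt]
  rfl

end TotalSpaceChart

section Coordinates

variable {EM : Type*} [NormedAddCommGroup EM] [NormedSpace ℝ EM]
  {H : Type*} [TopologicalSpace H] {I : ModelWithCorners ℝ EM H}
  {M : Type*} [TopologicalSpace M] [ChartedSpace H M]
  {F : Type*} [NormedAddCommGroup F] [NormedSpace ℝ F]
  {ξ : M → Type*} [TopologicalSpace (TotalSpace F ξ)]
  [∀ p, NormedAddCommGroup (ξ p)] [∀ p, InnerProductSpace ℝ (ξ p)]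
  [FiberBundle F ξ] [VectorBundle ℝ F ξ]

variable (I F ξ) in
/-- The fibre metric in the coordinates around `p`. -/
def fiberMetricCoord (p : M) (x : EM) : F →L[ℝ] F →L[ℝ] ℝ :=
  letI q := (extChartAt I p).symm x
  letI s := (trivializationAt F ξ p).symmL ℝ q
  s.precomp ℝ ∘L (innerSL ℝ ∘L s)

theorem fiberMetricCoord_apply (p : M) (x : EM) (b b' : F) :
    fiberMetricCoord I F ξ p x b b' =
      inner ℝ ((trivializationAt F ξ p).symmL ℝ ((extChartAt I p).symm x) b)
        ((trivializationAt F ξ p).symmL ℝ ((extChartAt I p).symm x) b') := rfl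

variable [ContMDiffVectorBundle 1 F ξ I]

section ConnectionForm

variable [FiniteDimensional ℝ F]

/-- The connection form in the coordinates around `p`. -/
def connectionFormCoord (D : CovariantDerivative I F ξ) (p : M) (x : EM) : EM →L[ℝ] F →L[ℝ] F :=
  letI q := (extChartAt I p).symm x
  letI e := trivializationAt F ξ p
  letI B : F →L[ℝ] EM →L[ℝ] F :=
    ((e.continuousLinearMapAt ℝ q).postcomp EM ∘L
      (paramDeriv I (extChartAt I p).symm x).precomp (ξ q)) ∘L
        connectionForm e D q ∘L e.symmL ℝ q
  B.flip

theorem connectionFormCoord_apply (D : CovariantDerivative I F ξ) (p : M) (x a : EM) (b : F) :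
    connectionFormCoord D p x a b =
      (trivializationAt F ξ p).continuousLinearMapAt ℝ ((extChartAt I p).symm x)
        (connectionForm (trivializationAt F ξ p) D ((extChartAt I p).symm x)
          ((trivializationAt F ξ p).symmL ℝ ((extChartAt I p).symm x) b)
          (paramDeriv I (extChartAt I p).symm x a)) := rfl

end ConnectionForm

variable [I.Boundaryless] [IsManifold I 1 M] (x₀ : TotalSpace F ξ) {y : EM × F}

theorem projDeriv_paramDeriv (hy : y.1 ∈ coordDomain I F ξ x₀.proj) (u : EM × F) :
    (projDeriv ((extChartAt (I.prod 𝓘(ℝ, F)) x₀).symm y)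
      (paramDeriv (I.prod 𝓘(ℝ, F)) (extChartAt (I.prod 𝓘(ℝ, F)) x₀).symm y u) : EM) =
    paramDeriv I (extChartAt I x₀.proj).symm y.1 u.1 := by
  have hproj : (TotalSpace.proj : TotalSpace F ξ → M) ∘ (extChartAt (I.prod 𝓘(ℝ, F)) x₀).symm
      =ᶠ[𝓝 y] (extChartAt I x₀.proj).symm ∘ Prod.fst := by
    filter_upwards [continuous_fst.continuousAt.eventually
      ((isOpen_coordDomain (F := F) (V := ξ) x₀.proj).mem_nhds hy)] with y' hy'
    rw [Function.comp_apply, extChartAt_totalSpace_symm x₀ hy']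
    rfl
  have hderiv := paramDeriv_congr (I := I) hproj u
  rw [paramDeriv_comp (mdifferentiableAt_extChartAt_symm hy.1) differentiableAt_fst,
    fderiv_fst] at hderiv
  rw [projDeriv, mfderiv_paramDeriv ((contMDiffAt_proj ξ).mdifferentiableAt one_ne_zero)
    (mdifferentiableAt_extChartAt_symm (mem_extChartAt_totalSpace_target hy))]
  exact hderiv

theorem mvfderiv_trivialization_snd_paramDeriv (hy : y.1 ∈ coordDomain I F ξ x₀.proj)
    (u : EM × F) :
    mvfderiv (I.prod 𝓘(ℝ, F)) (fun z ↦ (trivializationAt F ξ x₀.proj z).2)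
      ((extChartAt (I.prod 𝓘(ℝ, F)) x₀).symm y)
      (paramDeriv (I.prod 𝓘(ℝ, F)) (extChartAt (I.prod 𝓘(ℝ, F)) x₀).symm y u) = u.2 := by
  have hsnd : (fun z ↦ (trivializationAt F ξ x₀.proj z).2) ∘
      (extChartAt (I.prod 𝓘(ℝ, F)) x₀).symm =ᶠ[𝓝 y] Prod.snd := by
    filter_upwards [continuous_fst.continuousAt.eventually
      ((isOpen_coordDomain (F := F) (V := ξ) x₀.proj).mem_nhds hy)] with y' hy'
    rw [Function.comp_apply, extChartAt_totalSpace_symm x₀ hy',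
      Trivialization.apply_mk_symm _ hy'.2]
  have hz : ((extChartAt (I.prod 𝓘(ℝ, F)) x₀).symm y).proj ∈
      (trivializationAt F ξ x₀.proj).baseSet := by
    rw [extChartAt_totalSpace_symm x₀ hy]
    exact hy.2
  rw [mvfderiv_paramDeriv (mdifferentiableAt_trivialization_snd _ hz)
    (mdifferentiableAt_extChartAt_symm (mem_extChartAt_totalSpace_target hy)), hsnd.fderiv_eq,
    fderiv_snd]
  rfl

variable [FiniteDimensional ℝ F] (D : CovariantDerivative I F ξ)

theorem connectionForm_projDeriv_paramDeriv (hy : y.1 ∈ coordDomain I F ξ x₀.proj) (u : EM × F) :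
    connectionForm (trivializationAt F ξ x₀.proj) D
        ((extChartAt (I.prod 𝓘(ℝ, F)) x₀).symm y).proj
        ((extChartAt (I.prod 𝓘(ℝ, F)) x₀).symm y).snd
        (projDeriv _ (paramDeriv (I.prod 𝓘(ℝ, F)) (extChartAt (I.prod 𝓘(ℝ, F)) x₀).symm y u)) =
      (trivializationAt F ξ x₀.proj).symmL ℝ ((extChartAt (I.prod 𝓘(ℝ, F)) x₀).symm y).proj
        (connectionFormCoord D x₀.proj y.1 u.1 y.2) := by
  let e := trivializationAt F ξ x₀.proj
  -- the tangent spaces `TangentSpace I z.proj` and `TangentSpace I q` are both `EM`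
  have htransport : ∀ (z : TotalSpace F ξ) (q : M) (v : F) (a a' : EM), q ∈ e.baseSet → a = a' →
      z = ⟨q, e.symm q v⟩ →
      connectionForm e D z.proj z.snd (a : TangentSpace I z.proj) =
      e.symmL ℝ z.proj (e.continuousLinearMapAt ℝ q (connectionForm e D q (e.symmL ℝ q v)
        (a' : TangentSpace I q))) := by
    rintro z q v a a' hq rfl rfl
    rw [e.symmL_continuousLinearMapAt hq, e.symmL_apply hq]
  rw [connectionFormCoord_apply]
  exact htransport _ _ _ _ _ hy.2 (projDeriv_paramDeriv x₀ hy u) (extChartAt_totalSpace_symm x₀ hy)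

theorem connector_paramDeriv (hy : y.1 ∈ coordDomain I F ξ x₀.proj) (u : EM × F) :
    connector D ((extChartAt (I.prod 𝓘(ℝ, F)) x₀).symm y)
      (paramDeriv (I.prod 𝓘(ℝ, F)) (extChartAt (I.prod 𝓘(ℝ, F)) x₀).symm y u) =
    (trivializationAt F ξ x₀.proj).symmL ℝ ((extChartAt (I.prod 𝓘(ℝ, F)) x₀).symm y).proj
      (localConnector (connectionFormCoord D x₀.proj) y u) := by
  have hz : ((extChartAt (I.prod 𝓘(ℝ, F)) x₀).symm y).proj ∈
      (trivializationAt F ξ x₀.proj).baseSet := by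
    rw [extChartAt_totalSpace_symm x₀ hy]
    exact hy.2
  rw [connector_apply (trivializationAt F ξ x₀.proj) D _ hz,
    mvfderiv_trivialization_snd_paramDeriv x₀ hy, connectionForm_projDeriv_paramDeriv x₀ D hy,
    localConnector_apply, map_add]

theorem pullbackMetric_connectionMetric (g : BilinearField I M)
    (hy : y.1 ∈ coordDomain I F ξ x₀.proj) :
    pullbackMetric (connectionMetric g D) (extChartAt (I.prod 𝓘(ℝ, F)) x₀).symm y =
      localMetric (pullbackMetric g (extChartAt I x₀.proj).symm)
        (fiberMetricCoord I F ξ x₀.proj) (connectionFormCoord D x₀.proj) y := by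
  have hz := extChartAt_totalSpace_symm x₀ hy
  have hbase : ∀ (q q' : M) (a a' b b' : EM), q = q' → a = a' → b = b' →
      g q (a : TangentSpace I q) (b : TangentSpace I q) =
        g q' (a' : TangentSpace I q') (b' : TangentSpace I q') := by
    rintro _ _ _ _ _ _ rfl rfl rfl
    rfl
  refine ContinuousLinearMap.ext fun u ↦ ContinuousLinearMap.ext fun v ↦ ?_
  rw [pullbackMetric_apply, connectionMetric_apply, localMetric_apply,
    connector_paramDeriv x₀ D hy, connector_paramDeriv x₀ D hy, pullbackMetric_apply,
    fiberMetricCoord_apply]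
  congr 1
  · exact hbase _ _ _ _ _ _ (by rw [hz]) (projDeriv_paramDeriv x₀ hy u)
      (projDeriv_paramDeriv x₀ hy v)
  · rw [hz]

end Coordinates

section BaseMetric

variable {EM : Type*} [NormedAddCommGroup EM] [NormedSpace ℝ EM]
  {H : Type*} [TopologicalSpace H] {I : ModelWithCorners ℝ EM H} [I.Boundaryless]
  {M : Type*} [TopologicalSpace M] [ChartedSpace H M] [IsManifold I ∞ M]

theorem paramDeriv_extChartAt_symm_eq {p : M} {x : EM} (hx : x ∈ (extChartAt I p).target)
    (a : EM) :
    paramDeriv I (extChartAt I p).symm x a =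
      (trivializationAt EM (TangentSpace I) p).symm ((extChartAt I p).symm x) a := by
  have hsource : (extChartAt I p).symm x ∈ (chartAt H p).source := by
    simpa using (extChartAt I p).map_target hx
  rw [← Trivialization.symmL_apply (R := ℝ) _ (by simpa using hsource),
    TangentBundle.symmL_trivializationAt hsource, (extChartAt I p).right_inv hx, I.range_eq_univ,
    mfderivWithin_univ]
  rfl

variable [FiniteDimensional ℝ EM]
  (g : ContMDiffRiemannianMetric I ∞ EM (fun p : M ↦ TangentSpace I p)) (p : M)

theorem contDiffOn_pullbackMetric_extChartAt_symm :
    ContDiffOn ℝ ∞ (pullbackMetric g.inner (extChartAt I p).symm) (extChartAt I p).target := by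
  let e := trivializationAt EM (TangentSpace I) p
  refine contDiffOn_clm_apply.2 fun a ↦ contDiffOn_clm_apply.2 fun b ↦ ?_
  have htotal : ContMDiffOn I (I.prod 𝓘(ℝ)) ∞
      (fun m ↦ TotalSpace.mk' ℝ (E := Bundle.Trivial M ℝ) m
        (g.inner m (e.symm m a) (e.symm m b))) e.baseSet :=
    ContMDiffOn.clm_bundle_apply₂ (F₁ := EM) (F₂ := EM) g.contMDiff.contMDiffOn
      (contMDiffOn_symm_const e a) (contMDiffOn_symm_const e b)
  have hinner : ContMDiffOn I 𝓘(ℝ) ∞ (fun m ↦ g.inner m (e.symm m a) (e.symm m b)) e.baseSet :=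
    fun x hx ↦ (contMDiffWithinAt_totalSpace.1 (htotal x hx)).2
  refine contMDiffOn_iff_contDiffOn.1 ((hinner.comp (contMDiffOn_extChartAt_symm p)
    fun x hx ↦ ?_).congr fun x hx ↦ ?_)
  · rw [mem_preimage, TangentBundle.trivializationAt_baseSet]
    simpa using (extChartAt I p).map_target hx
  · rw [pullbackMetric_apply, paramDeriv_extChartAt_symm_eq hx, paramDeriv_extChartAt_symm_eq hx]
    rfl

theorem isMetricOn_pullbackMetric_extChartAt_symm :
    IsMetricOn (pullbackMetric g.inner (extChartAt I p).symm) (extChartAt I p).target where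
  isOpen := isOpen_extChartAt_target p
  contDiffOn := contDiffOn_pullbackMetric_extChartAt_symm g p
  symm _ _ _ _ := g.symm _ _ _
  pos _ hy _ hu := g.pos _ _ fun h ↦ hu <|
    (isInvertible_paramDeriv_extChartAt_symm hy).injective (h.trans (map_zero _).symm)

end BaseMetric

section Coordinates

variable {EM : Type*} [NormedAddCommGroup EM] [NormedSpace ℝ EM]
  {H : Type*} [TopologicalSpace H] {I : ModelWithCorners ℝ EM H}
  {M : Type*} [TopologicalSpace M] [ChartedSpace H M]
  {F : Type*} [NormedAddCommGroup F] [NormedSpace ℝ F]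
  {ξ : M → Type*} [TopologicalSpace (TotalSpace F ξ)]
  [∀ p, NormedAddCommGroup (ξ p)] [∀ p, InnerProductSpace ℝ (ξ p)]
  [FiberBundle F ξ] [VectorBundle ℝ F ξ]

theorem fiberMetricCoord_eq (p : M) {x : EM} (hx : x ∈ coordDomain I F ξ p) (b b' : F) :
    fiberMetricCoord I F ξ p x b b' =
      inner ℝ ((trivializationAt F ξ p).symm ((extChartAt I p).symm x) b)
        ((trivializationAt F ξ p).symm ((extChartAt I p).symm x) b') := by
  rw [fiberMetricCoord_apply, Trivialization.symmL_apply _ hx.2, Trivialization.symmL_apply _ hx.2]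

section Smooth

variable [IsManifold I ∞ M]

section FiberMetric

variable [ContMDiffVectorBundle ∞ F ξ I] [IsContMDiffRiemannianBundle I ∞ F ξ] (p : M)

theorem contDiffOn_fiberMetricCoord [FiniteDimensional ℝ F] :
    ContDiffOn ℝ ∞ (fiberMetricCoord I F ξ p) (coordDomain I F ξ p) := by
  let e := trivializationAt F ξ p
  refine contDiffOn_clm_apply.2 fun b ↦ contDiffOn_clm_apply.2 fun b' ↦ ?_
  have hinner : ContMDiffOn I 𝓘(ℝ) ∞ (fun q ↦ inner ℝ (e.symm q b) (e.symm q b')) e.baseSet :=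
    (contMDiffOn_symm_const e b).inner_bundle (contMDiffOn_symm_const e b')
  exact contMDiffOn_iff_contDiffOn.1 <|
    (hinner.comp ((contMDiffOn_extChartAt_symm p).mono inter_subset_left) fun x hx ↦ hx.2).congr
      fun x hx ↦ fiberMetricCoord_eq p hx b b'

theorem isMetricOn_fiberMetricCoord [I.Boundaryless] [FiniteDimensional ℝ F] :
    IsMetricOn (fiberMetricCoord I F ξ p) (coordDomain I F ξ p) where
  isOpen := isOpen_coordDomain p
  contDiffOn := contDiffOn_fiberMetricCoord p
  symm _ _ _ _ := real_inner_comm _ _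
  pos x hx b hb := by
    rw [fiberMetricCoord_apply]
    refine real_inner_self_pos.2 fun h ↦ hb ?_
    rw [← Trivialization.continuousLinearMapAt_symmL (R := ℝ) _ hx.2 b, h, map_zero]

end FiberMetric

variable [FiniteDimensional ℝ EM] [T2Space M]

theorem contMDiffAt_covariantDerivative (D : CovariantDerivative I F ξ)
    (hD : CovariantDerivative.ContMDiffCovariantDerivative D ∞) {σ : ∀ q, ξ q} {U : Set M}
    (hU : IsOpen U)
    (hσ : ContMDiffOn I (I.prod 𝓘(ℝ, F)) ∞ (fun q ↦ TotalSpace.mk' F q (σ q)) U)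
    {q : M} (hq : q ∈ U) :
    ContMDiffAt I (I.prod 𝓘(ℝ, EM →L[ℝ] F)) ∞
      (fun q ↦ TotalSpace.mk' (EM →L[ℝ] F) (E := fun q ↦ TangentSpace I q →L[ℝ] ξ q) q (D σ q))
      q := by
  -- `D` is only known to preserve smoothness of global sections: cut `σ` off around `q`
  obtain ⟨f, -, hf⟩ := (SmoothBumpFunction.nhds_basis_tsupport (I := I) q).mem_iff.1
    (hU.mem_nhds hq)
  have hcut : ContMDiff I (I.prod 𝓘(ℝ, F)) ∞
      (fun q ↦ TotalSpace.mk' F q (((f : M → ℝ) • σ) q)) :=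
    ContMDiffOn.smul_section_of_tsupport f.contMDiff.contMDiffOn hU hf hσ
  have hDcut : ContMDiffAt I (I.prod 𝓘(ℝ, EM →L[ℝ] F)) ∞
      (fun q ↦ TotalSpace.mk' (EM →L[ℝ] F) (E := fun q ↦ TangentSpace I q →L[ℝ] ξ q) q
        (D ((f : M → ℝ) • σ) q)) q :=
    (hD.contMDiff.contMDiff hcut.contMDiffOn).contMDiffAt univ_mem
  refine hDcut.congr_of_eventuallyEq ?_
  filter_upwards [f.eventuallyEq_one.eventually_nhds, hU.mem_nhds hq] with q' hq' hqU
  have hσ' : MDifferentiableAt I (I.prod 𝓘(ℝ, F)) (fun q ↦ TotalSpace.mk' F q (σ q)) q' :=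
    (hσ.contMDiffAt (hU.mem_nhds hqU)).mdifferentiableAt (by simp)
  congr 1
  refine D.isCovariantDerivativeOnUniv.congr_of_eventuallyEq hσ'
    (hcut.mdifferentiable (by simp) q') univ_mem ?_
  filter_upwards [hq'] with q'' h
  simp [h]

end Smooth

section ConnectionForm

variable [FiniteDimensional ℝ F] (D : CovariantDerivative I F ξ)

theorem connectionFormCoord_eq [ContMDiffVectorBundle 1 F ξ I] (p : M) {x : EM}
    (hx : x ∈ coordDomain I F ξ p) (a : EM) (b : F) :
    connectionFormCoord D p x a b =
      (trivializationAt F ξ p ⟨(extChartAt I p).symm x,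
        D (fun q ↦ (trivializationAt F ξ p).symm q b) ((extChartAt I p).symm x)
          (paramDeriv I (extChartAt I p).symm x a)⟩).2 := by
  rw [connectionFormCoord_apply, Trivialization.continuousLinearMapAt_apply,
    Trivialization.coe_linearMapAt_of_mem _ hx.2, covariantDerivative_symm_const _ D hx.2,
    Trivialization.symmL_apply _ hx.2]

theorem symmL_connectionFormCoord [ContMDiffVectorBundle 1 F ξ I] (p : M) {x : EM}
    (hx : x ∈ coordDomain I F ξ p) (a : EM) (b : F) :
    (trivializationAt F ξ p).symmL ℝ ((extChartAt I p).symm x) (connectionFormCoord D p x a b) =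
      D (fun q ↦ (trivializationAt F ξ p).symm q b) ((extChartAt I p).symm x)
        (paramDeriv I (extChartAt I p).symm x a) := by
  rw [connectionFormCoord_eq D p hx, Trivialization.symmL_apply _ hx.2,
    Trivialization.symm_apply_apply_mk _ hx.2]

variable [I.Boundaryless] [IsManifold I ∞ M] [ContMDiffVectorBundle ∞ F ξ I]

theorem isMetricConnectionAt_connectionFormCoord [IsContMDiffRiemannianBundle I ∞ F ξ]
    (hDmetric : D.IsMetricCompatible) (p : M) {x : EM}
    (hx : x ∈ coordDomain I F ξ p) :
    IsMetricConnectionAt (fiberMetricCoord I F ξ p) (connectionFormCoord D p) x := by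
  intro a b b'
  let e := trivializationAt F ξ p
  let q := (extChartAt I p).symm x
  have hframe : ∀ b, MDifferentiableAt I (I.prod 𝓘(ℝ, F))
      (fun q ↦ TotalSpace.mk' F q (e.symm q b)) q := fun b ↦
    ((contMDiffOn_symm_const (I := I) (n := 1) e b).contMDiffAt
      (e.open_baseSet.mem_nhds hx.2)).mdifferentiableAt one_ne_zero
  have hdiff : DifferentiableAt ℝ (fiberMetricCoord I F ξ p) x :=
    ((isMetricOn_fiberMetricCoord p).contDiffAt hx).differentiableAt (by simp)
  have hcoord : (fun x' ↦ fiberMetricCoord I F ξ p x' b b') =ᶠ[𝓝 x]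
      (fun q ↦ inner ℝ (e.symm q b) (e.symm q b')) ∘ (extChartAt I p).symm := by
    filter_upwards [(isOpen_coordDomain p).mem_nhds hx] with x' hx'
    exact fiberMetricCoord_eq p hx' b b'
  rw [← fderiv_clm_apply₂_const hdiff, hcoord.fderiv_eq,
    ← mvfderiv_paramDeriv (φ := (extChartAt I p).symm)
      ((hframe b).inner_bundle (hframe b')) (mdifferentiableAt_extChartAt_symm hx.1)]
  refine (hDmetric.mvfderiv_inner_eq (x := q)
    (fun _ ↦ (paramDeriv I (extChartAt I p).symm x a : EM)) (hframe b) (hframe b')).trans ?_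
  rw [fiberMetricCoord_apply, fiberMetricCoord_apply, symmL_connectionFormCoord D p hx,
    symmL_connectionFormCoord D p hx, e.symmL_apply hx.2, e.symmL_apply hx.2]

variable [FiniteDimensional ℝ EM] [T2Space M]

theorem contDiffOn_connectionFormCoord
    (hD : CovariantDerivative.ContMDiffCovariantDerivative D ∞) (p : M) :
    ContDiffOn ℝ ∞ (connectionFormCoord D p) (coordDomain I F ξ p) := by
  let e := trivializationAt F ξ p
  let eT := trivializationAt EM (TangentSpace I) p
  refine contDiffOn_clm_apply.2 fun a ↦ contDiffOn_clm_apply.2 fun b ↦ ?_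
  have hform : ContMDiffOn I 𝓘(ℝ, F) ∞
      (fun q ↦ (e ⟨q, D (fun q ↦ e.symm q b) q (eT.symm q a)⟩).2) (eT.baseSet ∩ e.baseSet) := by
    intro q hq
    have hDe := contMDiffAt_covariantDerivative D hD e.open_baseSet (contMDiffOn_symm_const e b)
      hq.2
    have ha : ContMDiffAt I (I.prod 𝓘(ℝ, EM)) ∞
        (fun q ↦ TotalSpace.mk' EM (E := fun q : M ↦ TangentSpace I q) q (eT.symm q a)) q :=
      (contMDiffOn_symm_const eT a).contMDiffAt (eT.open_baseSet.mem_nhds hq.1)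
    have hDea : ContMDiffAt I (I.prod 𝓘(ℝ, F)) ∞
        (fun q ↦ TotalSpace.mk' F q (D (fun q ↦ e.symm q b) q (eT.symm q a))) q :=
      ContMDiffAt.clm_bundle_apply (F₁ := EM) (F₂ := F) hDe ha
    exact ((e.contMDiffAt_section_iff hq.2).1 hDea).contMDiffWithinAt
  refine contMDiffOn_iff_contDiffOn.1 ((hform.comp
    ((contMDiffOn_extChartAt_symm p).mono inter_subset_left) fun x hx ↦ ⟨?_, hx.2⟩).congr
    fun x hx ↦ ?_)
  · rw [TangentBundle.trivializationAt_baseSet]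
    simpa using (extChartAt I p).map_target hx.1
  · rw [connectionFormCoord_eq D p hx, paramDeriv_extChartAt_symm_eq hx.1]
    rfl

theorem isConnectionData_coord [IsContMDiffRiemannianBundle I ∞ F ξ]
    (g : ContMDiffRiemannianMetric I ∞ EM (fun p : M ↦ TangentSpace I p))
    (hD : CovariantDerivative.ContMDiffCovariantDerivative D ∞)
    (hDmetric : D.IsMetricCompatible) (p : M) :
    IsConnectionData (pullbackMetric g.inner (extChartAt I p).symm) (fiberMetricCoord I F ξ p)
      (connectionFormCoord D p) (coordDomain I F ξ p) where
  base := (isMetricOn_pullbackMetric_extChartAt_symm g p).mono (isOpen_coordDomain p)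
    inter_subset_left
  fiber := isMetricOn_fiberMetricCoord p
  contDiffOn_form := contDiffOn_connectionFormCoord D hD p
  compatible _ hx := isMetricConnectionAt_connectionFormCoord D hDmetric p hx

end ConnectionForm

end Coordinates

/-! ### Smoothness of the connection metric -/

section PositiveForm

variable {E : Type*} [NormedAddCommGroup E] [NormedSpace ℝ E] [FiniteDimensional ℝ E]
  {b : E →L[ℝ] E →L[ℝ] ℝ}

theorem isCoercive_of_pos (hb : ∀ u, u ≠ 0 → 0 < b u u) : IsCoercive b := by
  rcases subsingleton_or_nontrivial E with hE | hE
  · exact ⟨1, one_pos, fun u ↦ by simp [Subsingleton.elim u 0]⟩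
  have hcont : Continuous fun u ↦ b u u := by fun_prop
  obtain ⟨u₀, hu₀, hmin⟩ := (isCompact_sphere (0 : E) 1).exists_isMinOn
    (NormedSpace.sphere_nonempty.2 zero_le_one) hcont.continuousOn
  have hu₀' : u₀ ≠ 0 := fun h ↦ by simp [h] at hu₀
  refine ⟨b u₀ u₀, hb u₀ hu₀', fun u ↦ ?_⟩
  rcases eq_or_ne u 0 with rfl | hu
  · simp
  have hn : 0 < ‖u‖ := norm_pos_iff.2 hu
  have hle : b u₀ u₀ ≤ b (‖u‖⁻¹ • u) (‖u‖⁻¹ • u) := hmin (by simp [norm_smul, hn.ne'])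
  simp only [map_smul, smul_apply, smul_eq_mul] at hle
  calc b u₀ u₀ * ‖u‖ * ‖u‖ ≤ (‖u‖⁻¹ * (‖u‖⁻¹ * b u u)) * ‖u‖ * ‖u‖ := by gcongr
    _ = b u u := by field_simp

theorem isVonNBounded_of_pos (hb : ∀ u, u ≠ 0 → 0 < b u u) :
    Bornology.IsVonNBounded ℝ {u | b u u < 1} := by
  obtain ⟨c, hc, h⟩ := isCoercive_of_pos hb
  rw [NormedSpace.isVonNBounded_iff, isBounded_iff_forall_norm_le]
  refine ⟨c⁻¹ + 1, fun u hu ↦ ?_⟩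
  have hu' : ‖u‖ * ‖u‖ < c⁻¹ := by
    rw [← one_div, lt_div_iff₀' hc, ← mul_assoc]
    exact (h u).trans_lt hu
  nlinarith [sq_nonneg (‖u‖ - 1)]

end PositiveForm

section BilinearField

variable {E : Type*} [NormedAddCommGroup E] [NormedSpace ℝ E]
  {H : Type*} [TopologicalSpace H] {I : ModelWithCorners ℝ E H} [I.Boundaryless]
  {N : Type*} [TopologicalSpace N] [ChartedSpace H N]

section Coordinates

variable [IsManifold I 1 N]

theorem paramDeriv_extChartAt_symm_mfderiv (p : N) {q : N} (hq : q ∈ (extChartAt I p).source)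
    (u : TangentSpace I q) :
    (paramDeriv I (extChartAt I p).symm (extChartAt I p q)
      (mfderiv I 𝓘(ℝ, E) (extChartAt I p) q u) : E) = u := by
  have h := mfderivWithin_extChartAt_symm_comp_mfderiv_extChartAt' (I := I) hq
  rw [I.range_eq_univ, mfderivWithin_univ] at h
  exact congrArg (fun L : E →L[ℝ] E ↦ L u) h

theorem bilinearField_eq_pullbackMetric (G : BilinearField I N) (p : N) {q : N}
    (hq : q ∈ (extChartAt I p).source) (u v : TangentSpace I q) :
    G q u v = pullbackMetric G (extChartAt I p).symm (extChartAt I p q)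
      (mfderiv I 𝓘(ℝ, E) (extChartAt I p) q u) (mfderiv I 𝓘(ℝ, E) (extChartAt I p) q v) := by
  have htransport : ∀ (q q' : N) (a a' b b' : E), q = q' → a = a' → b = b' →
      G q (a : TangentSpace I q) (b : TangentSpace I q) =
        G q' (a' : TangentSpace I q') (b' : TangentSpace I q') := by
    rintro _ _ _ _ _ _ rfl rfl rfl
    rfl
  exact htransport _ _ _ _ _ _ ((extChartAt I p).left_inv hq).symm
    (paramDeriv_extChartAt_symm_mfderiv p hq u).symm
    (paramDeriv_extChartAt_symm_mfderiv p hq v).symm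

end Coordinates

variable [IsManifold I ∞ N]

theorem contMDiffAt_of_contDiffAt_pullbackMetric (G : BilinearField I N) (p : N)
    (hG : ContDiffAt ℝ ∞ (pullbackMetric G (extChartAt I p).symm) (extChartAt I p p)) :
    ContMDiffAt I (I.prod 𝓘(ℝ, E →L[ℝ] E →L[ℝ] ℝ)) ∞
      (fun q ↦ TotalSpace.mk' (E →L[ℝ] E →L[ℝ] ℝ)
        (E := fun q : N ↦ TangentSpace I q →L[ℝ] TangentSpace I q →L[ℝ] ℝ) q (G q)) p := by
  rw [contMDiffAt_section]
  have hcoord : ContMDiffAt I 𝓘(ℝ, E →L[ℝ] E →L[ℝ] ℝ) ∞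
      (pullbackMetric G (extChartAt I p).symm ∘ extChartAt I p) p :=
    hG.contMDiffAt.comp p contMDiffAt_extChartAt
  refine hcoord.congr_of_eventuallyEq ?_
  filter_upwards [extChartAt_source_mem_nhds (I := I) p] with q hq
  have hq' := (extChartAt I p).map_source hq
  have hbase : q ∈ (trivializationAt E (TangentSpace I) p).baseSet := by
    rw [TangentBundle.trivializationAt_baseSet]
    simpa using hq
  refine ContinuousLinearMap.ext fun a ↦ ContinuousLinearMap.ext fun b ↦ ?_
  rw [Function.comp_apply, pullbackMetric_apply, paramDeriv_extChartAt_symm_eq hq',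
    paramDeriv_extChartAt_symm_eq hq', (extChartAt I p).left_inv hq]
  simp only [hom_trivializationAt_apply, ContinuousLinearMap.inCoordinates,
    ContinuousLinearMap.comp_apply, Trivialization.continuousLinearMapAt_apply]
  rw [Trivialization.coe_linearMapAt_of_mem _ (by
    rw [hom_trivializationAt_baseSet]
    exact ⟨hbase, by simp⟩)]
  simp only [hom_trivializationAt_apply, ContinuousLinearMap.inCoordinates,
    ContinuousLinearMap.comp_apply, Trivialization.symmL_apply _ hbase]
  simp

theorem isRiemannianMetric_of_coord [FiniteDimensional ℝ E] (G : BilinearField I N)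
    (hsymm : ∀ x u v, G x u v = G x v u) (hpos : ∀ x u, u ≠ 0 → 0 < G x u u)
    (hG : ∀ p : N, ContDiffAt ℝ ∞ (pullbackMetric G (extChartAt I p).symm) (extChartAt I p p)) :
    IsRiemannianMetric G :=
  ⟨⟨G, hsymm, hpos, fun x ↦ isVonNBounded_of_pos (E := E) (hpos x),
    fun p ↦ contMDiffAt_of_contDiffAt_pullbackMetric G p (hG p)⟩, fun _ ↦ rfl⟩

end BilinearField

section ConnectionMetric

variable {EM : Type*} [NormedAddCommGroup EM] [NormedSpace ℝ EM]
  {H : Type*} [TopologicalSpace H] {I : ModelWithCorners ℝ EM H}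
  {M : Type*} [TopologicalSpace M] [ChartedSpace H M]
  {F : Type*} [NormedAddCommGroup F] [NormedSpace ℝ F]
  {ξ : M → Type*} [TopologicalSpace (TotalSpace F ξ)]

theorem fst_extChartAt_mem_coordDomain [∀ p, TopologicalSpace (ξ p)] [FiberBundle F ξ]
    (x₀ : TotalSpace F ξ) {x : TotalSpace F ξ}
    (hx : x ∈ (extChartAt (I.prod 𝓘(ℝ, F)) x₀).source) :
    (extChartAt (I.prod 𝓘(ℝ, F)) x₀ x).1 ∈ coordDomain I F ξ x₀.proj := by
  have h := (extChartAt (I.prod 𝓘(ℝ, F)) x₀).map_source hx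
  rw [extChartAt_totalSpace_target] at h
  exact h.1

variable [FiniteDimensional ℝ EM] [I.Boundaryless] [IsManifold I ∞ M] [T2Space M]
  [FiniteDimensional ℝ F] [∀ p, NormedAddCommGroup (ξ p)] [∀ p, InnerProductSpace ℝ (ξ p)]
  [FiberBundle F ξ] [VectorBundle ℝ F ξ] [ContMDiffVectorBundle ∞ F ξ I]
  [IsContMDiffRiemannianBundle I ∞ F ξ]
  (g : ContMDiffRiemannianMetric I ∞ EM (fun p : M ↦ TangentSpace I p))
  (D : CovariantDerivative I F ξ) (hD : CovariantDerivative.ContMDiffCovariantDerivative D ∞)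
  (hDmetric : D.IsMetricCompatible)

include hD hDmetric

theorem isMetricOn_connectionMetric (x₀ : TotalSpace F ξ) :
    IsMetricOn (pullbackMetric (connectionMetric g.inner D)
      (extChartAt (I.prod 𝓘(ℝ, F)) x₀).symm) (coordDomain I F ξ x₀.proj ×ˢ univ) :=
  (isConnectionData_coord D g hD hDmetric x₀.proj).isMetricOn.congr fun _ hy ↦
    pullbackMetric_connectionMetric x₀ D g.inner hy.1

theorem isRiemannianMetric_connectionMetric :
    IsRiemannianMetric (connectionMetric g.inner D) := by
  have hmem : ∀ x : TotalSpace F ξ, extChartAt (I.prod 𝓘(ℝ, F)) x x ∈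
      coordDomain I F ξ x.proj ×ˢ (univ : Set F) := fun x ↦
    ⟨fst_extChartAt_mem_coordDomain x (mem_extChartAt_source x), mem_univ _⟩
  refine isRiemannianMetric_of_coord _ (fun x u v ↦ ?_) (fun x u hu ↦ ?_) fun x ↦
    (isMetricOn_connectionMetric g D hD hDmetric x).contDiffAt (hmem x)
  · rw [connectionMetric_apply, connectionMetric_apply, g.symm, real_inner_comm]
  · rw [bilinearField_eq_pullbackMetric _ x (mem_extChartAt_source x)]
    refine (isMetricOn_connectionMetric g D hD hDmetric x).pos _ (hmem x) _ fun h ↦ hu ?_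
    exact (isInvertible_mfderiv_extChartAt (mem_extChartAt_source x)).injective
      (h.trans (map_zero _).symm)

end ConnectionMetric

/-! ### Completeness -/

section RiemannianDistance

variable {E : Type*} [NormedAddCommGroup E] [NormedSpace ℝ E]
  {H : Type*} [TopologicalSpace H] {I : ModelWithCorners ℝ E H}
  {N : Type*} [TopologicalSpace N] [ChartedSpace H N] [IsManifold I ∞ N]
  (g : ContMDiffRiemannianMetric I ∞ E (fun x : N ↦ TangentSpace I x))

theorem metricEDist_eq_riemannianEDist (x y : N) :
    letI : RiemannianBundle (fun x : N ↦ TangentSpace I x) := ⟨g.toRiemannianMetric⟩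
    metricEDist g.inner x y = riemannianEDist I x y := by
  let : RiemannianBundle (fun x : N ↦ TangentSpace I x) := ⟨g.toRiemannianMetric⟩
  have henorm : (fun z : N ↦ (⟨fun v ↦ ENNReal.ofReal (Real.sqrt (g.inner z v v))⟩ :
      ENorm (TangentSpace I z))) = fun z ↦ (inferInstance : ENorm (TangentSpace I z)) := by
    funext z
    congr 1
    funext v
    change _ = ‖v‖ₑ
    rw [← ofReal_norm, norm_eq_sqrt_real_inner]
    rfl
  unfold metricEDist
  rw [henorm]

theorem metricEDist_comm (x y : N) : metricEDist g.inner x y = metricEDist g.inner y x := by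
  let : RiemannianBundle (fun x : N ↦ TangentSpace I x) := ⟨g.toRiemannianMetric⟩
  rw [metricEDist_eq_riemannianEDist, metricEDist_eq_riemannianEDist, riemannianEDist_comm]

theorem metricEDist_triangle (x y z : N) :
    metricEDist g.inner x z ≤ metricEDist g.inner x y + metricEDist g.inner y z := by
  let : RiemannianBundle (fun x : N ↦ TangentSpace I x) := ⟨g.toRiemannianMetric⟩
  simp only [metricEDist_eq_riemannianEDist]
  exact riemannianEDist_triangle

theorem eventually_metricEDist_lt (z : N) {ε : ℝ≥0∞} (hε : 0 < ε) :
    ∀ᶠ y in 𝓝 z, metricEDist g.inner z y < ε := by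
  let : RiemannianBundle (fun x : N ↦ TangentSpace I x) := ⟨g.toRiemannianMetric⟩
  have : IsContinuousRiemannianBundle E (fun x : N ↦ TangentSpace I x) :=
    ⟨⟨g.inner, g.contMDiff.continuous, fun _ _ _ ↦ rfl⟩⟩
  simp only [metricEDist_eq_riemannianEDist]
  exact eventually_riemannianEDist_lt I z hε

theorem enorm_sub_le_metricEDist {h : N → ℝ} (hh : ContMDiff I 𝓘(ℝ, ℝ) 1 h)
    (hgrad : ∀ x (u : TangentSpace I x), |mvfderiv I h x u| ≤ √(g.inner x u u)) (x y : N) :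
    ‖h y - h x‖ₑ ≤ metricEDist g.inner x y := by
  let : RiemannianBundle (fun x : N ↦ TangentSpace I x) := ⟨g.toRiemannianMetric⟩
  rw [metricEDist_eq_riemannianEDist]
  refine le_of_forall_gt fun r hr ↦ ?_
  obtain ⟨γ, rfl, rfl, hγ, hlen, -⟩ :=
    exists_lt_locally_constant_of_riemannianEDist_lt hr zero_lt_one
  refine lt_of_le_of_lt ?_ hlen
  have hhγ : ContDiff ℝ 1 (h ∘ γ) := contMDiff_iff_contDiff.1 (hh.comp hγ)
  refine (enorm_sub_le_lintegral_deriv_of_contDiffOn_Icc hhγ.contDiffOn zero_le_one).trans ?_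
  rw [pathELength_eq_lintegral_mfderiv_Icc]
  refine MeasureTheory.lintegral_mono fun t ↦ ?_
  have hchain : deriv (h ∘ γ) t = mvfderiv I h (γ t) (mfderiv 𝓘(ℝ, ℝ) I γ t (1 : ℝ)) := by
    rw [← fderiv_apply_one_eq_deriv]
    exact (mvfderiv_paramDeriv (hh.mdifferentiable one_ne_zero _)
      (hγ.mdifferentiable one_ne_zero t) (1 : ℝ)).symm
  rw [hchain, ← ofReal_norm, ← ofReal_norm, Real.norm_eq_abs]
  refine ENNReal.ofReal_le_ofReal ((hgrad _ _).trans_eq ?_)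
  rw [norm_eq_sqrt_real_inner]
  rfl

theorem tendsto_metricEDist_of_mapClusterPt {x : ℕ → N} {z : N}
    (hx : ∀ ε : ℝ≥0∞, 0 < ε → ∃ k₀, ∀ k ≥ k₀, ∀ l ≥ k₀, metricEDist g.inner (x k) (x l) < ε)
    (hz : MapClusterPt z atTop x) :
    Tendsto (fun k ↦ metricEDist g.inner (x k) z) atTop (𝓝 0) := by
  refine ENNReal.tendsto_nhds_zero.2 fun ε hε ↦ ?_
  have hε2 : 0 < ε / 2 := ENNReal.half_pos hε.ne'
  obtain ⟨k₀, hk₀⟩ := hx (ε / 2) hε2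
  filter_upwards [eventually_ge_atTop k₀] with k hk
  obtain ⟨l, hlz, hl⟩ := ((hz.frequently (eventually_metricEDist_lt g z hε2)).and_eventually
    (eventually_ge_atTop k₀)).exists
  calc metricEDist g.inner (x k) z
      ≤ metricEDist g.inner (x k) (x l) + metricEDist g.inner z (x l) := by
        rw [metricEDist_comm g z]
        exact metricEDist_triangle g _ _ _
    _ ≤ ε / 2 + ε / 2 := add_le_add (hk₀ k hk l hl).le hlz.le
    _ = ε := ENNReal.add_halves ε

theorem isCompleteMetric_of_proper {G : BilinearField I N} (hG : IsRiemannianMetric G) {h : N → ℝ}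
    (hh : ContMDiff I 𝓘(ℝ, ℝ) 1 h)
    (hgrad : ∀ x (u : TangentSpace I x), |mvfderiv I h x u| ≤ √(G x u u))
    (hproper : ∀ C : ℝ, IsCompact {x | h x ≤ C}) : IsCompleteMetric G := by
  obtain ⟨g, hg⟩ := hG
  obtain rfl : g.inner = G := funext hg
  intro x hx
  obtain ⟨k₁, hk₁⟩ := hx 1 one_pos
  have hmem : ∀ k ≥ k₁, x k ∈ {z | h z ≤ h (x k₁) + 1} := fun k hk ↦ by
    have hdist := (enorm_sub_le_metricEDist g hh hgrad (x k₁) (x k)).trans_lt (hk₁ k₁ le_rfl k hk)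
    rw [← ofReal_norm, ENNReal.ofReal_lt_one, Real.norm_eq_abs, abs_lt] at hdist
    simp only [Set.mem_ofPred_eq]
    linarith [hdist.2]
  obtain ⟨z, -, hz⟩ := (hproper (h (x k₁) + 1)).exists_mapClusterPt (f := atTop) (u := x)
    (by simpa using (eventually_ge_atTop k₁).mono hmem)
  exact ⟨z, tendsto_metricEDist_of_mapClusterPt g hx hz⟩

end RiemannianDistance

section FiberNorm

variable {M F : Type*} {ξ : M → Type*}
  [∀ p, NormedAddCommGroup (ξ p)] [∀ p, InnerProductSpace ℝ (ξ p)]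

theorem fiberNormSq_eq_norm_sq (x : TotalSpace F ξ) : fiberNormSq F ξ x = ‖x.snd‖ ^ 2 :=
  real_inner_self_eq_norm_sq _

theorem fiberNormSq_nonneg (x : TotalSpace F ξ) : 0 ≤ fiberNormSq F ξ x :=
  real_inner_self_nonneg

variable [TopologicalSpace M] [NormedAddCommGroup F] [NormedSpace ℝ F]
  [TopologicalSpace (TotalSpace F ξ)] [FiberBundle F ξ] [VectorBundle ℝ F ξ]

theorem norm_trivialization_snd_le (e : Trivialization F (TotalSpace.proj : TotalSpace F ξ → M))
    [MemTrivializationAtlas e] {x : TotalSpace F ξ} (hx : x.proj ∈ e.baseSet) :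
    ‖(e x).2‖ ≤ ‖e.continuousLinearMapAt ℝ x.proj‖ * ‖x.snd‖ := by
  have h : (e x).2 = e.continuousLinearMapAt ℝ x.proj x.snd := by
    rw [Trivialization.continuousLinearMapAt_apply, Trivialization.coe_linearMapAt_of_mem _ hx]
  exact h ▸ ContinuousLinearMap.le_opNorm _ _

theorem connectedSpace_totalSpace [ConnectedSpace M] : ConnectedSpace (TotalSpace F ξ) := by
  obtain ⟨p₀⟩ := (inferInstance : Nonempty M)
  have hzero : IsPreconnected (range (zeroSection F ξ)) :=
    isPreconnected_range (Trivialization.continuous_zeroSection ℝ)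
  have hfiber (p : M) : IsPreconnected (range (TotalSpace.mk p : ξ p → TotalSpace F ξ)) :=
    isPreconnected_range (FiberBundle.continuous_totalSpaceMk F ξ p)
  have hpre : IsPreconnected (univ : Set (TotalSpace F ξ)) :=
    isPreconnected_of_forall (zeroSection F ξ p₀) fun x _ ↦
      ⟨range (zeroSection F ξ) ∪ range (TotalSpace.mk x.proj), subset_univ _,
        Or.inl ⟨p₀, rfl⟩, Or.inr ⟨x.snd, rfl⟩,
        hzero.union (zeroSection F ξ x.proj) ⟨x.proj, rfl⟩ ⟨0, rfl⟩ (hfiber x.proj)⟩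
  exact { isPreconnected_univ := hpre, toNonempty := ⟨zeroSection F ξ p₀⟩ }

section Compact

variable [FiniteDimensional ℝ F] [IsContinuousRiemannianBundle F ξ]

theorem exists_nhds_fiberNormSq_le_subset_isCompact [LocallyCompactSpace M] (p : M) (c : ℝ) :
    ∃ K ∈ 𝓝 p, ∃ T : Set (TotalSpace F ξ), IsCompact T ∧
      ∀ x, x.proj ∈ K → fiberNormSq F ξ x ≤ c → x ∈ T := by
  let e := trivializationAt F ξ p
  obtain ⟨C, hC, hev⟩ := eventually_norm_trivializationAt_lt F ξ p
  obtain ⟨K, hK, hKs, hKc⟩ := local_compact_nhds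
    (inter_mem hev (e.open_baseSet.mem_nhds (mem_baseSet_trivializationAt F ξ p)))
  refine ⟨K, hK, e.toOpenPartialHomeomorph.symm '' (K ×ˢ Metric.closedBall 0 (C * √c)), ?_, ?_⟩
  · exact (hKc.prod (isCompact_closedBall _ _)).image_of_continuousOn
      (e.toOpenPartialHomeomorph.continuousOn_symm.mono fun y hy ↦ e.mem_target.2 (hKs hy.1).2)
  · intro x hx hxc
    have hxs : x ∈ e.source := e.mem_source.2 (hKs hx).2
    refine ⟨e x, ⟨by rwa [e.coe_fst hxs], ?_⟩, e.toOpenPartialHomeomorph.left_inv hxs⟩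
    rw [fiberNormSq_eq_norm_sq] at hxc
    rw [mem_closedBall_zero_iff]
    exact (norm_trivialization_snd_le e (hKs hx).2).trans
      (mul_le_mul (hKs hx).1.le (Real.le_sqrt_of_sq_le hxc) (norm_nonneg _) hC.le)

theorem isCompact_fiberNormSq_le [CompactSpace M] [LocallyCompactSpace M]
    (hcont : Continuous (fiberNormSq F ξ)) (c : ℝ) :
    IsCompact {x : TotalSpace F ξ | fiberNormSq F ξ x ≤ c} := by
  choose K hK T hT hsub using
    fun p : M ↦ exists_nhds_fiberNormSq_le_subset_isCompact (F := F) (ξ := ξ) p c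
  obtain ⟨t, ht⟩ := CompactSpace.elim_nhds_subcover K hK
  refine (t.isCompact_biUnion fun p _ ↦ hT p).of_isClosed_subset
    (isClosed_le hcont continuous_const) fun x hx ↦ ?_
  obtain ⟨p, hp, hxp⟩ := mem_iUnion₂.1 (ht ▸ mem_univ x.proj : x.proj ∈ ⋃ p ∈ t, K p)
  exact mem_iUnion₂.2 ⟨p, hp, hsub p x hxp hx⟩

end Compact

variable {EM : Type*} [NormedAddCommGroup EM] [NormedSpace ℝ EM]
  {H : Type*} [TopologicalSpace H] (I : ModelWithCorners ℝ EM H) [ChartedSpace H M]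
  [IsContMDiffRiemannianBundle I ∞ F ξ]

variable (F ξ)

include I in
theorem isContinuousRiemannianBundle_of_contMDiff : IsContinuousRiemannianBundle F ξ :=
  let ⟨γ, hγ, hinner⟩ :=
    IsContMDiffRiemannianBundle.exists_contMDiff (IB := I) (n := ∞) (F := F) (E := ξ)
  ⟨⟨γ, hγ.continuous, hinner⟩⟩

theorem contMDiff_fiberNormSq : ContMDiff (I.prod 𝓘(ℝ, F)) 𝓘(ℝ, ℝ) ∞ (fiberNormSq F ξ) :=
  ContMDiff.inner_bundle (IB := I) (F := F) (b := (TotalSpace.proj : TotalSpace F ξ → M))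
    (v := fun z ↦ z.snd) (w := fun z ↦ z.snd) contMDiff_id contMDiff_id

end FiberNorm

section FiberNormDerivative

variable {EM : Type*} [NormedAddCommGroup EM] [NormedSpace ℝ EM]
  {H : Type*} [TopologicalSpace H] {I : ModelWithCorners ℝ EM H}
  {M : Type*} [TopologicalSpace M] [ChartedSpace H M]
  {F : Type*} [NormedAddCommGroup F] [NormedSpace ℝ F]
  {ξ : M → Type*} [TopologicalSpace (TotalSpace F ξ)]
  [∀ p, NormedAddCommGroup (ξ p)] [∀ p, InnerProductSpace ℝ (ξ p)]
  [FiberBundle F ξ] [VectorBundle ℝ F ξ]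

theorem fiberNormSq_extChartAt_symm (x₀ : TotalSpace F ξ) {y : EM × F}
    (hy : y.1 ∈ coordDomain I F ξ x₀.proj) :
    fiberNormSq F ξ ((extChartAt (I.prod 𝓘(ℝ, F)) x₀).symm y) =
      fiberMetricCoord I F ξ x₀.proj y.1 y.2 y.2 := by
  rw [extChartAt_totalSpace_symm x₀ hy, fiberMetricCoord_eq _ hy]
  rfl

variable [FiniteDimensional ℝ F] [I.Boundaryless] [IsManifold I ∞ M]
  [ContMDiffVectorBundle ∞ F ξ I] [IsContMDiffRiemannianBundle I ∞ F ξ]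
  (D : CovariantDerivative I F ξ) (hDmetric : D.IsMetricCompatible)

include hDmetric

theorem mvfderiv_fiberNormSq_paramDeriv (x₀ : TotalSpace F ξ) {y : EM × F}
    (hy : y.1 ∈ coordDomain I F ξ x₀.proj) (w : EM × F) :
    mvfderiv (I.prod 𝓘(ℝ, F)) (fiberNormSq F ξ) ((extChartAt (I.prod 𝓘(ℝ, F)) x₀).symm y)
        (paramDeriv (I.prod 𝓘(ℝ, F)) (extChartAt (I.prod 𝓘(ℝ, F)) x₀).symm y w) =
      2 * fiberMetricCoord I F ξ x₀.proj y.1 y.2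
        (localConnector (connectionFormCoord D x₀.proj) y w) := by
  have hk := isMetricOn_fiberMetricCoord (I := I) (F := F) (ξ := ξ) x₀.proj
  have hcoord : fiberNormSq F ξ ∘ (extChartAt (I.prod 𝓘(ℝ, F)) x₀).symm =ᶠ[𝓝 y]
      fun z ↦ fiberMetricCoord I F ξ x₀.proj z.1 z.2 z.2 := by
    filter_upwards [continuous_fst.continuousAt.eventually
      ((isOpen_coordDomain (I := I) (F := F) (V := ξ) x₀.proj).mem_nhds hy)] with z hz
    exact fiberNormSq_extChartAt_symm x₀ hz
  rw [mvfderiv_paramDeriv ((contMDiff_fiberNormSq F ξ I).mdifferentiable (by simp) _)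
      (mdifferentiableAt_extChartAt_symm (mem_extChartAt_totalSpace_target hy)),
    hcoord.fderiv_eq,
    (hasFDerivAt_fiberNorm ((hk.contDiffAt hy).differentiableAt (by simp)) (hk.symm _ hy)
      (isMetricConnectionAt_connectionFormCoord D hDmetric x₀.proj hy)).fderiv]
  simp

theorem mvfderiv_fiberNormSq (x : TotalSpace F ξ) (u : TangentSpace (I.prod 𝓘(ℝ, F)) x) :
    mvfderiv (I.prod 𝓘(ℝ, F)) (fiberNormSq F ξ) x u = 2 * inner ℝ x.snd (connector D x u) := by
  let φ := (extChartAt (I.prod 𝓘(ℝ, F)) x).symm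
  let y := extChartAt (I.prod 𝓘(ℝ, F)) x x
  have hy : y.1 ∈ coordDomain I F ξ x.proj :=
    fst_extChartAt_mem_coordDomain x (mem_extChartAt_source x)
  suffices h : ∀ z : TotalSpace F ξ, z = φ y → ∀ u : TangentSpace (I.prod 𝓘(ℝ, F)) z,
      mvfderiv (I.prod 𝓘(ℝ, F)) (fiberNormSq F ξ) z u = 2 * inner ℝ z.snd (connector D z u) from
    h x (extChartAt_to_inv x).symm u
  rintro _ rfl u
  obtain ⟨w, rfl⟩ := (isInvertible_paramDeriv_extChartAt_symm (I := I.prod 𝓘(ℝ, F))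
    (mem_extChartAt_totalSpace_target hy)).bijective.surjective u
  have htransport : ∀ z : TotalSpace F ξ, z = ⟨(extChartAt I x.proj).symm y.1,
      (trivializationAt F ξ x.proj).symm ((extChartAt I x.proj).symm y.1) y.2⟩ → ∀ b : F,
      fiberMetricCoord I F ξ x.proj y.1 y.2 b =
        inner ℝ z.snd ((trivializationAt F ξ x.proj).symmL ℝ z.proj b) := by
    rintro _ rfl b
    rw [fiberMetricCoord_eq _ hy, Trivialization.symmL_apply _ hy.2]
  rw [mvfderiv_fiberNormSq_paramDeriv D hDmetric x hy, connector_paramDeriv x D hy,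
    htransport (φ y) (extChartAt_totalSpace_symm x hy)]

variable (g : ContMDiffRiemannianMetric I ∞ EM (fun p : M ↦ TangentSpace I p))

theorem abs_mvfderiv_sqrt_fiberNormSq_le (x : TotalSpace F ξ)
    (u : TangentSpace (I.prod 𝓘(ℝ, F)) x) :
    |mvfderiv (I.prod 𝓘(ℝ, F)) (fun z : TotalSpace F ξ ↦ √(1 + fiberNormSq F ξ z)) x u| ≤
      √(connectionMetric g.inner D x u u) := by
  let v := x.snd
  let K := connector D x u
  have hpos : 0 < 1 + ‖v‖ ^ 2 := by positivity
  have hsqrt : HasFDerivAt (fun t : ℝ ↦ √(1 + t)) _ (fiberNormSq F ξ x) :=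
    ((hasFDerivAt_id _).const_add 1).sqrt (by simpa [fiberNormSq_eq_norm_sq] using hpos.ne')
  have hderiv : mvfderiv (I.prod 𝓘(ℝ, F)) (fun z : TotalSpace F ξ ↦ √(1 + fiberNormSq F ξ z)) x u =
      inner ℝ v K / √(1 + ‖v‖ ^ 2) := by
    have hchain : mvfderiv (I.prod 𝓘(ℝ, F)) (fun z ↦ √(1 + fiberNormSq F ξ z)) x u =
        fderiv ℝ (fun t ↦ √(1 + t)) (fiberNormSq F ξ x)
          (mvfderiv (I.prod 𝓘(ℝ, F)) (fiberNormSq F ξ) x u) := by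
      rw [← mfderiv_eq_fderiv]
      exact mvfderiv_comp_apply x hsqrt.differentiableAt.mdifferentiableAt
        ((contMDiff_fiberNormSq F ξ I).mdifferentiable (by simp) x) u
    rw [hchain, hsqrt.fderiv, mvfderiv_fiberNormSq D hDmetric, ← fiberNormSq_eq_norm_sq]
    simp only [id, smul_apply, ContinuousLinearMap.id_apply, smul_eq_mul]
    ring
  have hg : 0 ≤ g.inner x.proj (projDeriv x u) (projDeriv x u) := by
    rcases eq_or_ne (projDeriv x u) 0 with h | h
    · simp [h]
    · exact (g.pos _ _ h).le
  have hv : ‖v‖ ≤ √(1 + ‖v‖ ^ 2) := Real.le_sqrt_of_sq_le (by linarith)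
  rw [hderiv, abs_div, abs_of_pos (Real.sqrt_pos.2 hpos), div_le_iff₀ (Real.sqrt_pos.2 hpos)]
  calc |inner ℝ v K| ≤ ‖v‖ * ‖K‖ := abs_real_inner_le_norm v K
    _ = ‖K‖ * ‖v‖ := mul_comm _ _
    _ ≤ √(connectionMetric g.inner D x u u) * √(1 + ‖v‖ ^ 2) := by
      gcongr
      refine Real.le_sqrt_of_sq_le ?_
      rw [connectionMetric_apply, real_inner_self_eq_norm_sq]
      linarith

theorem isCompleteMetric_connectionMetric [FiniteDimensional ℝ EM] [T2Space M] [CompactSpace M]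
    (hD : CovariantDerivative.ContMDiffCovariantDerivative D ∞) :
    IsCompleteMetric (connectionMetric g.inner D) := by
  have hsmooth := contMDiff_fiberNormSq F ξ I
  have hpos (x : TotalSpace F ξ) : 0 < 1 + fiberNormSq F ξ x := by
    linarith [fiberNormSq_nonneg x]
  refine isCompleteMetric_of_proper (isRiemannianMetric_connectionMetric g D hD hDmetric)
    (h := fun z : TotalSpace F ξ ↦ √(1 + fiberNormSq F ξ z)) (fun x ↦ ?_)
    (abs_mvfderiv_sqrt_fiberNormSq_le D hDmetric g) fun C ↦ ?_
  · have hsqrt : ContDiffAt ℝ 1 (fun t ↦ √(1 + t)) (fiberNormSq F ξ x) :=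
      (contDiffAt_const.add contDiffAt_id).sqrt (hpos x).ne'
    exact hsqrt.contMDiffAt.comp x (hsmooth.of_le (by simp) x)
  · have : LocallyCompactSpace M := Manifold.locallyCompact_of_finiteDimensional I
    have := isContinuousRiemannianBundle_of_contMDiff F ξ I
    refine (isCompact_fiberNormSq_le hsmooth.continuous (C ^ 2 - 1)).of_isClosed_subset
      (isClosed_le (continuous_const.add hsmooth.continuous).sqrt continuous_const) fun x hx ↦ ?_
    have hx' : 1 + fiberNormSq F ξ x ≤ C ^ 2 := (Real.sqrt_le_iff.1 hx).2
    exact le_sub_iff_add_le'.2 hx'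

end FiberNormDerivative

/-! ### Ricci curvature of small sphere bundles -/

section LocalParametrization

theorem isEmbedding_domRestrict_of_leftInverse {X Y : Type*} [TopologicalSpace X]
    [TopologicalSpace Y] {f : X → Y} {g : Y → X} {U : Set X} (hf : ContinuousOn f U)
    (hgf : ∀ x ∈ U, g (f x) = x) (hg : ∀ x ∈ U, ContinuousAt g (f x)) :
    IsEmbedding (U.domRestrict f) := by
  refine ⟨isInducing_iff_nhds.2 fun x ↦ le_antisymm ?_ ?_, fun x y hxy ↦ ?_⟩
  · exact (continuousOn_iff_continuous_domRestrict.1 hf).continuousAt.le_comap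
  · rw [nhds_subtype, ← tendsto_iff_comap]
    have hgx : Tendsto g (𝓝 (f x)) (𝓝 (x : X)) := by
      simpa only [ContinuousAt, hgf x x.2] using hg x x.2
    exact (hgx.comp (tendsto_comap (f := U.domRestrict f))).congr fun z ↦ hgf z z.2
  · have hfxy : f x = f y := hxy
    exact Subtype.ext (by rw [← hgf x x.2, hfxy, hgf y y.2])

variable {E : Type*} [NormedAddCommGroup E] [NormedSpace ℝ E]
  {H : Type*} [TopologicalSpace H] {I : ModelWithCorners ℝ E H}
  {N : Type*} [TopologicalSpace N] [ChartedSpace H N]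
  {d : ℕ} {S : Set N} {U : Set (EuclideanSpace ℝ (Fin d))} {φ : EuclideanSpace ℝ (Fin d) → N}

namespace IsLocalParametrization

theorem of_leftInverse {ψ : N → EuclideanSpace ℝ (Fin d)} {O : Set N} (hU : IsOpen U)
    (hφ : ContMDiffOn 𝓘(ℝ, EuclideanSpace ℝ (Fin d)) I ∞ φ U)
    (hψ : ∀ y ∈ U, ContMDiffAt I 𝓘(ℝ, EuclideanSpace ℝ (Fin d)) ∞ ψ (φ y))
    (hψφ : ∀ y ∈ U, ψ (φ y) = y) (hO : IsOpen O) (himage : φ '' U = O ∩ S) :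
    IsLocalParametrization I d S U φ where
  isOpen := hU
  smooth := hφ
  immersion y hy := by
    have hid : ψ ∘ φ =ᶠ[𝓝 y] id := by
      filter_upwards [hU.mem_nhds hy] with z hz using hψφ z hz
    refine Function.LeftInverse.injective (g := mvfderiv I ψ (φ y)) fun u ↦ ?_
    rw [mvfderiv_paramDeriv ((hψ y hy).mdifferentiableAt (by simp))
      ((hφ.contMDiffAt (hU.mem_nhds hy)).mdifferentiableAt (by simp)), hid.fderiv_eq, fderiv_id]
    rfl
  embedding := isEmbedding_domRestrict_of_leftInverse hφ.continuousOn hψφ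
    fun y hy ↦ (hψ y hy).continuousAt
  image_open := ⟨O, hO, himage⟩

theorem mapsTo (h : IsLocalParametrization I d S U φ) : MapsTo φ U S := by
  obtain ⟨O, -, hO⟩ := h.image_open
  exact fun y hy ↦ (hO.subset (mem_image_of_mem φ hy)).2

theorem isImmersionOn_extChartAt [IsManifold I ∞ N] [I.Boundaryless]
    (h : IsLocalParametrization I d S U φ) (x : N) :
    IsImmersionOn (extChartAt I x ∘ φ) (U ∩ φ ⁻¹' (extChartAt I x).source)
      (extChartAt I x).target where
  isOpen := h.smooth.continuousOn.isOpen_inter_preimage h.isOpen (isOpen_extChartAt_source x)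
  contDiffOn := by
    rw [← contMDiffOn_iff_contDiffOn]
    exact (contMDiffOn_extChartAt (I := I) (x := x)).comp (h.smooth.mono inter_subset_left)
      fun z hz ↦ by simpa only [extChartAt_source] using hz.2
  mapsTo z hz := (extChartAt I x).map_source hz.2
  injective z hz := by
    have hchain : fderiv ℝ (extChartAt I x ∘ φ) z =
        (mfderiv I 𝓘(ℝ, E) (extChartAt I x) (φ z)).comp (paramDeriv I φ z) := by
      rw [← mfderiv_eq_fderiv]
      exact mfderiv_comp z (mdifferentiableAt_extChartAt (extChartAt_source I x ▸ hz.2))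
        ((h.smooth.contMDiffAt (h.isOpen.mem_nhds hz.1)).mdifferentiableAt (by simp))
    rw [hchain]
    exact (isInvertible_mfderiv_extChartAt hz.2).injective.comp (h.immersion z hz.1)

end IsLocalParametrization

theorem isLocalParametrization_extChartAt_symm
    [ChartedSpace (EuclideanSpace ℝ (Fin d)) N] [IsManifold (𝓡 d) ∞ N] (p : N) :
    IsLocalParametrization (𝓡 d) d (univ : Set N) (extChartAt (𝓡 d) p).target
      (extChartAt (𝓡 d) p).symm :=
  .of_leftInverse (isOpen_extChartAt_target p) (contMDiffOn_extChartAt_symm p)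
    (fun y hy ↦ contMDiffAt_extChartAt' (extChartAt_source (𝓡 d) p ▸
      (extChartAt (𝓡 d) p).map_target hy))
    (fun y hy ↦ (extChartAt (𝓡 d) p).right_inv hy) (isOpen_extChartAt_source p)
    (by rw [inter_univ, (extChartAt (𝓡 d) p).symm_image_target_eq_source])

end LocalParametrization

section FiberNorm

variable {M : Type*} {F : Type*} {ξ : M → Type*}
  [∀ p, NormedAddCommGroup (ξ p)] [∀ p, InnerProductSpace ℝ (ξ p)]

theorem mem_sphereBundle_iff {r : ℝ} (hr : 0 ≤ r) {x : TotalSpace F ξ} :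
    x ∈ sphereBundle F ξ r ↔ ‖x.snd‖ = r := by
  rw [sphereBundle, mem_ofPred_eq, real_inner_self_eq_norm_sq,
    pow_left_inj₀ (norm_nonneg _) hr two_ne_zero]

variable [TopologicalSpace M] [CompactSpace M] [LocallyCompactSpace M]
  [NormedAddCommGroup F] [NormedSpace ℝ F] [FiniteDimensional ℝ F]
  [TopologicalSpace (TotalSpace F ξ)] [FiberBundle F ξ] [VectorBundle ℝ F ξ]
  [IsContinuousRiemannianBundle F ξ]

theorem exists_pos_forall_norm_snd_lt_mem (hcont : Continuous (fiberNormSq F ξ))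
    {O : Set (TotalSpace F ξ)} (hO : IsOpen O) (hzero : ∀ p, zeroSection F ξ p ∈ O) :
    ∃ r₀ > 0, ∀ x : TotalSpace F ξ, ‖x.snd‖ < r₀ → x ∈ O := by
  have hpos : ∀ x ∈ {x | fiberNormSq F ξ x ≤ 1} \ O, 0 < fiberNormSq F ξ x := fun x hx ↦ by
    refine (fiberNormSq_nonneg x).lt_of_ne' fun h ↦ hx.2 ?_
    convert hzero x.proj
    exact TotalSpace.ext rfl (heq_of_eq (inner_self_eq_zero.1 h))
  obtain ⟨c, hc, hle⟩ :=
    ((isCompact_fiberNormSq_le hcont 1).diff hO).exists_forall_le' hcont.continuousOn hpos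
  refine ⟨min 1 √c, lt_min one_pos (Real.sqrt_pos.2 hc), fun x hx ↦ by_contra fun hxO ↦ ?_⟩
  obtain ⟨hx1, hxc⟩ := lt_min_iff.1 hx
  have hcx : c ≤ ‖x.snd‖ ^ 2 := by
    rw [← fiberNormSq_eq_norm_sq]
    refine hle x ⟨?_, hxO⟩
    rw [mem_ofPred_eq, fiberNormSq_eq_norm_sq]
    exact pow_le_one₀ (norm_nonneg _) hx1.le
  exact hcx.not_gt ((Real.lt_sqrt (norm_nonneg _)).1 hxc)

end FiberNorm

section SphereRicci

variable {EM : Type*} [NormedAddCommGroup EM] [NormedSpace ℝ EM]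
  {H : Type*} [TopologicalSpace H] {I : ModelWithCorners ℝ EM H}
  {M : Type*} [TopologicalSpace M] [ChartedSpace H M]
  {F : Type*} [NormedAddCommGroup F] [NormedSpace ℝ F] [FiniteDimensional ℝ F]
  {ξ : M → Type*} [TopologicalSpace (TotalSpace F ξ)]
  [∀ p, NormedAddCommGroup (ξ p)] [∀ p, InnerProductSpace ℝ (ξ p)]
  [FiberBundle F ξ] [VectorBundle ℝ F ξ] [ContMDiffVectorBundle ∞ F ξ I]

/-- The quadratic form `w ↦ Ric(w, w) + (n - 2) / r² * ⟨K w, K w⟩` of the connection metric, in the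
coordinates of the total space given by the chart and the trivialization at `p`. On vectors tangent
to the sphere bundle of radius `r` it is the Ricci curvature of the induced metric. -/
def sphereRicciCoord (g : BilinearField I M) (D : CovariantDerivative I F ξ) (p : M) (r : ℝ)
    (y w : EM × F) : ℝ :=
  ricci (localMetric (pullbackMetric g (extChartAt I p).symm) (fiberMetricCoord I F ξ p)
      (connectionFormCoord D p)) y w w +
    (Module.finrank ℝ F - 2) / r ^ 2 * fiberMetricCoord I F ξ p y.1
      (localConnector (connectionFormCoord D p) y w) (localConnector (connectionFormCoord D p) y w)

variable [FiniteDimensional ℝ EM] [I.Boundaryless] [IsManifold I ∞ M]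
  [T2Space M] [IsContMDiffRiemannianBundle I ∞ F ξ]
  (g : ContMDiffRiemannianMetric I ∞ EM (fun p : M ↦ TangentSpace I p))
  (D : CovariantDerivative I F ξ) (hD : CovariantDerivative.ContMDiffCovariantDerivative D ∞)
  (hDmetric : D.IsMetricCompatible)

include g hD hDmetric

theorem ricci_pullbackMetric_connectionMetric (x₀ : TotalSpace F ξ) {d : ℕ}
    {U : Set (EuclideanSpace ℝ (Fin d))} {φ : EuclideanSpace ℝ (Fin d) → TotalSpace F ξ} {r : ℝ}
    (hr : r ≠ 0) (hφ : IsLocalParametrization (I.prod 𝓘(ℝ, F)) d (sphereBundle F ξ r) U φ)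
    (hdim : d + 1 = Module.finrank ℝ (EM × F)) {y : EuclideanSpace ℝ (Fin d)} (hy : y ∈ U)
    (hyx : φ y ∈ (extChartAt (I.prod 𝓘(ℝ, F)) x₀).source) (u : EuclideanSpace ℝ (Fin d)) :
    ricci (pullbackMetric (connectionMetric g.inner D) φ) y u u =
      sphereRicciCoord g.inner D x₀.proj r (extChartAt (I.prod 𝓘(ℝ, F)) x₀ (φ y))
        (fderiv ℝ (extChartAt (I.prod 𝓘(ℝ, F)) x₀ ∘ φ) y u) := by
  have hφ' := hφ.isImmersionOn_extChartAt x₀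
  have hsphere : ∀ z ∈ U ∩ φ ⁻¹' (extChartAt (I.prod 𝓘(ℝ, F)) x₀).source,
      fiberMetricCoord I F ξ x₀.proj (extChartAt (I.prod 𝓘(ℝ, F)) x₀ (φ z)).1
        (extChartAt (I.prod 𝓘(ℝ, F)) x₀ (φ z)).2 (extChartAt (I.prod 𝓘(ℝ, F)) x₀ (φ z)).2 =
      r ^ 2 := fun z hz ↦ by
    rw [← fiberNormSq_extChartAt_symm x₀ (fst_extChartAt_mem_coordDomain x₀ hz.2),
      (extChartAt (I.prod 𝓘(ℝ, F)) x₀).left_inv hz.2]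
    exact hφ.mapsTo hz.1
  have hinduced : pullbackMetric (connectionMetric g.inner D) φ =ᶠ[𝓝 y] inducedMetric
      (localMetric (pullbackMetric g.inner (extChartAt I x₀.proj).symm)
        (fiberMetricCoord I F ξ x₀.proj) (connectionFormCoord D x₀.proj))
      (extChartAt (I.prod 𝓘(ℝ, F)) x₀ ∘ φ) := by
    refine (pullbackMetric_eventuallyEq_inducedMetric (connectionMetric g.inner D) (x := x₀)
      hφ.isOpen (hφ.smooth.of_le (by simp)) hy hyx).trans ?_
    filter_upwards [hφ'.isOpen.mem_nhds ⟨hy, hyx⟩] with z hz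
    rw [inducedMetric, inducedMetric, Function.comp_apply, pullbackMetric_connectionMetric x₀ D
      g.inner (fst_extChartAt_mem_coordDomain x₀ hz.2)]
  rw [extChartAt_totalSpace_target] at hφ'
  rw [ricci_congr hinduced, (isConnectionData_coord D g hD hDmetric x₀.proj).ricci_inducedMetric
    hφ' hr hsphere (by simpa using hdim) ⟨hy, hyx⟩ u, sphereRicciCoord, Function.comp_apply]

/-- As `r → 0` the vertical term `(n - 2) / r²` blows up, while the horizontal directions keep the
positive Ricci curvature of the base. -/
theorem eventually_sphereRicciCoord_pos (hn : 3 ≤ Module.finrank ℝ F) {p : M}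
    (hpos : ∀ a : EM, a ≠ 0 →
      0 < ricci (pullbackMetric g.inner (extChartAt I p).symm) (extChartAt I p p) a a) :
    ∀ᶠ x : TotalSpace F ξ in 𝓝 (zeroSection F ξ p), x.snd ≠ 0 → ∀ w ≠ 0,
      0 < sphereRicciCoord g.inner D p ‖x.snd‖
        (extChartAt (I.prod 𝓘(ℝ, F)) (zeroSection F ξ p) x) w := by
  have hchart : Tendsto (extChartAt (I.prod 𝓘(ℝ, F)) (zeroSection F ξ p))
      (𝓝 (zeroSection F ξ p)) (𝓝 (extChartAt I p p, 0)) := by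
    have hbase := mem_baseSet_trivializationAt F ξ p
    have hval : extChartAt (I.prod 𝓘(ℝ, F)) (zeroSection F ξ p) (zeroSection F ξ p) =
        (extChartAt I p p, 0) := by
      rw [extChartAt_totalSpace _ _ hbase]
      exact congrArg (Prod.mk _) (congrArg Prod.snd (Trivialization.zeroSection ℝ _ hbase))
    exact hval ▸ continuousAt_extChartAt (zeroSection F ξ p)
  have hnorm : Tendsto (fun x : TotalSpace F ξ ↦ ‖x.snd‖ ^ 2)
      (𝓝[{x | x.snd ≠ 0}] zeroSection F ξ p) (𝓝[>] 0) := by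
    simp_rw [← fiberNormSq_eq_norm_sq]
    have hzero : fiberNormSq F ξ (zeroSection F ξ p) = 0 := inner_zero_left _
    refine tendsto_nhdsWithin_iff.2 ⟨?_, ?_⟩
    · exact hzero ▸ ((contMDiff_fiberNormSq F ξ I).continuous.tendsto _).mono_left
        nhdsWithin_le_nhds
    · filter_upwards [self_mem_nhdsWithin] with x hx using real_inner_self_pos.2 hx
  have hcoeff : Tendsto (fun x : TotalSpace F ξ ↦ ((Module.finrank ℝ F : ℝ) - 2) / ‖x.snd‖ ^ 2)
      (𝓝[{x | x.snd ≠ 0}] zeroSection F ξ p) atTop := by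
    have hn' : (0 : ℝ) < Module.finrank ℝ F - 2 := by
      have : (3 : ℝ) ≤ Module.finrank ℝ F := mod_cast hn
      linarith
    simp only [div_eq_mul_inv]
    exact (tendsto_inv_nhdsGT_zero.comp hnorm).const_mul_atTop hn'
  have hev := (isConnectionData_coord D g hD hDmetric p).eventually_ricci_add_pos
    (extChartAt_mem_coordDomain (mem_extChartAt_source p) (mem_baseSet_trivializationAt F ξ p)) hpos
  exact eventually_nhdsWithin_iff.1
    (((hchart.mono_left nhdsWithin_le_nhds).prodMk hcoeff).eventually hev)

theorem exists_forall_sphereBundle_sphereRicciCoord_pos [CompactSpace M]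
    (hn : 3 ≤ Module.finrank ℝ F)
    (hpos : ∀ p : M, ∀ a : EM, a ≠ 0 →
      0 < ricci (pullbackMetric g.inner (extChartAt I p).symm) (extChartAt I p p) a a) :
    ∃ r₀ > 0, ∀ r : ℝ, 0 < r → r < r₀ → ∀ x ∈ sphereBundle F ξ r,
      ∃ x₀ : TotalSpace F ξ, x ∈ (extChartAt (I.prod 𝓘(ℝ, F)) x₀).source ∧ ∀ w ≠ 0,
        0 < sphereRicciCoord g.inner D x₀.proj r (extChartAt (I.prod 𝓘(ℝ, F)) x₀ x) w := by
  have : LocallyCompactSpace M := Manifold.locallyCompact_of_finiteDimensional I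
  let P (x : TotalSpace F ξ) : Prop := x.snd ≠ 0 → ∃ x₀ : TotalSpace F ξ,
    x ∈ (extChartAt (I.prod 𝓘(ℝ, F)) x₀).source ∧ ∀ w ≠ 0,
      0 < sphereRicciCoord g.inner D x₀.proj ‖x.snd‖ (extChartAt (I.prod 𝓘(ℝ, F)) x₀ x) w
  have hP (p : M) : zeroSection F ξ p ∈ interior {x | P x} := by
    rw [mem_interior_iff_mem_nhds]
    filter_upwards [extChartAt_source_mem_nhds (I := I.prod 𝓘(ℝ, F)) (zeroSection F ξ p),
      eventually_sphereRicciCoord_pos g D hD hDmetric hn (hpos p)] with x hx hricci hx0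
    exact ⟨zeroSection F ξ p, hx, hricci hx0⟩
  have := isContinuousRiemannianBundle_of_contMDiff F ξ I
  obtain ⟨r₀, hr₀, hball⟩ := exists_pos_forall_norm_snd_lt_mem
    (contMDiff_fiberNormSq F ξ I).continuous isOpen_interior hP
  refine ⟨r₀, hr₀, fun r hr hrr₀ x hx ↦ ?_⟩
  obtain rfl := (mem_sphereBundle_iff hr.le).1 hx
  exact interior_subset (hball x hrr₀) (norm_pos_iff.1 hr)

theorem hasPositiveRicci_of_sphereRicciCoord_pos {r : ℝ} (hr : r ≠ 0) {d : ℕ}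
    (hdim : d + 1 = Module.finrank ℝ (EM × F))
    (hpos : ∀ x ∈ sphereBundle F ξ r, ∃ x₀ : TotalSpace F ξ,
      x ∈ (extChartAt (I.prod 𝓘(ℝ, F)) x₀).source ∧ ∀ w ≠ 0,
        0 < sphereRicciCoord g.inner D x₀.proj r (extChartAt (I.prod 𝓘(ℝ, F)) x₀ x) w) :
    HasPositiveRicci (connectionMetric g.inner D) d (sphereBundle F ξ r) := by
  intro U φ hφ y hy u hu
  obtain ⟨x₀, hx₀, hpos⟩ := hpos (φ y) (hφ.mapsTo hy)
  rw [ricci_pullbackMetric_connectionMetric g D hD hDmetric x₀ hr hφ hdim hy hx₀]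
  exact hpos _ fun h ↦
    hu ((hφ.isImmersionOn_extChartAt x₀).injective y ⟨hy, hx₀⟩ (h.trans (map_zero _).symm))

end SphereRicci

theorem hasPositiveRicci_sphereBundle {m d : ℕ}
    {M : Type*} [TopologicalSpace M] [ChartedSpace (EuclideanSpace ℝ (Fin m)) M]
    [IsManifold (𝓡 m) ∞ M] [T2Space M] [CompactSpace M]
    {F : Type*} [NormedAddCommGroup F] [NormedSpace ℝ F] [FiniteDimensional ℝ F]
    {ξ : M → Type*} [TopologicalSpace (TotalSpace F ξ)]
    [∀ p, NormedAddCommGroup (ξ p)] [∀ p, InnerProductSpace ℝ (ξ p)]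
    [FiberBundle F ξ] [VectorBundle ℝ F ξ] [ContMDiffVectorBundle ∞ F ξ (𝓡 m)]
    [IsContMDiffRiemannianBundle (𝓡 m) ∞ F ξ]
    (g : ContMDiffRiemannianMetric (𝓡 m) ∞ (EuclideanSpace ℝ (Fin m))
      (fun p : M ↦ TangentSpace (𝓡 m) p))
    (D : CovariantDerivative (𝓡 m) F ξ)
    (hD : CovariantDerivative.ContMDiffCovariantDerivative D ∞) (hDmetric : D.IsMetricCompatible)
    (hpos : HasPositiveRicci g.inner m (univ : Set M)) (hn : 3 ≤ Module.finrank ℝ F)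
    (hdim : d + 1 = Module.finrank ℝ (EuclideanSpace ℝ (Fin m) × F)) :
    ∃ r₀ : ℝ, 0 < r₀ ∧ ∀ r : ℝ, 0 < r → r < r₀ →
      HasPositiveRicci (connectionMetric g.inner D) d (sphereBundle F ξ r) := by
  obtain ⟨r₀, hr₀, h⟩ := exists_forall_sphereBundle_sphereRicciCoord_pos g D hD hDmetric hn
    fun p ↦ hpos _ _ (isLocalParametrization_extChartAt_symm p) _ (mem_extChartAt_target p)
  exact ⟨r₀, hr₀, fun r hr hrr₀ ↦
    hasPositiveRicci_of_sphereRicciCoord_pos g D hD hDmetric hr.ne' hdim (h r hr hrr₀)⟩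

/-! ### Isoparametric functions and principal curvatures -/

section RiemannianMetric

variable {E : Type*} [NormedAddCommGroup E] [NormedSpace ℝ E]
  {H : Type*} [TopologicalSpace H] {I : ModelWithCorners ℝ E H}
  {N : Type*} [TopologicalSpace N] [ChartedSpace H N]

theorem IsRiemannianMetric.pos [IsManifold I 1 N] {G : BilinearField I N}
    (hG : IsRiemannianMetric G) (x : N) (u : TangentSpace I x) (hu : u ≠ 0) : 0 < G x u u := by
  obtain ⟨g, hg⟩ := hG
  rw [← hg x]
  exact g.pos x u hu

theorem riemGradient_eq_of_forall [FiniteDimensional ℝ E] {G : BilinearField I N} {f : N → ℝ}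
    {x : N} (hpos : ∀ u, u ≠ 0 → 0 < G x u u) {X : TangentSpace I x}
    (h : ∀ w, G x X w = mvfderiv I f x w) : riemGradient G f x = X := by
  have hdf : mvfderiv I f x = G x X := ContinuousLinearMap.ext fun w ↦ (h w).symm
  have hinv : (G x).IsInvertible := isInvertible_of_pos (V := E) hpos
  rw [riemGradient, hdf, hinv.inverse_apply_eq]

theorem inverse_mfderiv_extChartAt_apply [I.Boundaryless] [IsManifold I 1 N] (p : N) (w : E) :
    ((mfderiv I 𝓘(ℝ, E) (extChartAt I p) p).inverse w : E) =
      paramDeriv I (extChartAt I p).symm (extChartAt I p p) w := by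
  have hinv := isInvertible_mfderiv_extChartAt (I := I) (mem_extChartAt_source (I := I) p)
  obtain ⟨u, rfl⟩ := hinv.bijective.surjective w
  rw [hinv.inverse_apply_eq.2 rfl]
  exact (paramDeriv_extChartAt_symm_mfderiv p (mem_extChartAt_source p) u).symm

end RiemannianMetric

section HorizontalVertical

variable {EM : Type*} [NormedAddCommGroup EM] [NormedSpace ℝ EM]
  {H : Type*} [TopologicalSpace H] {I : ModelWithCorners ℝ EM H}
  {M : Type*} [TopologicalSpace M] [ChartedSpace H M]
  {F : Type*} [NormedAddCommGroup F] [NormedSpace ℝ F]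
  {ξ : M → Type*} [TopologicalSpace (TotalSpace F ξ)]
  [∀ p, NormedAddCommGroup (ξ p)] [∀ p, InnerProductSpace ℝ (ξ p)]
  [FiberBundle F ξ] [VectorBundle ℝ F ξ]

variable (F ξ) in
theorem finrank_fiber (p : M) : Module.finrank ℝ (ξ p) = Module.finrank ℝ F :=
  ((trivializationAt F ξ p).continuousLinearEquivAt ℝ p
    (mem_baseSet_trivializationAt F ξ p)).toLinearEquiv.finrank_eq

variable (F ξ) in
theorem finiteDimensional_fiber [FiniteDimensional ℝ F] (p : M) : FiniteDimensional ℝ (ξ p) :=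
  ((trivializationAt F ξ p).continuousLinearEquivAt ℝ p
    (mem_baseSet_trivializationAt F ξ p)).symm.toLinearEquiv.finiteDimensional

theorem symmL_snd_extChartAt_totalSpace (x₀ : TotalSpace F ξ) {y : EM × F}
    (hy : y.1 ∈ coordDomain I F ξ x₀.proj) :
    (trivializationAt F ξ x₀.proj).symmL ℝ ((extChartAt (I.prod 𝓘(ℝ, F)) x₀).symm y).proj y.2 =
      ((extChartAt (I.prod 𝓘(ℝ, F)) x₀).symm y).snd := by
  rw [extChartAt_totalSpace_symm x₀ hy, Trivialization.symmL_apply _ hy.2]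

variable [I.Boundaryless] [IsManifold I 1 M] [FiniteDimensional ℝ F]
  [ContMDiffVectorBundle 1 F ξ I] (D : CovariantDerivative I F ξ)

theorem projDeriv_prod_connector_injective (x : TotalSpace F ξ) :
    Function.Injective ((projDeriv x).prod (connector D x)) := by
  let φ := (extChartAt (I.prod 𝓘(ℝ, F)) x).symm
  let y := extChartAt (I.prod 𝓘(ℝ, F)) x x
  have hy : y.1 ∈ coordDomain I F ξ x.proj :=
    fst_extChartAt_mem_coordDomain x (mem_extChartAt_source x)
  suffices h : ∀ z : TotalSpace F ξ, z = φ y →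
      Function.Injective ((projDeriv z).prod (connector D z)) from h x (extChartAt_to_inv x).symm
  rintro _ rfl
  refine (injective_iff_map_eq_zero _).2 fun u hu ↦ ?_
  obtain ⟨w, rfl⟩ := (isInvertible_paramDeriv_extChartAt_symm (I := I.prod 𝓘(ℝ, F))
    (mem_extChartAt_totalSpace_target hy)).bijective.surjective u
  have hbase : w.1 = 0 := by
    have h : (projDeriv (φ y) (paramDeriv (I.prod 𝓘(ℝ, F)) φ y w) : EM) = 0 := congrArg Prod.fst hu
    rw [projDeriv_paramDeriv x hy] at h
    exact (injective_iff_map_eq_zero _).1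
      (isInvertible_paramDeriv_extChartAt_symm hy.1).bijective.injective _ h
  have hproj : (φ y).proj ∈ (trivializationAt F ξ x.proj).baseSet := by
    rw [extChartAt_totalSpace_symm x hy]
    exact hy.2
  have hfiber : w.2 = 0 := by
    have h : connector D (φ y) (paramDeriv (I.prod 𝓘(ℝ, F)) φ y w) = 0 := congrArg Prod.snd hu
    rw [connector_paramDeriv x D hy, localConnector_apply, hbase, map_zero, zero_apply,
      add_zero] at h
    rw [← (trivializationAt F ξ x.proj).continuousLinearMapAt_symmL (R := ℝ) hproj w.2, h, map_zero]
  have hw : w = 0 := Prod.ext hbase hfiber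
  rw [hw, map_zero]

variable [FiniteDimensional ℝ EM]

/-- The splitting `u ↦ (dπ u, K u)` of the tangent space of the total space into its horizontal
and vertical parts. -/
def horizontalVerticalEquiv (x : TotalSpace F ξ) :
    TangentSpace (I.prod 𝓘(ℝ, F)) x ≃ₗ[ℝ] TangentSpace I x.proj × ξ x.proj :=
  have : FiniteDimensional ℝ (TangentSpace (I.prod 𝓘(ℝ, F)) x) :=
    inferInstanceAs (FiniteDimensional ℝ (EM × F))
  have : FiniteDimensional ℝ (TangentSpace I x.proj) := inferInstanceAs (FiniteDimensional ℝ EM)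
  have : FiniteDimensional ℝ (ξ x.proj) := finiteDimensional_fiber F ξ x.proj
  LinearEquiv.ofInjectiveOfFinrankEq ((projDeriv x).prod (connector D x) : _ →ₗ[ℝ] _)
    (projDeriv_prod_connector_injective D x) (by
      rw [Module.finrank_prod, finrank_fiber F ξ]
      exact Module.finrank_prod)

theorem horizontalVerticalEquiv_apply (x : TotalSpace F ξ)
    (u : TangentSpace (I.prod 𝓘(ℝ, F)) x) :
    horizontalVerticalEquiv D x u = (projDeriv x u, connector D x u) := rfl

/-- The `D`-vertical lift of `v` to `x`: the tangent vector `u` with `dπ u = 0` and `K u = v`. -/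
def verticalLift (x : TotalSpace F ξ) : ξ x.proj →ₗ[ℝ] TangentSpace (I.prod 𝓘(ℝ, F)) x :=
  (horizontalVerticalEquiv D x).symm.toLinearMap ∘ₗ LinearMap.inr ℝ (TangentSpace I x.proj) _

theorem verticalLift_injective (x : TotalSpace F ξ) : Function.Injective (verticalLift D x) :=
  (horizontalVerticalEquiv D x).symm.injective.comp LinearMap.inr_injective

theorem horizontalVerticalEquiv_verticalLift (x : TotalSpace F ξ) (v : ξ x.proj) :
    horizontalVerticalEquiv D x (verticalLift D x v) = (0, v) :=
  (horizontalVerticalEquiv D x).apply_symm_apply _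

theorem projDeriv_verticalLift (x : TotalSpace F ξ) (v : ξ x.proj) :
    projDeriv x (verticalLift D x v) = 0 :=
  congrArg Prod.fst (horizontalVerticalEquiv_verticalLift D x v)

theorem connector_verticalLift (x : TotalSpace F ξ) (v : ξ x.proj) :
    connector D x (verticalLift D x v) = v :=
  congrArg Prod.snd (horizontalVerticalEquiv_verticalLift D x v)

theorem verticalLift_symmL (x₀ : TotalSpace F ξ) {y : EM × F}
    (hy : y.1 ∈ coordDomain I F ξ x₀.proj) (b : F) :
    verticalLift D ((extChartAt (I.prod 𝓘(ℝ, F)) x₀).symm y)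
        ((trivializationAt F ξ x₀.proj).symmL ℝ ((extChartAt (I.prod 𝓘(ℝ, F)) x₀).symm y).proj b) =
      paramDeriv (I.prod 𝓘(ℝ, F)) (extChartAt (I.prod 𝓘(ℝ, F)) x₀).symm y (0, b) := by
  apply (horizontalVerticalEquiv D _).injective
  rw [horizontalVerticalEquiv_verticalLift, horizontalVerticalEquiv_apply,
    connector_paramDeriv x₀ D hy, localConnector_apply]
  refine Prod.ext ?_ (by simp)
  exact ((projDeriv_paramDeriv x₀ hy (0, b)).trans (map_zero _)).symm

/-- The Euler vector field `(p, v) ↦ v`, every fibre being tangent to itself. -/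
def eulerField (x : TotalSpace F ξ) : TangentSpace (I.prod 𝓘(ℝ, F)) x := verticalLift D x x.snd

theorem eulerField_extChartAt_symm (x₀ : TotalSpace F ξ) {y : EM × F}
    (hy : y.1 ∈ coordDomain I F ξ x₀.proj) :
    eulerField D ((extChartAt (I.prod 𝓘(ℝ, F)) x₀).symm y) =
      paramDeriv (I.prod 𝓘(ℝ, F)) (extChartAt (I.prod 𝓘(ℝ, F)) x₀).symm y (0, y.2) := by
  rw [← verticalLift_symmL D x₀ hy, symmL_snd_extChartAt_totalSpace x₀ hy, eulerField]

theorem readVectorField_smul_eulerField (x₀ : TotalSpace F ξ) (h : TotalSpace F ξ → ℝ)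
    {y : EM × F} (hy : y.1 ∈ coordDomain I F ξ x₀.proj) :
    readVectorField (extChartAt (I.prod 𝓘(ℝ, F)) x₀).symm (fun z ↦ h z • eulerField D z) y =
      h ((extChartAt (I.prod 𝓘(ℝ, F)) x₀).symm y) • ((0, y.2) : EM × F) := by
  rw [readVectorField, eulerField_extChartAt_symm D x₀ hy, ← map_smul]
  exact (isInvertible_paramDeriv_extChartAt_symm
    (mem_extChartAt_totalSpace_target hy)).inverse_apply_eq.2 rfl

end HorizontalVertical

section Isoparametric

variable {EM : Type*} [NormedAddCommGroup EM] [NormedSpace ℝ EM]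
  {H : Type*} [TopologicalSpace H] {I : ModelWithCorners ℝ EM H}
  {M : Type*} [TopologicalSpace M] [ChartedSpace H M]
  {F : Type*} [NormedAddCommGroup F] [NormedSpace ℝ F]
  {ξ : M → Type*} [TopologicalSpace (TotalSpace F ξ)]
  [∀ p, NormedAddCommGroup (ξ p)] [∀ p, InnerProductSpace ℝ (ξ p)]
  [FiberBundle F ξ] [VectorBundle ℝ F ξ]

theorem exists_mem_sphereBundle [Nontrivial F] (p : M) {r : ℝ} (hr : 0 ≤ r) :
    ∃ v : ξ p, (⟨p, v⟩ : TotalSpace F ξ) ∈ sphereBundle F ξ r := by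
  have : Nontrivial (ξ p) := ((trivializationAt F ξ p).continuousLinearEquivAt ℝ p
    (mem_baseSet_trivializationAt F ξ p)).toEquiv.nontrivial
  obtain ⟨v, hv⟩ := exists_norm_eq (ξ p) hr
  exact ⟨v, (mem_sphereBundle_iff hr).2 hv⟩

variable [FiniteDimensional ℝ EM] [FiniteDimensional ℝ F] [I.Boundaryless] [IsManifold I ∞ M]
  [T2Space M] [ContMDiffVectorBundle ∞ F ξ I] [IsContMDiffRiemannianBundle I ∞ F ξ]
  (g : ContMDiffRiemannianMetric I ∞ EM (fun p : M ↦ TangentSpace I p))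
  (D : CovariantDerivative I F ξ)
  (hD : CovariantDerivative.ContMDiffCovariantDerivative D ∞)
  (hDmetric : D.IsMetricCompatible)

include hD hDmetric

theorem riemGradient_fiberNormSq (x : TotalSpace F ξ) :
    riemGradient (connectionMetric g.inner D) (fiberNormSq F ξ) x = (2 : ℝ) • eulerField D x := by
  refine riemGradient_eq_of_forall
    ((isRiemannianMetric_connectionMetric g D hD hDmetric).pos x) fun w ↦ ?_
  rw [mvfderiv_fiberNormSq D hDmetric, map_smul, smul_apply, connectionMetric_apply,
    eulerField, projDeriv_verticalLift, connector_verticalLift, map_zero, zero_apply, zero_add,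
    smul_eq_mul]

theorem connectionMetric_riemGradient_fiberNormSq (x : TotalSpace F ξ) :
    connectionMetric g.inner D x
      (riemGradient (connectionMetric g.inner D) (fiberNormSq F ξ) x)
      (riemGradient (connectionMetric g.inner D) (fiberNormSq F ξ) x) =
    4 * fiberNormSq F ξ x := by
  rw [riemGradient_fiberNormSq g D hD hDmetric, map_smul, map_smul, smul_apply,
    connectionMetric_apply, eulerField, projDeriv_verticalLift, connector_verticalLift, map_zero,
    zero_add, fiberNormSq, smul_eq_mul, smul_eq_mul]
  ring

theorem levelUnitNormal_fiberNormSq (x : TotalSpace F ξ) :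
    levelUnitNormal (connectionMetric g.inner D) (fiberNormSq F ξ) x =
      (√(fiberNormSq F ξ x))⁻¹ • eulerField D x := by
  have hsqrt : √(4 * fiberNormSq F ξ x) = 2 * √(fiberNormSq F ξ x) := by
    rw [Real.sqrt_mul (by norm_num), show (4 : ℝ) = 2 ^ 2 by norm_num, Real.sqrt_sq (by norm_num)]
  rw [levelUnitNormal, connectionMetric_riemGradient_fiberNormSq g D hD hDmetric,
    riemGradient_fiberNormSq g D hD hDmetric, hsqrt, smul_smul, mul_inv_rev,
    inv_mul_cancel_right₀ two_ne_zero]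

theorem covDeriv_smul_eulerField_coord (x₀ : TotalSpace F ξ) {y : EM × F}
    (hy : y.1 ∈ coordDomain I F ξ x₀.proj) {h : TotalSpace F ξ → ℝ}
    (hh : DifferentiableAt ℝ (h ∘ (extChartAt (I.prod 𝓘(ℝ, F)) x₀).symm) y) (w : EM × F) :
    fderiv ℝ (readVectorField (extChartAt (I.prod 𝓘(ℝ, F)) x₀).symm
        fun z ↦ h z • eulerField D z) y w
      + christoffel
          (pullbackMetric (connectionMetric g.inner D) (extChartAt (I.prod 𝓘(ℝ, F)) x₀).symm) y w
          (readVectorField (extChartAt (I.prod 𝓘(ℝ, F)) x₀).symm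
            (fun z ↦ h z • eulerField D z) y) =
      fderiv ℝ (h ∘ (extChartAt (I.prod 𝓘(ℝ, F)) x₀).symm) y w • (0, y.2)
        + h ((extChartAt (I.prod 𝓘(ℝ, F)) x₀).symm y) •
          (0, localConnector (connectionFormCoord D x₀.proj) y w) := by
  let φ := (extChartAt (I.prod 𝓘(ℝ, F)) x₀).symm
  have hdomain : ∀ᶠ z : EM × F in 𝓝 y, z.1 ∈ coordDomain I F ξ x₀.proj :=
    continuous_fst.continuousAt.eventually
      ((isOpen_coordDomain (I := I) (F := F) (V := ξ) x₀.proj).mem_nhds hy)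
  have hread : readVectorField φ (fun z ↦ h z • eulerField D z)
      =ᶠ[𝓝 y] fun z ↦ (h ∘ φ) z • ((0, z.2) : EM × F) :=
    hdomain.mono fun z hz ↦ readVectorField_smul_eulerField D x₀ h hz
  have hmetric : pullbackMetric (connectionMetric g.inner D) φ =ᶠ[𝓝 y]
      localMetric (pullbackMetric g.inner (extChartAt I x₀.proj).symm)
        (fiberMetricCoord I F ξ x₀.proj) (connectionFormCoord D x₀.proj) :=
    hdomain.mono fun z hz ↦ pullbackMetric_connectionMetric x₀ D g.inner hz
  rw [hread.fderiv_eq, hread.self_of_nhds, (christoffel_congr hmetric).self_of_nhds]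
  exact (isConnectionData_coord D g hD hDmetric x₀.proj).covDeriv_smul_position hy hh w

theorem covDeriv_smul_eulerField {x : TotalSpace F ξ} {h : TotalSpace F ξ → ℝ}
    (hh : MDifferentiableAt (I.prod 𝓘(ℝ, F)) 𝓘(ℝ) h x)
    (u : TangentSpace (I.prod 𝓘(ℝ, F)) x) :
    covDeriv (connectionMetric g.inner D) (fun z ↦ h z • eulerField D z) x u =
      mvfderiv (I.prod 𝓘(ℝ, F)) h x u • eulerField D x +
        h x • verticalLift D x (connector D x u) := by
  let φ := (extChartAt (I.prod 𝓘(ℝ, F)) x).symm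
  let y := extChartAt (I.prod 𝓘(ℝ, F)) x x
  let w : EM × F := mfderiv (I.prod 𝓘(ℝ, F)) 𝓘(ℝ, EM × F) (extChartAt (I.prod 𝓘(ℝ, F)) x) x u
  have hx : x = φ y := (extChartAt_to_inv x).symm
  have hy : y.1 ∈ coordDomain I F ξ x.proj :=
    fst_extChartAt_mem_coordDomain x (mem_extChartAt_source x)
  have hφ : MDifferentiableAt 𝓘(ℝ, EM × F) (I.prod 𝓘(ℝ, F)) φ y :=
    mdifferentiableAt_extChartAt_symm (mem_extChartAt_totalSpace_target hy)
  have hhφ : MDifferentiableAt (I.prod 𝓘(ℝ, F)) 𝓘(ℝ) h (φ y) := hx ▸ hh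
  have htransport : ∀ (z : TotalSpace F ξ) (u' : EM × F), z = φ y →
      u' = paramDeriv (I.prod 𝓘(ℝ, F)) φ y w →
      (mvfderiv (I.prod 𝓘(ℝ, F)) h z (u' : TangentSpace (I.prod 𝓘(ℝ, F)) z) • eulerField D z +
        h z • verticalLift D z (connector D z u') : EM × F) =
      paramDeriv (I.prod 𝓘(ℝ, F)) φ y (fderiv ℝ (h ∘ φ) y w • (0, y.2) +
        (h ∘ φ) y • (0, localConnector (connectionFormCoord D x.proj) y w)) := by
    rintro _ _ rfl rfl
    rw [mvfderiv_paramDeriv hhφ hφ, eulerField_extChartAt_symm D x hy, connector_paramDeriv x D hy,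
      verticalLift_symmL D x hy, map_add, map_smul, map_smul]
    rfl
  have hcoord := congrArg (paramDeriv (I.prod 𝓘(ℝ, F)) φ y)
    (covDeriv_smul_eulerField_coord g D hD hDmetric x hy (hhφ.comp y hφ).differentiableAt w)
  exact ((inverse_mfderiv_extChartAt_apply x _).trans hcoord).trans (htransport x u hx
    (paramDeriv_extChartAt_symm_mfderiv x (mem_extChartAt_source x) u).symm).symm

theorem laplaceBeltrami_fiberNormSq (x : TotalSpace F ξ) :
    laplaceBeltrami (connectionMetric g.inner D) (fiberNormSq F ξ) x =
      2 * Module.finrank ℝ F := by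
  have : FiniteDimensional ℝ (TangentSpace I x.proj) := inferInstanceAs (FiniteDimensional ℝ EM)
  have : FiniteDimensional ℝ (ξ x.proj) := finiteDimensional_fiber F ξ x.proj
  have hgrad : riemGradient (connectionMetric g.inner D) (fiberNormSq F ξ) =
      fun z ↦ (2 : ℝ) • eulerField D z :=
    funext (riemGradient_fiberNormSq g D hD hDmetric)
  have hconj : (covDeriv (connectionMetric g.inner D)
      (riemGradient (connectionMetric g.inner D) (fiberNormSq F ξ)) x : _ →ₗ[ℝ] _) =
      (horizontalVerticalEquiv D x).symm.conj
        (LinearMap.prodMap 0 ((2 : ℝ) • LinearMap.id)) := by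
    ext u
    rw [hgrad]
    refine (covDeriv_smul_eulerField g D hD hDmetric mdifferentiableAt_const u).trans ?_
    rw [mvfderiv_const, zero_apply, zero_smul, zero_add, ← map_smul]
    rfl
  rw [laplaceBeltrami, hconj, LinearMap.trace_conj', LinearMap.trace_prodMap', map_zero, zero_add,
    map_smul, LinearMap.trace_id, finrank_fiber F ξ, smul_eq_mul]

variable (F ξ) in
theorem isIsoparametricFunction_fiberNormSq [Nonempty M] [Nontrivial F] :
    IsIsoparametricFunction (connectionMetric g.inner D) (fiberNormSq F ξ) := by
  obtain ⟨p⟩ := (inferInstance : Nonempty M)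
  obtain ⟨v, hv⟩ := exists_mem_sphereBundle (F := F) (ξ := ξ) p zero_le_one
  have hne : fiberNormSq F ξ ⟨p, v⟩ ≠ fiberNormSq F ξ ⟨p, 0⟩ := by
    have hv' : fiberNormSq F ξ ⟨p, v⟩ = 1 ^ 2 := hv
    have hzero : fiberNormSq F ξ ⟨p, 0⟩ = 0 := inner_zero_left _
    rw [hv', hzero]
    norm_num
  exact ⟨contMDiff_fiberNormSq F ξ I, ⟨⟨p, v⟩, ⟨p, 0⟩, hne⟩,
    ⟨fun t ↦ 4 * t, by fun_prop, connectionMetric_riemGradient_fiberNormSq g D hD hDmetric⟩,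
    ⟨fun _ ↦ 2 * Module.finrank ℝ F, continuous_const,
      laplaceBeltrami_fiberNormSq g D hD hDmetric⟩⟩

theorem isIsoparametricHypersurface_sphereBundle [Nonempty M] [Nontrivial F] {r : ℝ}
    (hr : 0 < r) :
    IsIsoparametricHypersurface (connectionMetric g.inner D) (sphereBundle F ξ r) := by
  obtain ⟨p⟩ := (inferInstance : Nonempty M)
  obtain ⟨v, hv⟩ := exists_mem_sphereBundle (F := F) (ξ := ξ) p hr.le
  refine ⟨fiberNormSq F ξ, r ^ 2, isIsoparametricFunction_fiberNormSq F ξ g D hD hDmetric, rfl,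
    ⟨_, hv⟩, fun x hx hdf ↦ ?_⟩
  have hfx : fiberNormSq F ξ x = r ^ 2 := hx
  have hgrad : riemGradient (connectionMetric g.inner D) (fiberNormSq F ξ) x = 0 := by
    rw [riemGradient, hdf, map_zero]
  have hnorm := connectionMetric_riemGradient_fiberNormSq g D hD hDmetric x
  rw [hgrad, map_zero, hfx] at hnorm
  linarith [pow_pos hr 2]

theorem covDeriv_levelUnitNormal_fiberNormSq {x : TotalSpace F ξ} (hx : fiberNormSq F ξ x ≠ 0)
    {u : TangentSpace (I.prod 𝓘(ℝ, F)) x}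
    (hu : mvfderiv (I.prod 𝓘(ℝ, F)) (fiberNormSq F ξ) x u = 0) :
    covDeriv (connectionMetric g.inner D)
        (levelUnitNormal (connectionMetric g.inner D) (fiberNormSq F ξ)) x u =
      (√(fiberNormSq F ξ x))⁻¹ • verticalLift D x (connector D x u) := by
  have hsqrt : DifferentiableAt ℝ (fun t : ℝ ↦ (√t)⁻¹) (fiberNormSq F ξ x) :=
    (differentiableAt_id.sqrt hx).inv
      (Real.sqrt_ne_zero'.2 ((fiberNormSq_nonneg x).lt_of_ne' hx))
  have hf := (contMDiff_fiberNormSq F ξ I).mdifferentiable (by simp) x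
  have hderiv : mvfderiv (I.prod 𝓘(ℝ, F)) (fun z ↦ (√(fiberNormSq F ξ z))⁻¹) x u = 0 :=
    (mvfderiv_comp_apply x hsqrt.mdifferentiableAt hf u).trans
      ((congrArg _ hu).trans (map_zero _))
  have hnormal : levelUnitNormal (connectionMetric g.inner D) (fiberNormSq F ξ) =
      fun z ↦ (√(fiberNormSq F ξ z))⁻¹ • eulerField D z :=
    funext (levelUnitNormal_fiberNormSq g D hD hDmetric)
  rw [hnormal, covDeriv_smul_eulerField g D hD hDmetric (h := fun z ↦ (√(fiberNormSq F ξ z))⁻¹)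
    (hsqrt.mdifferentiableAt.comp x hf), hderiv, zero_smul, zero_add]

variable {r : ℝ} (hr : 0 < r) {x : TotalSpace F ξ} (hx : x ∈ sphereBundle F ξ r)

include hr hx

theorem mem_principalSpace_fiberNormSq (κ : ℝ) (u : TangentSpace (I.prod 𝓘(ℝ, F)) x) :
    u ∈ principalSpace (connectionMetric g.inner D) (fiberNormSq F ξ) x κ ↔
      inner ℝ x.snd (connector D x u) = 0 ∧
        verticalLift D x (connector D x u) = (-(r * κ)) • u := by
  have hfx : fiberNormSq F ξ x = r ^ 2 := hx
  rw [principalSpace, Submodule.mem_inf, LinearMap.mem_ker, Module.End.mem_eigenspace_iff,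
    LinearMap.neg_apply, ContinuousLinearMap.coe_coe, ContinuousLinearMap.coe_coe]
  have hker : mvfderiv (I.prod 𝓘(ℝ, F)) (fiberNormSq F ξ) x u = 0 ↔
      inner ℝ x.snd (connector D x u) = 0 := by
    rw [mvfderiv_fiberNormSq D hDmetric, mul_eq_zero, or_iff_right two_ne_zero]
  rw [← hker]
  refine and_congr_right fun hu ↦ ?_
  rw [covDeriv_levelUnitNormal_fiberNormSq g D hD hDmetric (hfx ▸ (pow_pos hr 2).ne') hu, hfx,
    Real.sqrt_sq hr.le, neg_eq_iff_eq_neg, inv_smul_eq_iff₀ hr.ne', neg_smul, mul_smul, smul_neg]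

theorem finrank_principalSpace_zero :
    Module.finrank ℝ (principalSpace (connectionMetric g.inner D) (fiberNormSq F ξ) x 0) =
      Module.finrank ℝ EM := by
  have hker : principalSpace (connectionMetric g.inner D) (fiberNormSq F ξ) x 0 =
      LinearMap.ker (connector D x).toLinearMap := by
    ext u
    rw [mem_principalSpace_fiberNormSq g D hD hDmetric hr hx, mul_zero, neg_zero, zero_smul,
      (map_eq_zero_iff _ (verticalLift_injective D x))]
    exact ⟨And.right, fun h ↦ ⟨(congrArg _ h).trans (inner_zero_right _), h⟩⟩
  have hsurj : Function.Surjective (connector D x).toLinearMap :=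
    fun v ↦ ⟨verticalLift D x v, connector_verticalLift D x v⟩
  have : FiniteDimensional ℝ (TangentSpace (I.prod 𝓘(ℝ, F)) x) :=
    inferInstanceAs (FiniteDimensional ℝ (EM × F))
  have hrank := LinearMap.finrank_range_add_finrank_ker (connector D x).toLinearMap
  have htotal : Module.finrank ℝ (TangentSpace (I.prod 𝓘(ℝ, F)) x) =
      Module.finrank ℝ EM + Module.finrank ℝ F := Module.finrank_prod
  rw [LinearMap.range_eq_top.2 hsurj, finrank_top, finrank_fiber F ξ, htotal] at hrank
  rw [hker]
  omega

theorem finrank_principalSpace_neg_inv :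
    Module.finrank ℝ (principalSpace (connectionMetric g.inner D) (fiberNormSq F ξ) x (-1 / r)) =
      Module.finrank ℝ F - 1 := by
  have hvertical : principalSpace (connectionMetric g.inner D) (fiberNormSq F ξ) x (-1 / r) =
      (ℝ ∙ x.snd)ᗮ.map (verticalLift D x) := by
    ext u
    rw [mem_principalSpace_fiberNormSq g D hD hDmetric hr hx, mul_div_cancel₀ _ hr.ne', neg_neg,
      one_smul, Submodule.mem_map]
    constructor
    · rintro ⟨horth, hu⟩
      exact ⟨_, Submodule.mem_orthogonal_singleton_iff_inner_right.2 horth, hu⟩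
    · rintro ⟨v, hv, rfl⟩
      rw [connector_verticalLift]
      exact ⟨Submodule.mem_orthogonal_singleton_iff_inner_right.1 hv, rfl⟩
  have hne : x.snd ≠ 0 := norm_ne_zero_iff.1 (((mem_sphereBundle_iff hr.le).1 hx).symm ▸ hr.ne')
  have : FiniteDimensional ℝ (ξ x.proj) := finiteDimensional_fiber F ξ x.proj
  have hsum := (ℝ ∙ x.snd).finrank_add_finrank_orthogonal
  rw [finrank_span_singleton hne, finrank_fiber F ξ] at hsum
  rw [hvertical,
    ← ((ℝ ∙ x.snd)ᗮ.equivMapOfInjective _ (verticalLift_injective D x)).finrank_eq]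
  omega

end Isoparametric

/-! ### Local parametrizations of the sphere bundle -/

section CentralProjection

variable {X F : Type*} [NormedAddCommGroup F] [NormedSpace ℝ F]
  {k : X → F →L[ℝ] F →L[ℝ] ℝ} {r : ℝ} {ℓ : F →L[ℝ] ℝ} {v : F} {Ω : Set X}

/-- The central projection of the affine hyperplane `v + ker ℓ` onto the sphere of radius `r` of
the fibre metric `k y`, in each fibre `{y} × F`. -/
def sphereParam (k : X → F →L[ℝ] F →L[ℝ] ℝ) (r : ℝ) (ℓ : F →L[ℝ] ℝ) (v : F)
    (y : X × ℓ.ker) : X × F :=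
  (y.1, (r / √(k y.1 (v + y.2) (v + y.2))) • (v + y.2))

/-- The central projection onto the affine hyperplane `v + ker ℓ`, in each fibre `{y} × F`: a left
inverse of `sphereParam`, smooth off the hyperplane `ker ℓ`. -/
def sphereChart (hv : ℓ v = 1) (z : X × F) : X × ℓ.ker :=
  (z.1, (ℓ z.2)⁻¹ • ℓ.projKerOfRightInverse (.toSpanSingleton ℝ v) (fun t ↦ by simp [hv]) z.2)

theorem coe_sphereChart_snd (hv : ℓ v = 1) {z : X × F} (hz : ℓ z.2 ≠ 0) :
    ((sphereChart hv z).2 : F) = (ℓ z.2)⁻¹ • z.2 - v := by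
  rw [sphereChart, Submodule.coe_smul, ContinuousLinearMap.coe_projKerOfRightInverse_apply,
    ContinuousLinearMap.toSpanSingleton_apply, smul_sub, inv_smul_smul₀ hz]

theorem map_add_coe_ker (hv : ℓ v = 1) (s : ℓ.ker) : ℓ (v + s) = 1 := by
  rw [map_add, hv, show ℓ s = 0 from s.2, add_zero]

theorem add_coe_ker_ne_zero (hv : ℓ v = 1) (s : ℓ.ker) : v + (s : F) ≠ 0 :=
  fun h ↦ one_ne_zero ((map_add_coe_ker hv s).symm.trans ((congrArg ℓ h).trans (map_zero ℓ)))

theorem sphereParam_sphereChart (hr : 0 < r) (hv : ℓ v = 1) {z : X × F} (hz : 0 < ℓ z.2)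
    (hzr : k z.1 z.2 z.2 = r ^ 2) : sphereParam k r ℓ v (sphereChart hv z) = z := by
  have hadd : v + ((sphereChart hv z).2 : F) = (ℓ z.2)⁻¹ • z.2 := by
    rw [coe_sphereChart_snd hv hz.ne', add_sub_cancel]
  have hnorm : k (sphereChart hv z).1 ((ℓ z.2)⁻¹ • z.2) ((ℓ z.2)⁻¹ • z.2) = (r / ℓ z.2) ^ 2 := by
    rw [sphereChart, map_smul, map_smul, smul_apply, hzr, smul_eq_mul, smul_eq_mul]
    ring
  refine Prod.ext rfl ?_
  rw [sphereParam, hadd, hnorm, Real.sqrt_sq (by positivity), div_div_cancel₀ hr.ne',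
    smul_inv_smul₀ hz.ne']

variable [NormedAddCommGroup X] [NormedSpace ℝ X]

theorem contDiffAt_sphereChart (hv : ℓ v = 1) {z : X × F} (hz : ℓ z.2 ≠ 0) :
    ContDiffAt ℝ ∞ (sphereChart hv) z :=
  contDiffAt_fst.prodMk (((ℓ.contDiff.contDiffAt.comp z contDiffAt_snd).inv hz).smul
    ((ContinuousLinearMap.contDiff _).contDiffAt.comp z contDiffAt_snd))

namespace IsMetricOn

variable (hk : IsMetricOn k Ω) (hv : ℓ v = 1)

include hk hv

theorem add_coe_ker_pos {y : X × ℓ.ker} (hy : y.1 ∈ Ω) : 0 < k y.1 (v + y.2) (v + y.2) :=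
  hk.pos _ hy _ (add_coe_ker_ne_zero hv y.2)

theorem map_sphereParam_pos (hr : 0 < r) {y : X × ℓ.ker} (hy : y.1 ∈ Ω) :
    0 < ℓ (sphereParam k r ℓ v y).2 := by
  rw [sphereParam, map_smul, map_add_coe_ker hv, smul_eq_mul, mul_one]
  exact div_pos hr (Real.sqrt_pos.2 (hk.add_coe_ker_pos hv hy))

theorem apply_sphereParam {y : X × ℓ.ker} (hy : y.1 ∈ Ω) :
    k y.1 (sphereParam k r ℓ v y).2 (sphereParam k r ℓ v y).2 = r ^ 2 := by
  have hpos := hk.add_coe_ker_pos hv hy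
  rw [sphereParam, map_smul, map_smul, smul_apply, smul_eq_mul, smul_eq_mul, ← mul_assoc,
    div_mul_div_comm, Real.mul_self_sqrt hpos.le, div_mul_cancel₀ _ hpos.ne', sq]

theorem sphereChart_sphereParam (hr : 0 < r) {y : X × ℓ.ker} (hy : y.1 ∈ Ω) :
    sphereChart hv (sphereParam k r ℓ v y) = y := by
  have hpos := hk.map_sphereParam_pos hv hr hy
  refine Prod.ext rfl (Subtype.ext ?_)
  rw [coe_sphereChart_snd hv hpos.ne']
  rw [sphereParam, map_smul, map_add_coe_ker hv, smul_eq_mul, mul_one] at hpos ⊢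
  rw [inv_smul_smul₀ hpos.ne', add_sub_cancel_left]

theorem image_sphereParam (hr : 0 < r) :
    sphereParam k r ℓ v '' (Ω ×ˢ univ) =
      {z | z.1 ∈ Ω ∧ 0 < ℓ z.2 ∧ k z.1 z.2 z.2 = r ^ 2} := by
  ext z
  constructor
  · rintro ⟨y, hy, rfl⟩
    exact ⟨hy.1, hk.map_sphereParam_pos hv hr hy.1, hk.apply_sphereParam hv hy.1⟩
  · rintro ⟨hz, hzℓ, hzr⟩
    exact ⟨sphereChart hv z, ⟨hz, mem_univ _⟩, sphereParam_sphereChart hr hv hzℓ hzr⟩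

theorem contDiffOn_sphereParam : ContDiffOn ℝ ∞ (sphereParam k r ℓ v) (Ω ×ˢ univ) := by
  have hadd : ContDiff ℝ ∞ (fun y : X × ℓ.ker ↦ v + (y.2 : F)) :=
    contDiff_const.add (ℓ.ker.subtypeL.contDiff.comp contDiff_snd)
  have hnormSq : ContDiffOn ℝ ∞ (fun y : X × ℓ.ker ↦ k y.1 (v + y.2) (v + y.2)) (Ω ×ˢ univ) :=
    ((hk.contDiffOn.comp contDiff_fst.contDiffOn fun y hy ↦ hy.1).clm_apply
      hadd.contDiffOn).clm_apply hadd.contDiffOn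
  have hpos : ∀ y ∈ Ω ×ˢ (univ : Set ℓ.ker), 0 < k y.1 (v + y.2) (v + y.2) :=
    fun y hy ↦ hk.add_coe_ker_pos hv hy.1
  exact contDiffOn_fst.prodMk ((contDiffOn_const.div (hnormSq.sqrt fun y hy ↦ (hpos y hy).ne')
    fun y hy ↦ (Real.sqrt_pos.2 (hpos y hy)).ne').smul hadd.contDiffOn)

end IsMetricOn

end CentralProjection

section SphereBundle

variable {EM : Type*} [NormedAddCommGroup EM] [NormedSpace ℝ EM]
  {H : Type*} [TopologicalSpace H] {I : ModelWithCorners ℝ EM H}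
  {M : Type*} [TopologicalSpace M] [ChartedSpace H M] [I.Boundaryless] [IsManifold I ∞ M]
  {F : Type*} [NormedAddCommGroup F] [NormedSpace ℝ F] [FiniteDimensional ℝ F]
  {ξ : M → Type*} [TopologicalSpace (TotalSpace F ξ)]
  [∀ p, NormedAddCommGroup (ξ p)] [∀ p, InnerProductSpace ℝ (ξ p)]
  [FiberBundle F ξ] [VectorBundle ℝ F ξ] [ContMDiffVectorBundle ∞ F ξ I]
  [IsContMDiffRiemannianBundle I ∞ F ξ]
  {x : TotalSpace F ξ} {r : ℝ} {ℓ : F →L[ℝ] ℝ} {v : F}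

omit [I.Boundaryless] [IsManifold I ∞ M] [FiniteDimensional ℝ F] [ContMDiffVectorBundle ∞ F ξ I]
  [IsContMDiffRiemannianBundle I ∞ F ξ] in
theorem mem_sphereBundle_iff_extChartAt {z : TotalSpace F ξ}
    (hz : z ∈ (extChartAt (I.prod 𝓘(ℝ, F)) x).source) :
    z ∈ sphereBundle F ξ r ↔
      fiberMetricCoord I F ξ x.proj (extChartAt (I.prod 𝓘(ℝ, F)) x z).1
        (extChartAt (I.prod 𝓘(ℝ, F)) x z).2 (extChartAt (I.prod 𝓘(ℝ, F)) x z).2 = r ^ 2 := by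
  rw [← fiberNormSq_extChartAt_symm x (fst_extChartAt_mem_coordDomain x hz),
    (extChartAt (I.prod 𝓘(ℝ, F)) x).left_inv hz]
  rfl

theorem image_extChartAt_symm_comp_sphereParam (hr : 0 < r) (hv : ℓ v = 1) :
    ((extChartAt (I.prod 𝓘(ℝ, F)) x).symm ∘ sphereParam (fiberMetricCoord I F ξ x.proj) r ℓ v) ''
        (coordDomain I F ξ x.proj ×ˢ univ) =
      ((extChartAt (I.prod 𝓘(ℝ, F)) x).source ∩
        extChartAt (I.prod 𝓘(ℝ, F)) x ⁻¹' {z | 0 < ℓ z.2}) ∩ sphereBundle F ξ r := by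
  rw [image_comp, (isMetricOn_fiberMetricCoord x.proj).image_sphereParam hv hr,
    PartialEquiv.symm_image_eq_source_inter_preimage _
      fun z hz ↦ mem_extChartAt_totalSpace_target hz.1, inter_assoc]
  ext z
  refine and_congr_right fun hz ↦ ?_
  rw [mem_inter_iff, mem_sphereBundle_iff_extChartAt hz]
  exact and_iff_right (fst_extChartAt_mem_coordDomain x hz)

theorem isLocalParametrization_sphereBundle (hr : 0 < r) (hv : ℓ v = 1) {d : ℕ}
    (L : EuclideanSpace ℝ (Fin d) ≃L[ℝ] EM × ℓ.ker) :
    IsLocalParametrization (I.prod 𝓘(ℝ, F)) d (sphereBundle F ξ r)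
      (L ⁻¹' (coordDomain I F ξ x.proj ×ˢ univ))
      ((extChartAt (I.prod 𝓘(ℝ, F)) x).symm ∘
        sphereParam (fiberMetricCoord I F ξ x.proj) r ℓ v ∘ L) := by
  let χ := extChartAt (I.prod 𝓘(ℝ, F)) x
  let ψ := sphereParam (fiberMetricCoord I F ξ x.proj) r ℓ v
  have hk := isMetricOn_fiberMetricCoord (I := I) (F := F) (ξ := ξ) x.proj
  have hmaps : MapsTo (ψ ∘ L) (L ⁻¹' (coordDomain I F ξ x.proj ×ˢ univ)) χ.target :=
    fun y hy ↦ mem_extChartAt_totalSpace_target hy.1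
  have hχψ : ∀ y ∈ L ⁻¹' (coordDomain I F ξ x.proj ×ˢ univ), χ (χ.symm (ψ (L y))) = ψ (L y) :=
    fun y hy ↦ χ.right_inv (hmaps hy)
  have hψ : ContDiffOn ℝ ∞ (ψ ∘ L) (L ⁻¹' (coordDomain I F ξ x.proj ×ˢ univ)) :=
    (hk.contDiffOn_sphereParam hv).comp L.contDiff.contDiffOn fun y hy ↦ hy
  refine .of_leftInverse (ψ := fun z ↦ L.symm (sphereChart hv (χ z)))
    (O := χ.source ∩ χ ⁻¹' {z | 0 < ℓ z.2})
    ((hk.isOpen.prod isOpen_univ).preimage L.continuous)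
    ((contMDiffOn_extChartAt_symm x).comp hψ.contMDiffOn hmaps) (fun y hy ↦ ?_) (fun y hy ↦ ?_)
    ((continuousOn_extChartAt x).isOpen_inter_preimage (isOpen_extChartAt_source x)
      (isOpen_lt continuous_const (by fun_prop))) ?_
  · have hχ : ContMDiffAt (I.prod 𝓘(ℝ, F)) 𝓘(ℝ, EM × F) ∞ χ (χ.symm (ψ (L y))) :=
      contMDiffAt_extChartAt'
        (extChartAt_source (I.prod 𝓘(ℝ, F)) x ▸ χ.map_target (hmaps hy))
    have hchart : ContDiffAt ℝ ∞ (fun z ↦ L.symm (sphereChart hv z)) (χ (χ.symm (ψ (L y)))) := by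
      rw [hχψ y hy]
      exact L.symm.contDiff.contDiffAt.comp _
        (contDiffAt_sphereChart hv (hk.map_sphereParam_pos hv hr hy.1).ne')
    exact hchart.contMDiffAt.comp _ hχ
  · change L.symm (sphereChart hv (χ (χ.symm (ψ (L y))))) = y
    rw [hχψ y hy, hk.sphereChart_sphereParam hv hr hy.1, L.symm_apply_apply]
  · rw [← Function.comp_assoc, image_comp, image_preimage_eq _ L.surjective,
      image_extChartAt_symm_comp_sphereParam hr hv]

theorem isEmbeddedSubmanifold_sphereBundle [FiniteDimensional ℝ EM] (hr : 0 < r) {d : ℕ}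
    (hdim : d + 1 = Module.finrank ℝ (EM × F)) :
    IsEmbeddedSubmanifold (I.prod 𝓘(ℝ, F)) d (sphereBundle F ξ r) := by
  intro x hx
  let y := extChartAt (I.prod 𝓘(ℝ, F)) x x
  let ℓ : F →L[ℝ] ℝ := (r ^ 2)⁻¹ • fiberMetricCoord I F ξ x.proj y.1 y.2
  have hℓ : ℓ y.2 = 1 := by
    rw [smul_apply, (mem_sphereBundle_iff_extChartAt (mem_extChartAt_source x)).1 hx, smul_eq_mul,
      inv_mul_cancel₀ (pow_pos hr 2).ne']
  have hne : ℓ.toLinearMap ≠ 0 := fun h ↦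
    one_ne_zero (hℓ.symm.trans (DFunLike.congr_fun h y.2))
  have hrank : Module.finrank ℝ (EuclideanSpace ℝ (Fin d)) = Module.finrank ℝ (EM × ℓ.ker) := by
    have hker := Module.Dual.finrank_ker_add_one_of_ne_zero hne
    rw [Module.finrank_prod] at hdim ⊢
    rw [finrank_euclideanSpace_fin]
    omega
  let L := ContinuousLinearEquiv.ofFinrankEq hrank
  refine ⟨_, _, isLocalParametrization_sphereBundle (x := x) hr hℓ L, ?_⟩
  rw [← Function.comp_assoc, image_comp, image_preimage_eq _ L.surjective,
    image_extChartAt_symm_comp_sphereParam hr hℓ]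
  exact ⟨⟨mem_extChartAt_source x, zero_lt_one.trans_eq hℓ.symm⟩, hx⟩

end SphereBundle

end

theorem theorem1p2 {m n : ℕ} (hn : 1 ≤ n)
    {M : Type*} [TopologicalSpace M] [ChartedSpace (EuclideanSpace ℝ (Fin m)) M]
    [IsManifold (𝓡 m) ∞ M] [T2Space M] [CompactSpace M] [Nonempty M]
    (g : ContMDiffRiemannianMetric (𝓡 m) ∞ (EuclideanSpace ℝ (Fin m))
      (fun p : M ↦ TangentSpace (𝓡 m) p))
    {ξ : M → Type*} [TopologicalSpace (TotalSpace (EuclideanSpace ℝ (Fin n)) ξ)]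
    [∀ p, NormedAddCommGroup (ξ p)] [∀ p, InnerProductSpace ℝ (ξ p)]
    [FiberBundle (EuclideanSpace ℝ (Fin n)) ξ] [VectorBundle ℝ (EuclideanSpace ℝ (Fin n)) ξ]
    [ContMDiffVectorBundle ∞ (EuclideanSpace ℝ (Fin n)) ξ (𝓡 m)]
    [IsContMDiffRiemannianBundle (𝓡 m) ∞ (EuclideanSpace ℝ (Fin n)) ξ]
    (D : CovariantDerivative (𝓡 m) (EuclideanSpace ℝ (Fin n)) ξ)
    (hDsmooth : CovariantDerivative.ContMDiffCovariantDerivative D ∞)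
    (hDmetric : D.IsMetricCompatible) :
    -- the connection metric is a complete smooth Riemannian metric on the total space `E`
    IsRiemannianMetric (connectionMetric g.inner D) ∧
    IsCompleteMetric (connectionMetric g.inner D) ∧
    (ConnectedSpace M → ConnectedSpace (TotalSpace (EuclideanSpace ℝ (Fin n)) ξ)) ∧
    -- every sphere bundle is an isoparametric hypersurface, with constant principal curvatures
    (∀ r : ℝ, 0 < r →
      IsEmbeddedSubmanifold ((𝓡 m).prod 𝓘(ℝ, EuclideanSpace ℝ (Fin n))) (m + n - 1)
        (sphereBundle (EuclideanSpace ℝ (Fin n)) ξ r) ∧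
      IsIsoparametricHypersurface (connectionMetric g.inner D)
        (sphereBundle (EuclideanSpace ℝ (Fin n)) ξ r) ∧
      ∀ x ∈ sphereBundle (EuclideanSpace ℝ (Fin n)) ξ r,
        Module.finrank ℝ (principalSpace (connectionMetric g.inner D)
          (fiberNormSq (EuclideanSpace ℝ (Fin n)) ξ) x 0) = m ∧
        Module.finrank ℝ (principalSpace (connectionMetric g.inner D)
          (fiberNormSq (EuclideanSpace ℝ (Fin n)) ξ) x (-1 / r)) = n - 1) ∧
    -- positive Ricci curvature of small sphere bundles
    (HasPositiveRicci g.inner m (univ : Set M) → 3 ≤ n →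
      ∃ r₀ : ℝ, 0 < r₀ ∧ ∀ r : ℝ, 0 < r → r < r₀ →
        HasPositiveRicci (connectionMetric g.inner D) (m + n - 1)
          (sphereBundle (EuclideanSpace ℝ (Fin n)) ξ r)) := by
  have : Nontrivial (EuclideanSpace ℝ (Fin n)) :=
    Module.nontrivial_of_finrank_pos (R := ℝ) (by rw [finrank_euclideanSpace_fin]; exact hn)
  have hdim : m + n - 1 + 1 =
      Module.finrank ℝ (EuclideanSpace ℝ (Fin m) × EuclideanSpace ℝ (Fin n)) := by
    rw [Module.finrank_prod, finrank_euclideanSpace_fin, finrank_euclideanSpace_fin]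
    omega
  refine ⟨isRiemannianMetric_connectionMetric g D hDsmooth hDmetric,
    isCompleteMetric_connectionMetric D hDmetric g hDsmooth, fun _ ↦ connectedSpace_totalSpace,
    fun r hr ↦ ⟨isEmbeddedSubmanifold_sphereBundle hr hdim,
      isIsoparametricHypersurface_sphereBundle g D hDsmooth hDmetric hr, fun x hx ↦ ⟨?_, ?_⟩⟩,
    fun hpos hn3 ↦ hasPositiveRicci_sphereBundle g D hDsmooth hDmetric hpos
      (by rwa [finrank_euclideanSpace_fin]) hdim⟩
  · rw [finrank_principalSpace_zero g D hDsmooth hDmetric hr hx, finrank_euclideanSpace_fin]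
  · rw [finrank_principalSpace_neg_inv g D hDsmooth hDmetric hr hx, finrank_euclideanSpace_fin]
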